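/- All graphs are finite and simple. For a graph $G$ and vertices $u,v$ let $d_G(u,v)$ be the distance between $u$ and $v$ in $G$, with $d_G(u,v)=\infty$ and $2^{-\infty}=0$ if no path connects them. The closeness of $G$ is $C(G)=\sum_{u\in V(G)}\sum_{v\in V(G)\setminus\{u\}}2^{-d_G(u,v)}$, and the link residual closeness of a graph $G$ with at least one edge is $R^L(G)=\min\{C(G-e): e\in E(G)\}$ (and $R^L(G)=0$ if $G$ has no edge), where $G-e$ is obtained by deleting the edge $e$. A vertex $v$ of a connected graph $G$ is a cut vertex if $G-v$ is disconnected. For integers $a_1,\dots,a_m\ge 0$, let $K^{a_1,\dots,a_m}$ be the graph obtained from the complete graph with vertex set $\{v_1,\dots,v_m\}$ by attaching a pendant path of length $a_i$ at $v_i$ for each $i$ with $a_i>0$. Let $PK_{n,k}$ be the graph $K^{a_1,\dots,a_{n-k}}$ with $a_1\ge\dots\ge a_{n-k}$, $\sum_i a_i=k$ and $a_1-a_{n-k}\in\{0,1\}$. For $b_2\ge b_1\ge 3$ and $n=2(b_1+b_2)-3$, let $H_n(b_1,b_2)$ be the $n$-vertex graph consisting of two cliques of sizes $b_1$ and $b_2$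 with exactly one common vertex and a pendant edge at each vertex of these cliques other than the common one. **Theorem.** Let $G$ be a connected graph with $n$ vertices and exactly $k$ cut vertices, where $2\le k\le n-3$. Let $q,r$ be the integers with $k=(n-k)q+r$ and $0\le r<n-k$. 1. If $(n,k)=(9,5)$, then $R^L(G)\le 16$, with equality if and only if $G\cong H_9(3,3)$. 2. If $(n,k)\ne(9,5)$, then $R^L(G)\le B$, where $$B=2(n^2+k^2-2nk-3n+4k)-2^{-q}(2n^2+2k^2-4nk-7n+7k+1)+2^{-2q-1}(n^2+k^2-2nk-3n+3k+2)$$ if $r=0$, and $$B=(n-k)(2n-2k-6)+2k-2^{-q}\left((n-k)(2n-2k-r-6)+\frac{5r+1}{2}\right)+2^{-2q-2}\left(2(n-k-2)(n-k-r)+\frac{r^2-3r+2}{2}\right)$$ if $r\ge 1$. If moreover $(n,k)\ne(11,6)$, then $R^L(G)=B$ if and only if $G\cong PK_{n,k}$; if $(n,k)=(11,6)$, then $R^L(G)=B$ if and only if $G\cong PK_{11,6}$ or $G\cong H_{11}(3,4)$. -/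

import Mathlib

noncomputable section

open Classical in
/-- The number `2 ^ (-d)`, where `d` is the distance between `u` and `v` in `G`;
it is `0` if `u` and `v` lie in different components (so that `d = ∞`). -/
def distWeight {V : Type*} (G : SimpleGraph V) (u v : V) : ℝ :=
  if G.Reachable u v then (2 : ℝ) ^ (-(G.dist u v : ℤ)) else 0

open Classical in
/-- The closeness of the vertex `u` in `G`. -/
def vertexCloseness {V : Type*} [Fintype V] (G : SimpleGraph V) (u : V) : ℝ :=
  ∑ v ∈ Finset.univ.erase u, distWeight G u v

/-- The closeness of the graph `G`. -/
def closeness {V : Type*} [Fintype V] (G : SimpleGraph V) : ℝ :=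
  ∑ u, vertexCloseness G u

/-- The link residual closeness of `G`: the minimum of the closeness of `G - e` over the edges
`e` of `G`. The infimum is over a finite set, hence a minimum if `G` has an edge
(see `isLeast_linkResidualCloseness`), and it is `0` if `G` has no edge
(see `linkResidualCloseness_bot`). -/
def linkResidualCloseness {V : Type*} [Fintype V] (G : SimpleGraph V) : ℝ :=
  ⨅ e : G.edgeSet, closeness (G.deleteEdges {(e : Sym2 V)})

theorem isLeast_linkResidualCloseness {V : Type*} [Fintype V] (G : SimpleGraph V)
    (hG : G.edgeSet.Nonempty) :
    IsLeast {x : ℝ | ∃ e ∈ G.edgeSet, x = closeness (G.deleteEdges {e})}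
      (linkResidualCloseness G) := by
  have : Nonempty G.edgeSet := hG.to_subtype
  have : Finite G.edgeSet := inferInstance
  constructor
  · obtain ⟨e, he⟩ := exists_eq_ciInf_of_finite
      (f := fun e : G.edgeSet => closeness (G.deleteEdges {(e : Sym2 V)}))
    exact ⟨e, e.2, he.symm⟩
  · rintro x ⟨e, he, rfl⟩
    exact ciInf_le (Set.finite_range
      (fun e : G.edgeSet => closeness (G.deleteEdges {(e : Sym2 V)}))).bddBelow ⟨e, he⟩

theorem linkResidualCloseness_bot {V : Type*} [Fintype V] :
    linkResidualCloseness (⊥ : SimpleGraph V) = 0 := by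
  have : IsEmpty (⊥ : SimpleGraph V).edgeSet := by simp
  exact Real.iInf_of_isEmpty _

/-- A vertex `v` of a connected graph `G` is a cut vertex if `G - v` is disconnected. -/
def IsCutVertex {V : Type*} (G : SimpleGraph V) (v : V) : Prop :=
  ¬ (G.induce {v}ᶜ).Preconnected

/-- The graph `K^{a_1,…,a_m}`: the complete graph on `m` vertices with a pendant path of length
`a i` attached at its `i`-th vertex (no path if `a i = 0`). The vertex `⟨i, t⟩` is the vertex at
distance `t` from the clique on the `i`-th path, and `⟨i, 0⟩` is the `i`-th vertex of the clique. -/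
def cliqueWithPaths {m : ℕ} (a : Fin m → ℕ) : SimpleGraph (Σ i : Fin m, Fin (a i + 1)) :=
  SimpleGraph.fromRel fun x y =>
    ((x.2 : ℕ) = 0 ∧ (y.2 : ℕ) = 0) ∨ (x.1 = y.1 ∧ (y.2 : ℕ) = (x.2 : ℕ) + 1)

/-- The balanced nonincreasing sequence of `m` natural numbers with sum `s`
(see `eq_balancedSeq_iff`). -/
def balancedSeq (m s : ℕ) (i : Fin m) : ℕ :=
  s / m + if (i : ℕ) < s % m then 1 else 0

/-- `graphPK n k` is the graph `K^{a_1,…,a_{n-k}}` with `a_1 ≥ ⋯ ≥ a_{n-k}`, `a_1 + ⋯ + a_{n-k} = k`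
and `a_1 - a_{n-k} ≤ 1`. -/
def graphPK (n k : ℕ) : SimpleGraph (Σ i : Fin (n - k), Fin (balancedSeq (n - k) k i + 1)) :=
  cliqueWithPaths (balancedSeq (n - k) k)

theorem sum_balancedSeq {m : ℕ} (hm : 0 < m) (s : ℕ) : ∑ i, balancedSeq m s i = s := by
  have h : (Finset.univ.filter fun i : Fin m => (i : ℕ) < s % m).card = s % m := by
    rw [Fin.card_filter_val_lt]
    exact min_eq_right (Nat.mod_lt s hm).le
  simp only [balancedSeq, Finset.sum_add_distrib, Finset.sum_const, Finset.card_univ,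
    Fintype.card_fin, smul_eq_mul, Finset.sum_boole, Nat.cast_id, h]
  exact Nat.div_add_mod s m

/-- `balancedSeq m s` is the only nonincreasing sequence of `m` natural numbers with sum `s` whose
entries differ by at most one. -/
theorem eq_balancedSeq_iff {m : ℕ} (hm : 0 < m) (s : ℕ) (a : Fin m → ℕ) :
    a = balancedSeq m s ↔ Antitone a ∧ ∑ i, a i = s ∧ ∀ i j, a i ≤ a j + 1 := by
  have hanti : Antitone (balancedSeq m s) := by
    intro i j hij
    have hij' : (i : ℕ) ≤ j := hij
    simp only [balancedSeq]
    split_ifs <;> omega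
  have hbal : ∀ i j, balancedSeq m s i ≤ balancedSeq m s j + 1 := by
    intro i j
    simp only [balancedSeq]
    split_ifs <;> omega
  constructor
  · rintro rfl
    exact ⟨hanti, sum_balancedSeq hm s, hbal⟩
  · rintro ⟨ha, hs, hb⟩
    have key : ∀ b c : Fin m → ℕ, Antitone b → Antitone c → (∀ i j, b i ≤ b j + 1) →
        (∀ i j, c i ≤ c j + 1) → ∑ i, b i = ∑ i, c i → ∀ i, ¬ b i < c i := by
      intro b c hb hc hb1 hc1 hsum i hi
      have hle : ∀ j, b j ≤ c j := by
        intro j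
        rcases le_total i j with h | h
        · have h1 := hb h
          have h2 := hc1 i j
          omega
        · have h1 := hc h
          have h2 := hb1 j i
          omega
      exact (Finset.sum_lt_sum (fun j _ => hle j) ⟨i, Finset.mem_univ i, hi⟩).ne hsum
    have hsum : ∑ i, a i = ∑ i, balancedSeq m s i := by rw [hs, sum_balancedSeq hm s]
    funext i
    exact le_antisymm (not_lt.mp (key _ _ hanti ha hbal hb hsum.symm i))
      (not_lt.mp (key _ _ ha hanti hb hbal hsum i))

/-- The graph `H_n(b₁, b₂)` with `n = 2 (b₁ + b₂) - 3`: two cliques of sizes `b₁` and `b₂` with a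
common vertex, and a pendant edge at each vertex other than the common one. Here `none` is the
common vertex, the `some (x, false)` are the other vertices of the two cliques
(`x = Sum.inl i` in the first one, `x = Sum.inr j` in the second one), and `some (x, true)` is the
end of the pendant edge at `some (x, false)`. -/
def graphH (b₁ b₂ : ℕ) : SimpleGraph (Option ((Fin (b₁ - 1) ⊕ Fin (b₂ - 1)) × Bool)) :=
  SimpleGraph.fromRel fun u v =>
    (u = none ∧ ∃ x, v = some (x, false)) ∨
    (∃ i j, u = some (Sum.inl i, false) ∧ v = some (Sum.inl j, false)) ∨
    (∃ i j, u = some (Sum.inr i, false) ∧ v = some (Sum.inr j, false)) ∨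
    (∃ x, u = some (x, false) ∧ v = some (x, true))

/-- The upper bound, in terms of the order `n`, the number `k` of cut vertices, and the quotient
`q` and remainder `r` of `k` by `n - k`. -/
def cutVertexBound (n k q r : ℕ) : ℝ :=
  if r = 0 then
    2 * ((n : ℝ) ^ 2 + (k : ℝ) ^ 2 - 2 * n * k - 3 * n + 4 * k)
      - (2 : ℝ) ^ (-(q : ℤ)) *
        (2 * (n : ℝ) ^ 2 + 2 * (k : ℝ) ^ 2 - 4 * n * k - 7 * n + 7 * k + 1)
      + (2 : ℝ) ^ (-2 * (q : ℤ) - 1) *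
        ((n : ℝ) ^ 2 + (k : ℝ) ^ 2 - 2 * n * k - 3 * n + 3 * k + 2)
  else
    ((n : ℝ) - k) * (2 * n - 2 * k - 6) + 2 * k
      - (2 : ℝ) ^ (-(q : ℤ)) *
        (((n : ℝ) - k) * (2 * n - 2 * k - r - 6) + (5 * r + 1) / 2)
      + (2 : ℝ) ^ (-2 * (q : ℤ) - 2) *
        (2 * ((n : ℝ) - k - 2) * (n - k - r) + ((r : ℝ) ^ 2 - 3 * r + 2) / 2)

end

/-!
Adding edges to a connected graph raises its link residual closeness (`linkResidualCloseness_lt`),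
so one may complete every block of `G`, which does not change the cut vertices, and assume that `G`
is a tree of cliques (`exists_isRep`). Such a graph is encoded by a list of
rooted trees of cliques (`BTree`), the branches at one of its blocks, and `IsRep` allows to pass
from one block to another. The closeness of the graph, also after the removal of an edge, is a
polynomial in the weights `∑ 2 ^ (-d)` of the branches seen from their roots
(`closeness_listGraph`, `closeness_deleteEdges_pair`, `closeness_deleteEdges_of_three`).

For the upper bound one exhibits in each graph with `m = n - k` vertices that are no cut vertices
an edge whose removal is expensive. The parts that remain are compared with complete graphs with
pendant paths: a branch can be replaced by paths with the same numbers of cut vertices and of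
other vertices without lowering the closeness, as long as enough weight is attached to it
(`exists_paths_of_list`, `BTree.Good.exists_starBound`), and the paths are best when balanced
(`slotScore_le_balanced`). The bound of the theorem is `cutValue n m k a` with `a = ⌈k / m⌉`: what
remains if a path with `a` vertices is cut off at the clique of the balanced graph.
* If there is a bridge neither side of which is a pendant path, delete it
  (`IsRep.lt_cutValue_of_bridge`).
* Otherwise, if there is a pendant path with at least `a` vertices, cut off a longest one
  (`IsRep.le_cutValue_of_pendant`). Equality holds only for the balanced graph.
* Otherwise, if `a = 1`, there is no bridge, and one deletes an edge of an end block
  (`IsRep.lt_cutValue_of_no_bridge`).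
* Otherwise, by counting, some pendant path has exactly `a - 1` vertices besides its end in a
  clique (`IsRep.exists_long_path`), and one cuts it off (`IsRep.le_cutValue_of_long`). This is
  good enough, unless the graph consists of two cliques with a common vertex and pendant paths
  of equal length at all other vertices, where the sizes `3, 3` and `3, 4` with pendant edges are
  exceptional.

For the lower bounds for the extremal graphs, every edge lies either in a path or in a clique at
which the graph can be rooted, and the loss caused by its removal is computed from the weights
(`IsBalancedPaths.cutValue_le`, `IsTwoCliques.le_residual`).
-/

namespace CutVertexCloseness

/-! ### Multisets of path lengths -/

/-- The total weight `∑ 2 ^ (-d)` seen from one end of a path with `j + 1` vertices. -/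
noncomputable def slot (j : ℕ) : ℝ := 2 - (1 / 2) ^ j

/-- The sum of the weights of the paths with lengths in `V`. -/
noncomputable def slotSum (V : Multiset ℕ) : ℝ := (V.map slot).sum

/-- The second elementary symmetric function of the weights of the paths with lengths in `V`. -/
noncomputable def slotPairs (V : Multiset ℕ) : ℝ :=
  (slotSum V ^ 2 - (V.map fun j => slot j ^ 2).sum) / 2

/-- The closeness of a complete graph with pendant paths, the lengths of which form `V`. -/
noncomputable def pathsCloseness (V : Multiset ℕ) : ℝ :=
  2 * ((V.sum : ℝ) + V.card) - 2 * slotSum V + slotPairs V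

/-- The part of the closeness of a complete graph with pendant paths of lengths `0` and `V` that
depends on how the lengths are distributed. -/
noncomputable def slotScore (V : Multiset ℕ) : ℝ := slotPairs V - slotSum V

theorem half_pow_pos (j : ℕ) : (0 : ℝ) < (1 / 2) ^ j := by positivity

theorem half_pow_le_one (j : ℕ) : ((1 : ℝ) / 2) ^ j ≤ 1 :=
  pow_le_one₀ (by norm_num) (by norm_num)

theorem half_pow_le_half_pow {i j : ℕ} (h : i ≤ j) : ((1 : ℝ) / 2) ^ j ≤ (1 / 2) ^ i :=
  pow_le_pow_of_le_one (by norm_num) (by norm_num) h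

theorem one_le_slot (j : ℕ) : 1 ≤ slot j := by
  have := half_pow_le_one j
  unfold slot; linarith

theorem slot_lt_two (j : ℕ) : slot j < 2 := by
  have := half_pow_pos j
  unfold slot; linarith

theorem slot_mono {i j : ℕ} (h : i ≤ j) : slot i ≤ slot j := by
  have := half_pow_le_half_pow h
  unfold slot; linarith

theorem slot_succ (j : ℕ) : slot (j + 1) = 1 + slot j / 2 := by
  unfold slot; rw [pow_succ]; ring

@[simp] theorem slot_zero : slot 0 = 1 := by norm_num [slot]

theorem slot_one : slot 1 = 3 / 2 := by norm_num [slot]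

theorem slot_two : slot 2 = 7 / 4 := by norm_num [slot]

@[simp] theorem slotSum_zero : slotSum 0 = 0 := by simp [slotSum]

@[simp] theorem slotSum_cons (j : ℕ) (V : Multiset ℕ) :
    slotSum (j ::ₘ V) = slot j + slotSum V := by simp [slotSum]

@[simp] theorem slotSum_add (U V : Multiset ℕ) :
    slotSum (U + V) = slotSum U + slotSum V := by simp [slotSum]

@[simp] theorem slotPairs_zero : slotPairs 0 = 0 := by simp [slotPairs]

@[simp] theorem slotPairs_cons (j : ℕ) (V : Multiset ℕ) :
    slotPairs (j ::ₘ V) = slotPairs V + slot j * slotSum V := by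
  simp [slotPairs]; ring

@[simp] theorem slotPairs_add (U V : Multiset ℕ) :
    slotPairs (U + V) = slotPairs U + slotPairs V + slotSum U * slotSum V := by
  simp [slotPairs]; ring

@[simp] theorem slotSum_singleton (j : ℕ) : slotSum {j} = slot j := by simp [slotSum]

@[simp] theorem slotPairs_singleton (j : ℕ) : slotPairs {j} = 0 := by simp [slotPairs]

theorem card_le_slotSum (V : Multiset ℕ) : (V.card : ℝ) ≤ slotSum V := by
  induction V using Multiset.induction_on with
  | empty => simp
  | cons j V ih =>
    have := one_le_slot j
    simp only [Multiset.card_cons, slotSum_cons, Nat.cast_add, Nat.cast_one]; linarith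

theorem slotSum_nonneg (V : Multiset ℕ) : 0 ≤ slotSum V :=
  (Nat.cast_nonneg _).trans (card_le_slotSum V)

/-- A path of positive length has weight at least `3 / 2`. -/
theorem card_add_half_le_slotSum {V : Multiset ℕ} (h : 0 < V.sum) :
    (V.card : ℝ) + 1 / 2 ≤ slotSum V := by
  obtain ⟨j, hj, hj0⟩ : ∃ j ∈ V, j ≠ 0 := by
    by_contra! hc
    exact h.ne' (Multiset.sum_eq_zero hc)
  obtain ⟨V, rfl⟩ := Multiset.exists_cons_of_mem hj
  have h1 := card_le_slotSum V
  have h2 := slot_mono (Nat.one_le_iff_ne_zero.mpr hj0)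
  rw [slot_one] at h2
  simp only [Multiset.card_cons, slotSum_cons, Nat.cast_add, Nat.cast_one]; linarith

theorem pathsCloseness_cons (j : ℕ) (V : Multiset ℕ) :
    pathsCloseness (j ::ₘ V) =
      pathsCloseness V + 2 * (j + 1) - 2 * slot j + slot j * slotSum V := by
  simp [pathsCloseness]; ring

theorem pathsCloseness_add (U V : Multiset ℕ) :
    pathsCloseness (U + V) = pathsCloseness U + pathsCloseness V + slotSum U * slotSum V := by
  simp [pathsCloseness]; ring

theorem pathsCloseness_singleton (j : ℕ) :
    pathsCloseness {j} = 2 * (j + 1) - 2 * slot j := by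
  simp [pathsCloseness]

/-- Making two lengths more equal increases the score. -/
theorem slotScore_balance_lt (y d : ℕ) (V : Multiset ℕ) :
    slotScore ((y + 2 + d) ::ₘ y ::ₘ V) < slotScore ((y + 1 + d) ::ₘ (y + 1) ::ₘ V) := by
  have hS := slotSum_nonneg V
  have hy := half_pow_pos y
  have hd := half_pow_le_one d
  have hd0 := half_pow_pos d
  simp only [slotScore, slotPairs_cons, slotSum_cons, slot, pow_add, pow_one]
  set A := ((1 : ℝ) / 2) ^ y
  set D := ((1 : ℝ) / 2) ^ d
  have key : 0 < (1 + slotSum V) * (A / 4 * (2 - D)) := by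
    have : 0 < 2 - D := by linarith
    positivity
  nlinarith [key]

theorem slotScore_succ_le (x : ℕ) {V : Multiset ℕ} (hV : V ≠ 0) :
    slotScore (x ::ₘ V) ≤ slotScore ((x + 1) ::ₘ V) := by
  have h1 : (1 : ℝ) ≤ slotSum V := by
    refine le_trans ?_ (card_le_slotSum V)
    exact_mod_cast Multiset.card_pos.mpr hV
  have h2 := slot_mono (Nat.le_succ x)
  simp only [Nat.succ_eq_add_one] at h2
  simp only [slotScore, slotPairs_cons, slotSum_cons]
  nlinarith

/-- The multiset of `M` natural numbers with sum `s` that differ by at most one. -/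
def balanced (M s : ℕ) : Multiset ℕ :=
  Multiset.replicate (s % M) (s / M + 1) + Multiset.replicate (M - s % M) (s / M)

theorem card_balanced {M : ℕ} (hM : 0 < M) (s : ℕ) : (balanced M s).card = M := by
  have := Nat.mod_lt s hM
  simp [balanced]; omega

theorem sum_balanced {M : ℕ} (hM : 0 < M) (s : ℕ) : (balanced M s).sum = s := by
  have h1 := Nat.mod_lt s hM
  have h2 := Nat.div_add_mod s M
  simp only [balanced, Multiset.sum_add, Multiset.sum_replicate, smul_eq_mul]
  obtain ⟨c, hc⟩ : ∃ c, M = s % M + c := ⟨M - s % M, by omega⟩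
  have h3 : M - s % M = c := by omega
  rw [h3]
  calc _ = (s % M + c) * (s / M) + s % M := by ring
    _ = s := by rw [← hc]; exact h2

theorem eq_balanced {V : Multiset ℕ} (hV : V ≠ 0) (h : ∀ x ∈ V, ∀ y ∈ V, x ≤ y + 1) :
    V = balanced V.card V.sum := by
  obtain ⟨y, hy, hmin⟩ : ∃ y ∈ V, ∀ x ∈ V, y ≤ x := by
    obtain ⟨z, hz⟩ := Multiset.exists_mem_of_ne_zero hV
    obtain ⟨y, hy, hmin⟩ := Finset.exists_min_image V.toFinset id ⟨z, by simpa using hz⟩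
    exact ⟨y, by simpa using hy, fun x hx => hmin x (by simpa using hx)⟩
  have hsplit : ∃ c d, V = Multiset.replicate c (y + 1) + Multiset.replicate d y := by
    refine ⟨(V.filter (· = y + 1)).card, (V.filter (¬ · = y + 1)).card, ?_⟩
    conv_lhs => rw [← Multiset.filter_add_not (· = y + 1) V]
    congr 1
    · exact Multiset.eq_replicate_card.mpr fun x hx => (Multiset.mem_filter.mp hx).2
    · refine Multiset.eq_replicate_card.mpr fun x hx => ?_
      have hx' := Multiset.mem_filter.mp hx
      have h1 := hmin x hx'.1
      have h2 := h x hx'.1 y hy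
      have h3 := hx'.2
      omega
  obtain ⟨c, d, hcd⟩ := hsplit
  have hd : 0 < d := by
    rw [hcd, Multiset.mem_add] at hy
    rcases hy with hy | hy
    · have := Multiset.eq_of_mem_replicate hy; omega
    · by_contra h0
      simp [Nat.eq_zero_of_not_pos h0] at hy
  have hcard : V.card = c + d := by simp [hcd]
  have hsum : V.sum = (c + d) * y + c := by simp [hcd]; ring
  have hmod : V.sum % V.card = c := by
    rw [hcard, hsum, Nat.mul_add_mod]; exact Nat.mod_eq_of_lt (by omega)
  have hdiv : V.sum / V.card = y := by
    rw [hcard, hsum, Nat.mul_add_div (by omega), Nat.div_eq_of_lt (by omega)]; rfl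
  rw [balanced, hmod, hdiv, hcard, show c + d - c = d by omega]
  exact hcd

/-- If two entries differ by at least two, moving one unit between them gives a multiset of the
same size and sum and of larger score. -/
theorem exists_slotScore_lt {V : Multiset ℕ} {x y : ℕ} (hx : x ∈ V) (hy : y ∈ V)
    (hxy : y + 1 < x) :
    ∃ V' : Multiset ℕ, V'.card = V.card ∧ V'.sum = V.sum ∧ slotScore V < slotScore V' ∧
      (V'.map fun j => j ^ 2).sum < (V.map fun j => j ^ 2).sum := by
  obtain ⟨W, rfl⟩ := Multiset.exists_cons_of_mem hx
  have hy' : y ∈ W := by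
    rcases Multiset.mem_cons.mp hy with h | h
    · omega
    · exact h
  obtain ⟨U, rfl⟩ := Multiset.exists_cons_of_mem hy'
  obtain ⟨d, rfl⟩ : ∃ d, x = y + 2 + d := ⟨x - (y + 2), by omega⟩
  refine ⟨(y + 1 + d) ::ₘ (y + 1) ::ₘ U, by simp, by simp; ring,
    slotScore_balance_lt y d U, ?_⟩
  simp only [Multiset.map_cons, Multiset.sum_cons]
  nlinarith

/-- Among the multisets of given size and sum, the balanced one has the largest score. -/
theorem slotScore_le_balanced_of_sum_eq (V : Multiset ℕ) :
    slotScore V ≤ slotScore (balanced V.card V.sum) ∧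
      (slotScore V = slotScore (balanced V.card V.sum) → V = balanced V.card V.sum) := by
  induction hN : (V.map fun j => j ^ 2).sum using Nat.strong_induction_on generalizing V with
  | _ N ih =>
    by_cases hV : V = 0
    · subst hV; simp [balanced]
    by_cases hb : ∀ x ∈ V, ∀ y ∈ V, x ≤ y + 1
    · have h := eq_balanced hV hb
      exact ⟨by rw [← h], fun _ => h⟩
    · push Not at hb
      obtain ⟨x, hx, y, hy, hxy⟩ := hb
      obtain ⟨V', h1, h2, h3, h4⟩ := exists_slotScore_lt hx hy hxy
      have := (ih _ (hN ▸ h4) V' rfl).1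
      rw [h1, h2] at this
      exact ⟨(h3.trans_le this).le, fun h => absurd h (h3.trans_le this).ne⟩

theorem slotScore_le_balanced {M s : ℕ} (hM : 2 ≤ M) (V : Multiset ℕ) (hV : V.card = M)
    (hs : V.sum ≤ s) : slotScore V ≤ slotScore (balanced M s) := by
  obtain ⟨d, rfl⟩ := Nat.exists_eq_add_of_le hs
  induction d generalizing V with
  | zero => simpa [hV] using (slotScore_le_balanced_of_sum_eq V).1
  | succ d ih =>
    obtain ⟨x, hx⟩ := Multiset.card_pos_iff_exists_mem.mp (by omega : 0 < V.card)
    obtain ⟨U, rfl⟩ := Multiset.exists_cons_of_mem hx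
    have hU : U ≠ 0 := by rintro rfl; simp at hV; omega
    have h := ih ((x + 1) ::ₘ U) (by simpa using hV) (by simp)
    have e : ((x + 1) ::ₘ U).sum + d = (x ::ₘ U).sum + (d + 1) := by simp; ring
    rw [e] at h
    exact (slotScore_succ_le x hU).trans h

theorem slotScore_lt_balanced_of_unbalanced {M s : ℕ} (hM : 2 ≤ M) (V : Multiset ℕ)
    (hV : V.card = M) (hs : V.sum ≤ s) {x y : ℕ} (hx : x ∈ V) (hy : y ∈ V) (hxy : y + 1 < x) :
    slotScore V < slotScore (balanced M s) := by
  obtain ⟨V', h1, h2, h3, -⟩ := exists_slotScore_lt hx hy hxy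
  exact h3.trans_le (slotScore_le_balanced hM V' (h1.trans hV) (h2 ▸ hs))

/-- The closeness that is left when a pendant path with `b` vertices is cut off at the clique
from a complete graph with `m` balanced pendant paths; `n` is the number of vertices and `k` the
sum of the lengths of the paths. -/
noncomputable def cutValue (n m k b : ℕ) : ℝ :=
  2 * n - 6 + 4 * (1 / 2) ^ b + slotScore (balanced (m - 1) (k - b))

theorem cutValue_lt {n m k a b : ℕ} (hm : 3 ≤ m) (hab : a < b) :
    cutValue n m k b < cutValue n m k a := by
  have h1 : slotScore (balanced (m - 1) (k - b)) ≤ slotScore (balanced (m - 1) (k - a)) :=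
    slotScore_le_balanced (by omega) _ (card_balanced (by omega) _)
      (by rw [sum_balanced (by omega)]; omega)
  have h2 : ((1 : ℝ) / 2) ^ b < (1 / 2) ^ a :=
    pow_lt_pow_right_of_lt_one₀ (by norm_num) (by norm_num) hab
  unfold cutValue
  linarith

theorem slotSum_replicate (c j : ℕ) : slotSum (Multiset.replicate c j) = c * slot j := by
  simp [slotSum]

theorem slotPairs_replicate (c j : ℕ) :
    slotPairs (Multiset.replicate c j) = c * (c - 1) / 2 * slot j ^ 2 := by
  simp [slotPairs, slotSum]; ring

theorem balanced_mul_add {M q r : ℕ} (hr : r < M) :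
    balanced M (M * q + r) = Multiset.replicate r (q + 1) + Multiset.replicate (M - r) q := by
  have h1 : (M * q + r) % M = r := by rw [Nat.mul_add_mod, Nat.mod_eq_of_lt hr]
  have h2 : (M * q + r) / M = q := by
    rw [Nat.mul_add_div (by omega), Nat.div_eq_of_lt hr]; rfl
  rw [balanced, h1, h2]

theorem cutVertexBound_eq_cutValue {n k q r : ℕ} (hkn : k + 3 ≤ n) (hqr : k = (n - k) * q + r)
    (hr : r < n - k) :
    cutVertexBound n k q r = cutValue n (n - k) k (if r = 0 then q else q + 1) := by
  obtain ⟨M, hM⟩ : ∃ M, n = k + (M + 1) := ⟨n - k - 1, by omega⟩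
  have hm : n - k = M + 1 := by omega
  have hnR : (n : ℝ) = k + (M + 1) := by exact_mod_cast hM
  rw [hm] at hqr hr ⊢
  have hpow : (2 : ℝ) ^ (-(q : ℤ)) = (1 / 2) ^ q := by
    rw [zpow_neg, zpow_natCast, one_div, inv_pow]
  have hpow2 : (2 : ℝ) ^ (-2 * (q : ℤ) - 2) = ((1 / 2) ^ q) ^ 2 / 4 := by
    rw [zpow_sub₀ (by norm_num), show -2 * (q : ℤ) = -(q : ℤ) * 2 by ring, zpow_mul, hpow]
    norm_num
  have hpow1 : (2 : ℝ) ^ (-2 * (q : ℤ) - 1) = ((1 / 2) ^ q) ^ 2 / 2 := by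
    rw [zpow_sub₀ (by norm_num), show -2 * (q : ℤ) = -(q : ℤ) * 2 by ring, zpow_mul, hpow]
    norm_num
  rw [cutVertexBound, hpow, hpow1, hpow2, cutValue, Nat.add_sub_cancel]
  by_cases h0 : r = 0
  · subst h0
    have e : k - q = M * q + 0 := by
      rw [hqr]; simp only [add_zero, add_mul, one_mul]; omega
    have hk : (k : ℝ) = (M + 1) * q := by rw [hqr]; push_cast; ring
    rw [if_pos rfl, if_pos rfl, e, balanced_mul_add (by omega)]
    simp only [slotScore, slotPairs_add, slotSum_add, slotSum_replicate, slotPairs_replicate,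
      Nat.sub_zero, Nat.cast_zero, slot, hnR]
    generalize ((1 : ℝ) / 2) ^ q = x
    ring
  · obtain ⟨s, rfl⟩ := Nat.exists_eq_succ_of_ne_zero h0
    obtain ⟨t, rfl⟩ : ∃ t, M = s + 1 + t := ⟨M - (s + 1), by omega⟩
    have e : k - (q + 1) = (s + 1 + t) * q + s := by
      rw [hqr]; simp only [add_mul, one_mul]; omega
    rw [if_neg h0, if_neg h0, e, balanced_mul_add (by omega),
      show s + 1 + t - s = t + 1 by omega]
    simp only [slotScore, slotPairs_add, slotSum_add, slotSum_replicate, slotPairs_replicate,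
      slot, hnR, pow_succ]
    push_cast
    generalize ((1 : ℝ) / 2) ^ q = x
    ring

end CutVertexCloseness

namespace CutVertexCloseness

/-! ### Trees of cliques and their weights -/

/-- A rooted graph all of whose blocks are complete, with vertices labelled in `V`: a single
vertex, or the graph obtained from a rooted graph `r` and a list `us` of rooted graphs by joining
all their roots by a clique; the root of the result is the root of `r`. -/
inductive BTree (V : Type*) where
  | leaf (v : V) : BTree V
  | block (r : BTree V) (us : List (BTree V)) : BTree V

namespace BTree

variable {V : Type*}

theorem ind {P : BTree V → Prop} (leaf : ∀ v, P (leaf v))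
    (block : ∀ r us, P r → (∀ u ∈ us, P u) → P (block r us)) : ∀ t, P t
  | .leaf v => leaf v
  | .block r us => block r us (ind leaf block r) fun u _ => ind leaf block u

/-- The root. -/
def root : BTree V → V
  | leaf v => v
  | block r _ => r.root

/-- The list of all vertices. -/
def verts : BTree V → List V
  | leaf v => [v]
  | block r us => r.verts ++ us.flatMap fun u => u.verts

/-- Whether the rooted graph is a single vertex. -/
def isLeaf : BTree V → Bool
  | leaf _ => true
  | block _ _ => false

/-- The vertices that are cut vertices once something else is attached to the root; in particular
the root is one of them. -/
def innerRoot : BTree V → List V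
  | leaf v => [v]
  | block r us => r.innerRoot ++ us.flatMap fun u => if u.isLeaf then [] else u.innerRoot

/-- The vertices that are cut vertices once the root is joined to some new vertices by a clique:
the root is one of them unless it is the only vertex. -/
def inner (t : BTree V) : List V := if t.isLeaf then [] else t.innerRoot

/-- The number of vertices that are not in `innerRoot`. -/
def outerRootCount : BTree V → ℕ
  | leaf _ => 0
  | block r us =>
    r.outerRootCount + (us.map fun u => if u.isLeaf then 1 else u.outerRootCount).sum

/-- The number of vertices that are not in `inner`. -/
def outerCount (t : BTree V) : ℕ := if t.isLeaf then 1 else t.outerRootCount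

/-- The number of cut vertices if something is attached to the root. -/
def innerRootCount (t : BTree V) : ℕ := t.innerRoot.length

/-- The number of cut vertices if the root is joined to some new vertices by a clique. -/
def innerCount (t : BTree V) : ℕ := t.inner.length

/-- The sum of `2 ^ (-d)` over the distances `d` of all vertices (including the root) from the
root. -/
noncomputable def weight : BTree V → ℝ
  | leaf _ => 1
  | block r us => r.weight + (us.map fun u => u.weight).sum / 2

/-- The closeness. -/
noncomputable def close : BTree V → ℝ
  | leaf _ => 0
  | block r us => r.close + (us.map fun u => u.close).sum +
      r.weight * (us.map weight).sum +
      ((us.map weight).sum ^ 2 - (us.map fun u => u.weight ^ 2).sum) / 2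

/-- The rooted graph is a path that starts at the root. -/
inductive IsPath : BTree V → Prop
  | leaf (v : V) : IsPath (leaf v)
  | cons (v : V) {u : BTree V} : IsPath u → IsPath (block (.leaf v) [u])

/-- No block consists of a single vertex. -/
inductive Proper : BTree V → Prop
  | leaf (v : V) : Proper (leaf v)
  | block {r : BTree V} {us : List (BTree V)} : Proper r → us ≠ [] → (∀ u ∈ us, Proper u) →
      Proper (block r us)

/-- Every block at the root has at least three vertices or leads to a path. -/
inductive Good : BTree V → Prop
  | leaf (v : V) : Good (leaf v)
  | block {r : BTree V} {us : List (BTree V)} : Good r →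
      (2 ≤ us.length ∨ ∀ u ∈ us, IsPath u) → Good (block r us)

/-- Some branch at a neighbour of the root is not a path. -/
def HasThickChild : BTree V → Prop
  | leaf _ => False
  | block r us => r.HasThickChild ∨ ∃ u ∈ us, ¬ u.IsPath

end BTree

open BTree

variable {V : Type*}

/-- The total weight of a list of rooted graphs. -/
noncomputable def listWeight (us : List (BTree V)) : ℝ := (us.map weight).sum

/-- The second elementary symmetric function of the weights. -/
noncomputable def listPairs (us : List (BTree V)) : ℝ :=
  (listWeight us ^ 2 - (us.map fun u => u.weight ^ 2).sum) / 2

/-- The closeness of the graph obtained by joining the roots of a list of rooted graphs by a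
clique. -/
noncomputable def listClose (us : List (BTree V)) : ℝ :=
  (us.map close).sum + listPairs us

/-- The total `outerCount` of a list of rooted graphs. -/
def listOuter (us : List (BTree V)) : ℕ := (us.map outerCount).sum

/-- The total `innerCount` of a list of rooted graphs. -/
def listInner (us : List (BTree V)) : ℕ := (us.map innerCount).sum

@[simp] theorem listWeight_nil : listWeight ([] : List (BTree V)) = 0 := rfl
@[simp] theorem listWeight_cons (u : BTree V) (us : List (BTree V)) :
    listWeight (u :: us) = u.weight + listWeight us := by simp [listWeight]
@[simp] theorem listPairs_nil : listPairs ([] : List (BTree V)) = 0 := by simp [listPairs]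
@[simp] theorem listPairs_cons (u : BTree V) (us : List (BTree V)) :
    listPairs (u :: us) = listPairs us + u.weight * listWeight us := by
  simp [listPairs]; ring
@[simp] theorem listClose_nil : listClose ([] : List (BTree V)) = 0 := by simp [listClose]
@[simp] theorem listClose_cons (u : BTree V) (us : List (BTree V)) :
    listClose (u :: us) = u.close + listClose us + u.weight * listWeight us := by
  simp [listClose]; ring
@[simp] theorem listOuter_nil : listOuter ([] : List (BTree V)) = 0 := rfl
@[simp] theorem listOuter_cons (u : BTree V) (us : List (BTree V)) :
    listOuter (u :: us) = u.outerCount + listOuter us := by simp [listOuter]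
@[simp] theorem listInner_nil : listInner ([] : List (BTree V)) = 0 := rfl
@[simp] theorem listInner_cons (u : BTree V) (us : List (BTree V)) :
    listInner (u :: us) = u.innerCount + listInner us := by simp [listInner]

theorem listWeight_perm {L L' : List (BTree V)} (h : L.Perm L') :
    listWeight L = listWeight L' := (h.map _).sum_eq
theorem listOuter_perm {L L' : List (BTree V)} (h : L.Perm L') :
    listOuter L = listOuter L' := (h.map _).sum_eq
theorem listInner_perm {L L' : List (BTree V)} (h : L.Perm L') :
    listInner L = listInner L' := (h.map _).sum_eq

namespace BTree

@[simp] theorem weight_leaf (v : V) : (leaf v).weight = 1 := by simp [weight]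
@[simp] theorem weight_block (r : BTree V) (us : List (BTree V)) :
    (block r us).weight = r.weight + listWeight us / 2 := by simp [weight, listWeight]
@[simp] theorem close_leaf (v : V) : (leaf v).close = 0 := by simp [close]
@[simp] theorem close_block (r : BTree V) (us : List (BTree V)) :
    (block r us).close = listClose (r :: us) := by
  rw [listClose_cons]; simp [close, listClose, listPairs, listWeight]; ring
@[simp] theorem outerRootCount_leaf (v : V) : (leaf v).outerRootCount = 0 := by
  simp [outerRootCount]
@[simp] theorem outerRootCount_block (r : BTree V) (us : List (BTree V)) :
    (block r us).outerRootCount = r.outerRootCount + listOuter us := by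
  simp [outerRootCount, listOuter]; rfl
@[simp] theorem innerRootCount_leaf (v : V) : (leaf v).innerRootCount = 1 := by
  simp [innerRootCount, innerRoot]
@[simp] theorem innerRootCount_block (r : BTree V) (us : List (BTree V)) :
    (block r us).innerRootCount = r.innerRootCount + listInner us := by
  simp [innerRootCount, innerRoot, listInner, List.length_flatMap]; rfl
@[simp] theorem outerCount_leaf (v : V) : (leaf v).outerCount = 1 := by
  simp [outerCount, isLeaf]
@[simp] theorem outerCount_block (r : BTree V) (us : List (BTree V)) :
    (block r us).outerCount = r.outerRootCount + listOuter us := by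
  simp [outerCount, isLeaf]
@[simp] theorem innerCount_leaf (v : V) : (leaf v).innerCount = 0 := by
  simp [innerCount, inner, isLeaf]
@[simp] theorem innerCount_block (r : BTree V) (us : List (BTree V)) :
    (block r us).innerCount = r.innerRootCount + listInner us := by
  rw [← innerRootCount_block]; simp [innerCount, innerRootCount, inner, isLeaf]

theorem one_le_weight (t : BTree V) : 1 ≤ t.weight := by
  induction t using ind with
  | leaf v => simp
  | block r us hr hus =>
    have : 0 ≤ listWeight us := by
      refine List.sum_nonneg fun x hx => ?_
      obtain ⟨u, hu, rfl⟩ := List.mem_map.mp hx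
      linarith [hus u hu]
    rw [weight_block]; linarith

end BTree

theorem length_le_listWeight (us : List (BTree V)) : (us.length : ℝ) ≤ listWeight us := by
  induction us with
  | nil => simp
  | cons u us ih =>
    have := u.one_le_weight
    simp only [List.length_cons, listWeight_cons]; push_cast; linarith

theorem listWeight_nonneg (us : List (BTree V)) : 0 ≤ listWeight us :=
  (Nat.cast_nonneg _).trans (length_le_listWeight us)

namespace BTree

theorem one_le_innerRootCount (t : BTree V) : 1 ≤ t.innerRootCount := by
  induction t using ind with
  | leaf v => simp
  | block r us hr hus => rw [innerRootCount_block]; omega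

theorem eq_leaf_or_block (t : BTree V) : (∃ v, t = leaf v) ∨ ∃ r us, t = block r us := by
  cases t with
  | leaf v => exact Or.inl ⟨v, rfl⟩
  | block r us => exact Or.inr ⟨r, us, rfl⟩

theorem one_le_outerCount {t : BTree V} (ht : t.Proper) : 1 ≤ t.outerCount := by
  induction t using ind with
  | leaf v => simp
  | block r us hr hus =>
    cases ht with
    | block h1 h2 h3 =>
      obtain ⟨u, us, rfl⟩ := List.exists_cons_of_ne_nil h2
      have := hus u (by simp) (h3 u (by simp))
      rw [outerCount_block, listOuter_cons]; omega

theorem IsPath.proper {t : BTree V} (h : t.IsPath) : t.Proper := by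
  induction h with
  | leaf v => exact .leaf v
  | cons v _ ih => exact .block (.leaf v) (by simp) (by simpa using ih)

theorem IsPath.outerCount {t : BTree V} (h : t.IsPath) : t.outerCount = 1 := by
  induction h with
  | leaf v => simp
  | cons v _ ih => simp [ih]

theorem IsPath.weight {t : BTree V} (h : t.IsPath) : t.weight = slot t.innerCount := by
  induction h with
  | leaf v => simp
  | cons v _ ih => simp [ih, add_comm 1, slot_succ]

theorem IsPath.close {t : BTree V} (h : t.IsPath) :
    t.close = pathsCloseness {t.innerCount} := by
  induction h with
  | leaf v => simp [pathsCloseness_singleton]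
  | cons v h ih =>
    simp only [close_block, listClose_cons, listClose_nil, listWeight_cons, listWeight_nil,
      weight_leaf, close_leaf, innerCount_block, innerRootCount_leaf, listInner_cons,
      listInner_nil, ih, h.weight, pathsCloseness_singleton, add_zero, mul_zero]
    rw [add_comm 1, slot_succ]; push_cast; ring

theorem length_le_listOuter {us : List (BTree V)} (h : ∀ u ∈ us, u.Proper) :
    us.length ≤ listOuter us := by
  induction us with
  | nil => simp
  | cons u us ih =>
    have h1 := one_le_outerCount (h u (by simp))
    have h2 := ih fun x hx => h x (by simp [hx])
    simp only [List.length_cons, listOuter_cons]; omega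

theorem one_le_outerRootCount {r : BTree V} {us : List (BTree V)} (h : (block r us).Proper) :
    1 ≤ (block r us).outerRootCount := by
  simpa using one_le_outerCount h

/-- A branch that is not a path has at least two vertices that are not cut vertices. -/
theorem two_le_outerCount {t : BTree V} (ht : t.Proper) (hp : ¬ t.IsPath) :
    2 ≤ t.outerCount := by
  induction t using ind with
  | leaf v => exact absurd (.leaf v) hp
  | block r us hr hus =>
    cases ht with
    | block h1 h2 h3 =>
      have hl := length_le_listOuter h3
      obtain ⟨u, us, rfl⟩ := List.exists_cons_of_ne_nil h2
      rw [outerCount_block]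
      rcases r.eq_leaf_or_block with ⟨v, rfl⟩ | ⟨r', us', rfl⟩
      · cases us with
        | nil =>
          have := hus u (by simp) (h3 u (by simp)) fun h => hp (.cons v h)
          simp; omega
        | cons u' us => simp at hl; simp; omega
      · have := one_le_outerRootCount h1
        simp only [List.length_cons] at hl
        omega

theorem two_le_weight {t : BTree V} (ht : t.Proper) (hp : ¬ t.IsPath) : 2 ≤ t.weight := by
  induction t using ind with
  | leaf v => exact absurd (.leaf v) hp
  | block r us hr hus =>
    cases ht with
    | block h1 h2 h3 =>
      have hl := length_le_listWeight us
      obtain ⟨u, us, rfl⟩ := List.exists_cons_of_ne_nil h2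
      rcases r.eq_leaf_or_block with ⟨v, rfl⟩ | ⟨r', us', rfl⟩
      · cases us with
        | nil =>
          have := hus u (by simp) (h3 u (by simp)) fun h => hp (.cons v h)
          simp; linarith
        | cons u' us =>
          simp only [List.length_cons, Nat.cast_add, Nat.cast_one] at hl
          have := Nat.cast_nonneg (α := ℝ) us.length
          rw [weight_block, weight_leaf]; linarith
      · cases h1 with
        | block g1 g2 g3 =>
          have hl' := length_le_listWeight us'
          have : (1 : ℝ) ≤ us'.length := by exact_mod_cast List.length_pos_iff.mpr g2
          have := r'.one_le_weight
          simp only [List.length_cons, Nat.cast_add, Nat.cast_one] at hl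
          have := Nat.cast_nonneg (α := ℝ) us.length
          rw [weight_block, weight_block]; linarith

theorem three_half_le_weight {r : BTree V} {us : List (BTree V)} (h : (block r us).Proper) :
    3 / 2 ≤ (block r us).weight := by
  cases h with
  | block g1 g2 g3 =>
    have hl' := length_le_listWeight us
    have : (1 : ℝ) ≤ us.length := by exact_mod_cast List.length_pos_iff.mpr g2
    have := r.one_le_weight
    rw [weight_block]; linarith

end BTree

/-! ### Replacing branches by paths -/

/-- In the context of a weight `Y` at its neighbours outside, the branch `u` contributes at most
as much as suitable paths, as many as `u` has vertices that are not cut vertices. If `u` is not a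
path then the contribution is smaller by `g`. -/
def PathsDominate (u : BTree V) : Prop :=
  ∀ Y : ℝ, 0 ≤ Y → (2 ≤ Y ∨ u.IsPath) → ∃ (S : Multiset ℕ) (g : ℝ),
    S.card = u.outerCount ∧ S.sum = u.innerCount ∧ 0 ≤ g ∧
    (¬ u.IsPath → 0 < g ∧ min (Y - 2) 1 ≤ g) ∧
    u.close + Y * u.weight + g ≤ pathsCloseness S + Y * slotSum S

theorem BTree.IsPath.pathsDominate {u : BTree V} (h : u.IsPath) : PathsDominate u := by
  intro Y _ _
  refine ⟨{u.innerCount}, 0, by simp [h.outerCount], by simp, le_rfl, fun h' => absurd h h', ?_⟩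
  rw [h.close, h.weight, slotSum_singleton, add_zero]

/-- All branches at a clique can be replaced by paths. -/
theorem exists_paths_of_list (us : List (BTree V)) (β : ℝ) (hβ : 0 ≤ β)
    (hus : ∀ u ∈ us, u.Proper) (hD : ∀ u ∈ us, PathsDominate u)
    (h : 3 ≤ β + us.length ∨ ∀ u ∈ us, u.IsPath) :
    ∃ (S : Multiset ℕ) (g : ℝ), S.card = listOuter us ∧ S.sum = listInner us ∧ 0 ≤ g ∧
      ((∃ u ∈ us, ¬ u.IsPath) → 0 < g ∧ min (β + us.length - 3) 1 ≤ g) ∧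
      listClose us + β * listWeight us + g ≤ pathsCloseness S + β * slotSum S := by
  induction us generalizing β with
  | nil => exact ⟨0, 0, by simp, by simp, le_rfl, by simp, by simp [pathsCloseness]⟩
  | cons u us ih =>
    have hl := length_le_listWeight us
    have hY : 0 ≤ β + listWeight us := add_nonneg hβ (listWeight_nonneg us)
    simp only [List.length_cons, Nat.cast_add, Nat.cast_one] at h ⊢
    obtain ⟨S₁, g₁, c₁, s₁, p₁, n₁, i₁⟩ := hD u (by simp) (β + listWeight us) hY (by
      rcases h with h | h
      · left; linarith
      · right; exact h u (by simp))
    have hS₁ : 1 ≤ slotSum S₁ := by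
      refine le_trans ?_ (card_le_slotSum S₁)
      rw [c₁]; exact_mod_cast one_le_outerCount (hus u (by simp))
    obtain ⟨S₂, g₂, c₂, s₂, p₂, n₂, i₂⟩ := ih (β + slotSum S₁) (by linarith)
      (fun x hx => hus x (by simp [hx])) (fun x hx => hD x (by simp [hx])) (by
      rcases h with h | h
      · left; linarith
      · right; exact fun x hx => h x (by simp [hx]))
    refine ⟨S₁ + S₂, g₁ + g₂, by simp [c₁, c₂], by simp [s₁, s₂], by linarith, ?_, ?_⟩
    · rintro ⟨x, hx, hxp⟩
      rcases List.mem_cons.mp hx with rfl | hx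
      · obtain ⟨a, b⟩ := n₁ hxp
        refine ⟨by linarith, le_trans ?_ (b.trans (le_add_of_nonneg_right p₂))⟩
        exact min_le_min (by linarith) le_rfl
      · obtain ⟨a, b⟩ := n₂ ⟨x, hx, hxp⟩
        refine ⟨by linarith, le_trans ?_ (b.trans (le_add_of_nonneg_left p₁))⟩
        exact min_le_min (by linarith) le_rfl
    · rw [pathsCloseness_add, slotSum_add, listClose_cons, listWeight_cons]
      linarith

/-- The branch `t`, the root of which carries a weight `Z` outside, contributes at most as much as
its root with suitable paths attached by one clique. -/
def StarBound (t : BTree V) (Z : ℝ) (S : Multiset ℕ) (g : ℝ) : Prop :=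
  S.card = t.outerRootCount ∧ S.sum + 1 = t.innerRootCount ∧ 0 ≤ g ∧
    t.close + Z * t.weight + g ≤ pathsCloseness S + slotSum S + Z * (1 + slotSum S / 2)

theorem starBound_leaf (v : V) (Z : ℝ) : StarBound (leaf v) Z 0 0 := by
  simp [StarBound, pathsCloseness]

/-- The blocks at the root are merged into a single one. -/
theorem StarBound.block {r : BTree V} {us : List (BTree V)} {Z : ℝ} {S₁ S₂ : Multiset ℕ}
    {g₁ g₂ : ℝ} (h₁ : StarBound r (Z + slotSum S₂) S₁ g₁) (c₂ : S₂.card = listOuter us)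
    (s₂ : S₂.sum = listInner us) (p₂ : 0 ≤ g₂)
    (i₂ : listClose us + (r.weight + Z / 2) * listWeight us + g₂ ≤
      pathsCloseness S₂ + (r.weight + Z / 2) * slotSum S₂) :
    StarBound (block r us) Z (S₁ + S₂) (g₁ + g₂ + slotSum S₁ * slotSum S₂ / 2) := by
  obtain ⟨c₁, s₁, p₁, i₁⟩ := h₁
  have := mul_nonneg (slotSum_nonneg S₁) (slotSum_nonneg S₂)
  refine ⟨by simp [c₁, c₂], ?_, by linarith, ?_⟩
  · rw [Multiset.sum_add, innerRootCount_block]; omega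
  · rw [pathsCloseness_add, slotSum_add, close_block, listClose_cons, weight_block]
    linarith

/-- Making the root of a star of paths the second vertex of one of the paths. The gain is the
`(slot y + slotSum S) / 2 * (Y - slot x)` of the pairs of vertices whose distance changes. -/
theorem star_slide (x y : ℕ) (S : Multiset ℕ) (hxy : x ≤ y) (Y : ℝ) (hY : 2 ≤ Y) :
    ∃ g : ℝ, 0 < g ∧ min (Y - 2) 1 ≤ g ∧
      pathsCloseness (x ::ₘ y ::ₘ S) + slotSum (x ::ₘ y ::ₘ S) +
        Y * (1 + slotSum (x ::ₘ y ::ₘ S) / 2) + g ≤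
      pathsCloseness ((x + 1) ::ₘ y ::ₘ S) + Y * slotSum ((x + 1) ::ₘ y ::ₘ S) := by
  have hx1 := one_le_slot x
  have hx2 := slot_lt_two x
  have hy := slot_mono hxy
  have hS := slotSum_nonneg S
  have hge : slot x / 2 * (Y - slot x) ≤ (slot y + slotSum S) / 2 * (Y - slot x) := by
    apply mul_le_mul_of_nonneg_right <;> linarith
  refine ⟨(slot y + slotSum S) / 2 * (Y - slot x), ?_, le_trans ?_ hge, ?_⟩
  · apply mul_pos <;> linarith
  · have h1 : min (Y - 2) 1 ≤ 1 := min_le_right _ _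
    have h2 : min (Y - 2) 1 ≤ Y - 2 := min_le_left _ _
    set μ := min (Y - 2) 1
    nlinarith [mul_nonneg (sub_nonneg.mpr hx2.le) (sub_nonneg.mpr (h1.trans hx1))]
  · simp only [pathsCloseness_cons, slotSum_cons]
    rw [slot_succ]; push_cast
    linarith

/-- At most one block at the root, and only paths behind it. -/
def BTree.IsStar (t : BTree V) : Prop :=
  ∀ r us, t = block r us → r.isLeaf ∧ ∀ u ∈ us, u.IsPath

theorem starBound_gain_pos {r : BTree V} {us : List (BTree V)} (h : (block r us).Proper)
    {S₁ S₂ : Multiset ℕ} {g₁ g₂ : ℝ} (p₁ : 0 ≤ g₁) (p₂ : 0 ≤ g₂)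
    (c₁ : S₁.card = r.outerRootCount) (c₂ : S₂.card = listOuter us)
    (n₂ : (∃ u ∈ us, ¬ u.IsPath) → 0 < g₂) (hs : ¬ (block r us).IsStar) :
    0 < g₁ + g₂ + slotSum S₁ * slotSum S₂ / 2 := by
  have hp := mul_nonneg (slotSum_nonneg S₁) (slotSum_nonneg S₂)
  cases h with
  | block h1 h2 h3 =>
    by_cases hex : ∃ u ∈ us, ¬ u.IsPath
    · have := n₂ hex; linarith
    · push Not at hex
      rcases r.eq_leaf_or_block with ⟨v, rfl⟩ | ⟨r', us', rfl⟩
      · refine absurd ?_ hs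
        intro r us h
        cases h
        exact ⟨rfl, hex⟩
      · have a1 := card_le_slotSum S₁
        have a2 := card_le_slotSum S₂
        have b1 : (1 : ℝ) ≤ S₁.card := by
          rw [c₁]; exact_mod_cast one_le_outerRootCount h1
        have b2 : (1 : ℝ) ≤ S₂.card := by
          rw [c₂]
          exact_mod_cast (List.length_pos_iff.mpr h2).trans_le (length_le_listOuter h3)
        have : 0 < slotSum S₁ * slotSum S₂ := mul_pos (by linarith) (by linarith)
        linarith

theorem pathsDominate_and_starBound {t : BTree V} (ht : t.Proper) :
    PathsDominate t ∧ ∀ Z : ℝ, 2 ≤ Z → ∃ S g, StarBound t Z S g ∧ (¬ t.IsStar → 0 < g) := by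
  induction t using ind with
  | leaf v =>
    refine ⟨(IsPath.leaf v).pathsDominate, fun Z _ => ⟨0, 0, starBound_leaf v Z, fun h => ?_⟩⟩
    exact absurd (fun r us h => by cases h) h
  | block r us hr hus =>
    have ht' := ht
    cases ht with
    | block h1 h2 h3 =>
      have key : ∀ Z : ℝ, 2 ≤ Z →
          ∃ S g, StarBound (block r us) Z S g ∧ (¬ (block r us).IsStar → 0 < g) := by
        intro Z hZ
        have hr1 := r.one_le_weight
        have hlen : (1 : ℝ) ≤ us.length := by exact_mod_cast List.length_pos_iff.mpr h2
        obtain ⟨S₂, g₂, c₂, s₂, p₂, n₂, i₂⟩ := exists_paths_of_list us (r.weight + Z / 2)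
          (by linarith) h3 (fun u hu => (hus u hu (h3 u hu)).1) (Or.inl (by linarith))
        obtain ⟨S₁, g₁, b₁, -⟩ := (hr h1).2 (Z + slotSum S₂)
          (by have := slotSum_nonneg S₂; linarith)
        exact ⟨_, _, b₁.block c₂ s₂ p₂ i₂,
          starBound_gain_pos ht' b₁.2.2.1 p₂ b₁.1 c₂ fun h => (n₂ h).1⟩
      refine ⟨?_, key⟩
      by_cases hp : (block r us).IsPath
      · exact hp.pathsDominate
      intro Y hY0 hY
      have hY2 : 2 ≤ Y := hY.resolve_right hp
      obtain ⟨S, g, ⟨c, s, p, i⟩, -⟩ := key Y hY2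
      have hcard : 2 ≤ S.card := by
        rw [c]; simpa using two_le_outerCount ht' hp
      obtain ⟨x, y, T, hxy, rfl⟩ : ∃ x y T, x ≤ y ∧ S = x ::ₘ y ::ₘ T := by
        obtain ⟨x, hx⟩ := Multiset.card_pos_iff_exists_mem.mp (by omega : 0 < S.card)
        obtain ⟨T, rfl⟩ := Multiset.exists_cons_of_mem hx
        rw [Multiset.card_cons] at hcard
        obtain ⟨y, hy⟩ := Multiset.card_pos_iff_exists_mem.mp (by omega : 0 < T.card)
        obtain ⟨T, rfl⟩ := Multiset.exists_cons_of_mem hy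
        rcases le_total x y with h | h
        · exact ⟨x, y, T, h, rfl⟩
        · exact ⟨y, x, T, h, Multiset.cons_swap _ _ _⟩
      obtain ⟨g', q1, q2, q3⟩ := star_slide x y T hxy Y hY2
      refine ⟨(x + 1) ::ₘ y ::ₘ T, g', ?_, ?_, q1.le, fun _ => ⟨q1, q2⟩, ?_⟩
      · simpa using c
      · simp only [Multiset.sum_cons] at s ⊢
        rw [innerCount_block, ← innerRootCount_block]; omega
      · linarith

theorem BTree.Proper.pathsDominate {t : BTree V} (ht : t.Proper) : PathsDominate t :=
  (pathsDominate_and_starBound ht).1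

theorem exists_starBound_of_two_le {t : BTree V} (ht : t.Proper) {Z : ℝ} (hZ : 2 ≤ Z) :
    ∃ S g, StarBound t Z S g :=
  let ⟨S, g, h, _⟩ := (pathsDominate_and_starBound ht).2 Z hZ
  ⟨S, g, h⟩

/-- For a good branch no weight outside is needed. -/
theorem BTree.Good.exists_starBound {t : BTree V} (hg : t.Good) (ht : t.Proper) {Z : ℝ}
    (hZ : 0 ≤ Z) :
    ∃ S g, StarBound t Z S g ∧ (¬ t.IsStar → 0 < g) ∧
      (t.HasThickChild → min (Z / 2) 1 ≤ g) ∧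
      ∀ r us, t = BTree.block r us → (r.outerRootCount * listOuter us : ℝ) / 2 ≤ g := by
  induction t using ind generalizing Z with
  | leaf v =>
    refine ⟨0, 0, starBound_leaf v Z, fun h => ?_, fun h => ?_, fun r us h => ?_⟩
    · exact absurd (fun r us h => by cases h) h
    · simp [HasThickChild] at h
    · cases h
  | block r us hr hus =>
    have ht' := ht
    cases ht with
    | block h1 h2 h3 =>
      cases hg with
      | block k1 k2 =>
        have hr1 := r.one_le_weight
        obtain ⟨S₂, g₂, c₂, s₂, p₂, n₂, i₂⟩ := exists_paths_of_list us (r.weight + Z / 2)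
          (by linarith) h3 (fun u hu => (h3 u hu).pathsDominate) (by
            refine k2.imp (fun k => ?_) id
            have : (2 : ℝ) ≤ us.length := by exact_mod_cast k
            linarith)
        have hS₂ := slotSum_nonneg S₂
        obtain ⟨S₁, g₁, b₁, -, t₁, -⟩ := hr k1 h1 (Z := Z + slotSum S₂) (by linarith)
        have hp := mul_nonneg (slotSum_nonneg S₁) hS₂
        have p₁ := b₁.2.2.1
        refine ⟨_, _, b₁.block c₂ s₂ p₂ i₂,
          starBound_gain_pos ht' b₁.2.2.1 p₂ b₁.1 c₂ fun h => (n₂ h).1, ?_, ?_⟩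
        · intro h
          rw [HasThickChild] at h
          rcases h with h | h
          · have : min (Z / 2) 1 ≤ min ((Z + slotSum S₂) / 2) 1 :=
              min_le_min (by linarith) le_rfl
            linarith [t₁ h]
          · have hl : 2 ≤ us.length := by
              refine k2.resolve_right fun hall => ?_
              obtain ⟨u, hu, hup⟩ := h
              exact hup (hall u hu)
            have hl' : (2 : ℝ) ≤ us.length := by exact_mod_cast hl
            have : min (Z / 2) 1 ≤ min (r.weight + Z / 2 + us.length - 3) 1 :=
              min_le_min (by linarith) le_rfl
            linarith [(n₂ h).2]
        · rintro r' us' h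
          cases h
          have a1 := card_le_slotSum S₁
          have a2 := card_le_slotSum S₂
          rw [b₁.1] at a1
          rw [c₂] at a2
          have : (r.outerRootCount * listOuter us : ℝ) ≤ slotSum S₁ * slotSum S₂ :=
            mul_le_mul a1 a2 (Nat.cast_nonneg _) (slotSum_nonneg S₁)
          linarith

theorem exists_starBound_of_one_le {r : BTree V} {us : List (BTree V)} (h : (block r us).Proper)
    (hb : r.isLeaf = false ∨ 2 ≤ us.length) {Z : ℝ} (hZ : 1 ≤ Z) :
    ∃ S g, StarBound (block r us) Z S g := by
  cases h with
  | block h1 h2 h3 =>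
    have hr1 := r.one_le_weight
    have hlen : (1 : ℝ) ≤ us.length := by exact_mod_cast List.length_pos_iff.mpr h2
    obtain ⟨S₂, g₂, c₂, s₂, p₂, n₂, i₂⟩ := exists_paths_of_list us (r.weight + Z / 2)
      (by linarith) h3 (fun u hu => (h3 u hu).pathsDominate) (by
        left
        rcases hb with hb | hb
        · rcases r.eq_leaf_or_block with ⟨v, rfl⟩ | ⟨r', us', rfl⟩
          · simp [isLeaf] at hb
          · have := three_half_le_weight h1
            linarith
        · have : (2 : ℝ) ≤ us.length := by exact_mod_cast hb
          linarith)
    have hS₂ : 1 ≤ slotSum S₂ := by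
      refine le_trans ?_ (card_le_slotSum S₂)
      rw [c₂]
      exact hlen.trans (by exact_mod_cast length_le_listOuter h3)
    obtain ⟨S₁, g₁, b₁⟩ := exists_starBound_of_two_le h1 (Z := Z + slotSum S₂) (by linarith)
    exact ⟨_, _, b₁.block c₂ s₂ p₂ i₂⟩

/-- A path with `j + 1` vertices, joined by an edge to the root of `t`. -/
theorem exists_paths_of_path_append {t : BTree V} (ht : t.Proper) (j : ℕ) :
    ∃ S : Multiset ℕ, S.card = 1 + t.outerCount ∧ S.sum = j + t.innerCount ∧
      t.close + slot j * t.weight + pathsCloseness {j} ≤ pathsCloseness S := by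
  induction t using ind generalizing j with
  | leaf v =>
    refine ⟨j ::ₘ {0}, by simp, by simp, ?_⟩
    simp [pathsCloseness_cons, pathsCloseness_singleton]
    linarith
  | block r us hr hus =>
    by_cases hb : r.isLeaf = false ∨ 2 ≤ us.length
    · obtain ⟨S, g, c, s, p, i⟩ := exists_starBound_of_one_le ht hb (one_le_slot j)
      refine ⟨(j + 1) ::ₘ S, ?_, ?_, ?_⟩
      · rw [Multiset.card_cons, c, outerCount_block, outerRootCount_block]; ring
      · rw [Multiset.sum_cons, innerCount_block, ← innerRootCount_block, ← s]; ring
      · rw [pathsCloseness_cons, pathsCloseness_singleton, slot_succ]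
        push_cast
        linarith
    · push Not at hb
      cases ht with
      | block h1 h2 h3 =>
        rcases r.eq_leaf_or_block with ⟨v, rfl⟩ | ⟨r', us', rfl⟩
        · obtain ⟨u, us, rfl⟩ := List.exists_cons_of_ne_nil h2
          obtain rfl : us = [] := by
            have := hb.2
            simp only [List.length_cons] at this
            exact List.length_eq_zero_iff.mp (by omega)
          obtain ⟨S, c, s, i⟩ := hus u (by simp) (h3 u (by simp)) (j + 1)
          refine ⟨S, by simp [c], by simp [s]; ring, ?_⟩
          rw [pathsCloseness_singleton, slot_succ] at i
          rw [pathsCloseness_singleton]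
          simp only [close_block, listClose_cons, listClose_nil, listWeight_cons,
            listWeight_nil, weight_leaf, close_leaf, weight_block]
          push_cast at i
          linarith
        · simp [isLeaf] at hb

/-- One vertex of a path becomes a new vertex of the clique. -/
theorem exists_pathsCloseness_le (S : Multiset ℕ) (hS : 0 < S.sum) :
    ∃ S' : Multiset ℕ, S'.card = S.card + 1 ∧ S'.sum + 1 = S.sum ∧
      pathsCloseness S ≤ pathsCloseness S' := by
  obtain ⟨j, hj, hj0⟩ : ∃ j ∈ S, j ≠ 0 := by
    by_contra! hc
    exact hS.ne' (Multiset.sum_eq_zero hc)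
  obtain ⟨T, rfl⟩ := Multiset.exists_cons_of_mem hj
  obtain ⟨i, rfl⟩ := Nat.exists_eq_succ_of_ne_zero hj0
  refine ⟨i ::ₘ 0 ::ₘ T, by simp, by simp; ring, ?_⟩
  have hT := slotSum_nonneg T
  have hi := one_le_slot i
  have hi' := slot_lt_two i
  simp only [Nat.succ_eq_add_one, pathsCloseness_cons, slotSum_cons, slot_succ, slot_zero]
  push_cast
  nlinarith

/-- A bound for the closeness of `t` alone. -/
theorem close_le_pathsCloseness {r : BTree V} {us : List (BTree V)} (h : (block r us).Proper) :
    ∃ S : Multiset ℕ, S.card = (block r us).outerCount + 1 ∧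
      S.sum + 1 = (block r us).innerCount ∧ (block r us).close ≤ pathsCloseness S := by
  cases h with
  | block h1 h2 h3 =>
    rcases r.eq_leaf_or_block with ⟨v, rfl⟩ | ⟨r', us', rfl⟩
    · by_cases hl : 2 ≤ us.length
      · have hl' : (2 : ℝ) ≤ us.length := by exact_mod_cast hl
        obtain ⟨S, g, c, s, p, n, i⟩ := exists_paths_of_list us 1 (by norm_num) h3
          (fun u hu => (h3 u hu).pathsDominate) (Or.inl (by linarith))
        refine ⟨0 ::ₘ S, by simp [c], by simp [s]; ring, ?_⟩
        rw [pathsCloseness_cons]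
        simp only [close_block, listClose_cons, weight_leaf, close_leaf, slot_zero]
        push_cast
        linarith
      · obtain ⟨u, us, rfl⟩ := List.exists_cons_of_ne_nil h2
        obtain rfl : us = [] := by
          simp only [List.length_cons] at hl
          exact List.length_eq_zero_iff.mp (by omega)
        obtain ⟨S, c, s, i⟩ := exists_paths_of_path_append (h3 u (by simp)) 0
        refine ⟨S, by simp [c, add_comm], by simp [s, add_comm], ?_⟩
        simp only [pathsCloseness_singleton, slot_zero] at i
        simp only [close_block, listClose_cons, listClose_nil, listWeight_cons,
          listWeight_nil, weight_leaf, close_leaf]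
        push_cast at i
        linarith
    · set r := block r' us' with hr
      have hout : r.outerRootCount = r.outerCount := by simp [hr]
      have hin : r.innerRootCount = r.innerCount := by simp [hr]
      suffices ∃ S : Multiset ℕ, S.card = (block r us).outerCount ∧
          S.sum = (block r us).innerCount ∧ (block r us).close ≤ pathsCloseness S by
        obtain ⟨S, c, s, i⟩ := this
        have hpos : 0 < S.sum := by
          rw [s, innerCount_block]; have := r.one_le_innerRootCount; omega
        obtain ⟨S', c', s', i'⟩ := exists_pathsCloseness_le S hpos
        exact ⟨S', by omega, by omega, i.trans i'⟩
      rw [outerCount_block, innerCount_block, close_block, hout, hin]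
      by_cases hl : 2 ≤ us.length
      · have hl' : (2 : ℝ) ≤ us.length := by exact_mod_cast hl
        have h3' : ∀ u ∈ r :: us, u.Proper := by
          intro u hu
          rcases List.mem_cons.mp hu with rfl | hu
          · exact h1
          · exact h3 u hu
        obtain ⟨S, g, c, s, p, n, i⟩ := exists_paths_of_list (r :: us) 0 le_rfl h3'
          (fun u hu => (h3' u hu).pathsDominate)
          (Or.inl (by simp only [List.length_cons]; push_cast; linarith))
        exact ⟨S, by simp [c], by simp [s], by linarith⟩
      · obtain ⟨u, us, rfl⟩ := List.exists_cons_of_ne_nil h2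
        obtain rfl : us = [] := by
          simp only [List.length_cons] at hl
          exact List.length_eq_zero_iff.mp (by omega)
        have hu := h3 u (by simp)
        simp only [listClose_cons, listClose_nil, listWeight_cons, listWeight_nil, listOuter_cons,
          listOuter_nil, listInner_cons, listInner_nil, add_zero, mul_zero]
        by_cases hup : u.IsPath
        · obtain ⟨S, c, s, i⟩ := exists_paths_of_path_append h1 u.innerCount
          refine ⟨S, by rw [c, hup.outerCount]; ring, by rw [s]; ring, ?_⟩
          rw [← hup.close, ← hup.weight] at i
          linarith
        by_cases hrp : r.IsPath
        · obtain ⟨S, c, s, i⟩ := exists_paths_of_path_append hu r.innerCount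
          refine ⟨S, by rw [c, hrp.outerCount], by rw [s], ?_⟩
          rw [← hrp.close, ← hrp.weight] at i
          linarith
        have hu2 := two_le_weight hu hup
        obtain ⟨S₁, g₁, c₁, s₁, p₁, -, i₁⟩ := h1.pathsDominate u.weight (by linarith)
          (Or.inl hu2)
        have hS₁ : 2 ≤ slotSum S₁ := by
          refine le_trans ?_ (card_le_slotSum S₁)
          rw [c₁]; exact_mod_cast two_le_outerCount h1 hrp
        obtain ⟨S₂, g₂, c₂, s₂, p₂, -, i₂⟩ := hu.pathsDominate (slotSum S₁) (by linarith)
          (Or.inl hS₁)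
        refine ⟨S₁ + S₂, by simp [c₁, c₂], by simp [s₁, s₂], ?_⟩
        rw [pathsCloseness_add]
        linarith

end CutVertexCloseness

namespace CutVertexCloseness

open Finset

/-! ### Closeness of graphs glued at vertices -/

section Weights

variable {V : Type*} (G H : SimpleGraph V)

theorem distWeight_of_reachable {G : SimpleGraph V} {u v : V} (h : G.Reachable u v) :
    distWeight G u v = (1 / 2) ^ G.dist u v := by
  rw [distWeight, if_pos h, zpow_neg, zpow_natCast, one_div, inv_pow]

theorem distWeight_of_not_reachable {G : SimpleGraph V} {u v : V} (h : ¬ G.Reachable u v) :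
    distWeight G u v = 0 := if_neg h

@[simp] theorem distWeight_self (u : V) : distWeight G u u = 1 := by
  rw [distWeight_of_reachable (SimpleGraph.Reachable.refl u), SimpleGraph.dist_self, pow_zero]

theorem distWeight_comm (u v : V) : distWeight G u v = distWeight G v u := by
  by_cases h : G.Reachable u v
  · rw [distWeight_of_reachable h, distWeight_of_reachable h.symm, SimpleGraph.dist_comm]
  · rw [distWeight_of_not_reachable h, distWeight_of_not_reachable fun h' => h h'.symm]

theorem distWeight_nonneg (u v : V) : 0 ≤ distWeight G u v := by
  by_cases h : G.Reachable u v
  · rw [distWeight_of_reachable h]; positivity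
  · rw [distWeight_of_not_reachable h]

theorem distWeight_le_one (u v : V) : distWeight G u v ≤ 1 := by
  by_cases h : G.Reachable u v
  · rw [distWeight_of_reachable h]; exact half_pow_le_one _
  · rw [distWeight_of_not_reachable h]; norm_num

variable {G H}

theorem distWeight_mono (h : G ≤ H) (u v : V) : distWeight G u v ≤ distWeight H u v := by
  by_cases hr : G.Reachable u v
  · rw [distWeight_of_reachable hr, distWeight_of_reachable (hr.mono h)]
    exact half_pow_le_half_pow (SimpleGraph.Reachable.dist_anti h hr)
  · rw [distWeight_of_not_reachable hr]; exact distWeight_nonneg _ _ _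

theorem distWeight_of_adj {u v : V} (h : G.Adj u v) : distWeight G u v = 1 / 2 := by
  rw [distWeight_of_reachable h.reachable, SimpleGraph.dist_eq_one_iff_adj.mpr h, pow_one]

theorem distWeight_triangle (u v w : V) :
    distWeight G u v * distWeight G v w ≤ distWeight G u w := by
  by_cases h1 : G.Reachable u v
  · by_cases h2 : G.Reachable v w
    · rw [distWeight_of_reachable h1, distWeight_of_reachable h2,
        distWeight_of_reachable (h1.trans h2), ← pow_add]
      obtain ⟨p, hp⟩ := h1.exists_walk_length_eq_dist
      obtain ⟨q, hq⟩ := h2.exists_walk_length_eq_dist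
      refine half_pow_le_half_pow ?_
      rw [← hp, ← hq, ← SimpleGraph.Walk.length_append]
      exact SimpleGraph.dist_le _
    · rw [distWeight_of_not_reachable h2, mul_zero]; exact distWeight_nonneg _ _ _
  · rw [distWeight_of_not_reachable h1, zero_mul]; exact distWeight_nonneg _ _ _

theorem distWeight_step (p : V) {q q' : V} (h : G.Adj q q') :
    distWeight G p q ≤ 2 * distWeight G p q' := by
  have := distWeight_triangle (G := G) p q q'
  rw [distWeight_of_adj h] at this
  linarith

/-- A function that at most halves along each edge is an upper bound for the weights. -/
theorem distWeight_le_of_step {p : V} (g : V → ℝ) (hp : 1 ≤ g p) (hg : ∀ q, 0 ≤ g q)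
    (hs : ∀ q q', G.Adj q q' → g q ≤ 2 * g q') (q : V) : distWeight G p q ≤ g q := by
  by_cases h : G.Reachable p q
  · rw [distWeight_of_reachable h]
    obtain ⟨w, hw⟩ := h.exists_walk_length_eq_dist
    rw [← hw]
    have key : ∀ {x y : V} (w : G.Walk x y), g x * (1 / 2) ^ w.length ≤ g y := by
      intro x y w
      induction w with
      | nil => simp
      | cons h w ih =>
        refine le_trans ?_ ih
        have h2 := hs _ _ h
        rw [SimpleGraph.Walk.length_cons, pow_succ]
        have := half_pow_pos w.length
        nlinarith
    have := key w
    have := half_pow_pos w.length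
    nlinarith
  · rw [distWeight_of_not_reachable h]; exact hg q

theorem distWeight_eq_zero_of_isolated {x y : V} (h : ∀ z, ¬ G.Adj y z) (hxy : x ≠ y) :
    distWeight G x y = 0 := by
  refine le_antisymm ?_ (distWeight_nonneg _ _ _)
  classical
  have := distWeight_le_of_step (G := G) (p := x) (fun q => if q = y then 0 else 1)
    (by simp [hxy]) (fun q => by split_ifs <;> norm_num) (fun q q' hqq => by
      have h1 : q ≠ y := by rintro rfl; exact h _ hqq
      have h2 : q' ≠ y := by rintro rfl; exact h _ hqq.symm
      simp [h1, h2]) y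
  simpa using this

end Weights

section Pairs

open Classical in
/-- The weight of a pair of different vertices, and `0` for a pair of equal vertices. -/
noncomputable def pairWeight {V : Type*} (G : SimpleGraph V) (u v : V) : ℝ :=
  if u = v then 0 else distWeight G u v

variable {V : Type*} {G H : SimpleGraph V}

theorem pairWeight_of_ne {u v : V} (h : u ≠ v) : pairWeight G u v = distWeight G u v := if_neg h

@[simp] theorem pairWeight_self (u : V) : pairWeight G u u = 0 := if_pos rfl

theorem pairWeight_comm (u v : V) : pairWeight G u v = pairWeight G v u := by
  by_cases h : u = v
  · rw [h]
  · rw [pairWeight_of_ne h, pairWeight_of_ne (Ne.symm h), distWeight_comm]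

theorem pairWeight_eq_zero_of_isolated {x y : V} (h : ∀ z, ¬ G.Adj y z) :
    pairWeight G x y = 0 := by
  by_cases hxy : x = y
  · simp [hxy]
  · rw [pairWeight_of_ne hxy, distWeight_eq_zero_of_isolated h hxy]

variable [Fintype V]

theorem closeness_eq_sum : closeness G = ∑ x, ∑ y, pairWeight G x y := by
  classical
  unfold closeness vertexCloseness
  refine sum_congr rfl fun x _ => ?_
  rw [← add_sum_erase univ (fun y => pairWeight G x y) (mem_univ x), pairWeight_self, zero_add]
  convert sum_congr rfl fun y hy => ?_
  exact (pairWeight_of_ne (ne_of_mem_erase hy).symm).symm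

/-- The total weight seen from a vertex, including its own weight `1`. -/
noncomputable def vertexWeight (G : SimpleGraph V) (x : V) : ℝ := ∑ y, distWeight G x y

theorem vertexWeight_eq (x : V) : vertexWeight G x = 1 + ∑ y, pairWeight G x y := by
  classical
  unfold vertexWeight
  rw [← add_sum_erase univ _ (mem_univ x), ← add_sum_erase univ (fun y => pairWeight G x y)
    (mem_univ x), pairWeight_self, zero_add, distWeight_self]
  congr 1
  exact sum_congr rfl fun y hy => (pairWeight_of_ne (ne_of_mem_erase hy).symm).symm

theorem vertexWeight_of_isolated {x : V} (h : ∀ z, ¬ G.Adj x z) : vertexWeight G x = 1 := by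
  rw [vertexWeight_eq, sum_eq_zero, add_zero]
  intro y _
  rw [pairWeight_comm]
  exact pairWeight_eq_zero_of_isolated h

theorem closeness_bot : closeness (⊥ : SimpleGraph V) = 0 := by
  rw [closeness_eq_sum]
  exact sum_eq_zero fun x _ => sum_eq_zero fun y _ =>
    pairWeight_eq_zero_of_isolated fun z => by simp

/-- A new edge raises the weight of its ends, and no weight decreases. -/
theorem closeness_lt_of_lt (h : G < H) : closeness G < closeness H := by
  have hle : ∀ x y, pairWeight G x y ≤ pairWeight H x y := by
    intro x y
    by_cases hxy : x = y
    · simp [hxy]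
    · rw [pairWeight_of_ne hxy, pairWeight_of_ne hxy]; exact distWeight_mono h.le x y
  obtain ⟨x, y, hH, hG⟩ : ∃ x y, H.Adj x y ∧ ¬ G.Adj x y := by
    by_contra! hc
    exact h.not_ge fun x y => hc x y
  rw [closeness_eq_sum, closeness_eq_sum]
  refine sum_lt_sum (fun x _ => sum_le_sum fun y _ => hle x y) ⟨x, mem_univ x, ?_⟩
  refine sum_lt_sum (fun y _ => hle x y) ⟨y, mem_univ y, ?_⟩
  rw [pairWeight_of_ne hH.ne, pairWeight_of_ne hH.ne, distWeight_of_adj hH]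
  by_cases hr : G.Reachable x y
  · rw [distWeight_of_reachable hr]
    have h0 : G.dist x y ≠ 0 := fun h0 => hH.ne (hr.dist_eq_zero_iff.mp h0)
    have h1 : G.dist x y ≠ 1 := fun h1 => hG (SimpleGraph.dist_eq_one_iff_adj.mp h1)
    refine (half_pow_le_half_pow (by omega : 2 ≤ G.dist x y)).trans_lt ?_
    norm_num
  · rw [distWeight_of_not_reachable hr]; norm_num

theorem closeness_le_of_le (h : G ≤ H) : closeness G ≤ closeness H := by
  rcases h.eq_or_lt with rfl | h
  · exact le_rfl
  · exact (closeness_lt_of_lt h).le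

end Pairs

section Glue

variable {V : Type*} {T Γ : SimpleGraph V} {ρ : V → V}

/-- Let the edges of `T` lie in the fibres of `ρ` and those of `Γ` between fixed points of `ρ`.
Then a shortest path in `Γ ⊔ T` between different fibres leaves and enters them at the fixed
points. -/
theorem distWeight_glue (hT : ∀ p q, T.Adj p q → ρ p = ρ q)
    (hΓ : ∀ x y, Γ.Adj x y → ρ x = x) (p q : V) :
    distWeight (Γ ⊔ T) p q = open Classical in if ρ q = ρ p then distWeight T p q else
      distWeight T p (ρ p) * distWeight Γ (ρ p) (ρ q) * distWeight T (ρ q) q := by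
  classical
  set g : V → ℝ := fun q => if ρ q = ρ p then distWeight T p q else
      distWeight T p (ρ p) * distWeight Γ (ρ p) (ρ q) * distWeight T (ρ q) q with hg
  have hg0 : ∀ q, 0 ≤ g q := by
    intro q
    simp only [hg]
    have := distWeight_nonneg T
    have := distWeight_nonneg Γ
    split_ifs
    · apply_assumption
    · exact mul_nonneg (mul_nonneg (by apply_assumption) (by apply_assumption))
        (by apply_assumption)
  refine le_antisymm ?_ ?_
  · refine (distWeight_le_of_step g (by simp [hg]) hg0 ?_ q).trans_eq (by simp [hg])
    intro q q' hqq
    rcases hqq with hqq | hqq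
    · have e1 := hΓ _ _ hqq
      have e2 := hΓ _ _ hqq.symm
      have hne := hqq.ne
      have a1 := distWeight_nonneg T p (ρ p)
      have a2 := distWeight_le_one Γ (ρ p) q
      simp only [hg, e1, e2, distWeight_self, mul_one]
      split_ifs with h1 h2 h2
      · exact absurd (h1.trans h2.symm) hne
      · rw [← h1, distWeight_of_adj hqq, h1]; linarith
      · rw [h2]; nlinarith
      · have := distWeight_step (G := Γ) (ρ p) hqq
        nlinarith
    · have e := hT _ _ hqq
      simp only [hg, e]
      split_ifs with h1
      · exact distWeight_step p hqq
      · have := distWeight_step (G := T) (ρ q') hqq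
        have b1 := distWeight_nonneg T p (ρ p)
        have b2 := distWeight_nonneg Γ (ρ p) (ρ q')
        nlinarith [mul_nonneg b1 b2]
  · show g q ≤ _
    simp only [hg]
    split_ifs with h
    · exact distWeight_mono le_sup_right p q
    · have c1 := distWeight_mono (le_sup_right : T ≤ Γ ⊔ T) p (ρ p)
      have c2 := distWeight_mono (le_sup_left : Γ ≤ Γ ⊔ T) (ρ p) (ρ q)
      have c3 := distWeight_mono (le_sup_right : T ≤ Γ ⊔ T) (ρ q) q
      have d1 := distWeight_triangle (G := Γ ⊔ T) p (ρ p) (ρ q)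
      have d2 := distWeight_triangle (G := Γ ⊔ T) p (ρ q) q
      calc _ ≤ distWeight (Γ ⊔ T) p (ρ p) * distWeight (Γ ⊔ T) (ρ p) (ρ q) *
            distWeight (Γ ⊔ T) (ρ q) q := by
            refine mul_le_mul (mul_le_mul c1 c2 (distWeight_nonneg _ _ _)
              (distWeight_nonneg _ _ _)) c3 (distWeight_nonneg _ _ _) ?_
            exact mul_nonneg (distWeight_nonneg _ _ _) (distWeight_nonneg _ _ _)
        _ ≤ _ := (mul_le_mul_of_nonneg_right d1 (distWeight_nonneg _ _ _)).trans d2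

theorem distWeight_eq_zero_of_fibre (hT : ∀ p q, T.Adj p q → ρ p = ρ q) {p q : V}
    (h : ρ p ≠ ρ q) : distWeight T p q = 0 := by
  refine distWeight_of_not_reachable fun hr => h ?_
  obtain ⟨w⟩ := hr
  clear h
  induction w with
  | nil => rfl
  | cons h _ ih => exact (hT _ _ h).trans ih

open Classical in
/-- The weight of `p` seen from the point `x` if `ρ p = x`. -/
noncomputable def fibreWeight (T : SimpleGraph V) (ρ : V → V) (p x : V) : ℝ :=
  if ρ p = x then distWeight T p x else 0

variable [Fintype V]

theorem sum_fibreWeight (hT : ∀ p q, T.Adj p q → ρ p = ρ q) {x : V} (hx : ρ x = x) :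
    ∑ p, fibreWeight T ρ p x = vertexWeight T x := by
  refine sum_congr rfl fun p _ => ?_
  rw [fibreWeight]
  split_ifs with h
  · exact distWeight_comm _ _ _
  · rw [distWeight_eq_zero_of_fibre hT]
    rw [hx]; exact Ne.symm h

theorem sum_fibreWeight_mul (p : V) (f : V → ℝ) :
    ∑ x, fibreWeight T ρ p x * f x = distWeight T p (ρ p) * f (ρ p) := by
  classical
  rw [sum_eq_single (ρ p)]
  · rw [fibreWeight, if_pos rfl]
  · intro x _ hx
    rw [fibreWeight, if_neg (Ne.symm hx), zero_mul]
  · simp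

theorem pairWeight_glue (hT : ∀ p q, T.Adj p q → ρ p = ρ q)
    (hΓ : ∀ x y, Γ.Adj x y → ρ x = x) (p q : V) :
    pairWeight (Γ ⊔ T) p q = pairWeight T p q +
      ∑ x, fibreWeight T ρ p x * ∑ y, fibreWeight T ρ q y * pairWeight Γ x y := by
  rw [sum_fibreWeight_mul, sum_fibreWeight_mul]
  by_cases hpq : p = q
  · subst hpq; simp
  rw [pairWeight_of_ne hpq, pairWeight_of_ne hpq, distWeight_glue hT hΓ]
  split_ifs with h
  · simp [h]
  · rw [pairWeight_of_ne (Ne.symm h), distWeight_eq_zero_of_fibre hT (Ne.symm h),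
      distWeight_comm T q]
    ring

theorem fibre_swap (hT : ∀ p q, T.Adj p q → ρ p = ρ q)
    (hΓ : ∀ x y, Γ.Adj x y → ρ x = x) (x : V) :
    ∑ q, ∑ y, fibreWeight T ρ q y * pairWeight Γ x y =
      ∑ y, vertexWeight T y * pairWeight Γ x y := by
  rw [sum_comm]
  refine sum_congr rfl fun y _ => ?_
  rw [← sum_mul]
  by_cases hy : ρ y = y
  · rw [sum_fibreWeight hT hy]
  · rw [pairWeight_eq_zero_of_isolated fun z hz => hy (hΓ _ _ hz), mul_zero, mul_zero]

/-- The closeness of a graph `Γ` with a part of `T` attached at each of its vertices. -/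
theorem closeness_glue (hT : ∀ p q, T.Adj p q → ρ p = ρ q)
    (hΓ : ∀ x y, Γ.Adj x y → ρ x = x) :
    closeness (Γ ⊔ T) = closeness T +
      ∑ x, ∑ y, vertexWeight T x * vertexWeight T y * pairWeight Γ x y := by
  simp only [closeness_eq_sum, pairWeight_glue hT hΓ, sum_add_distrib]
  congr 1
  calc _ = ∑ p, ∑ x, fibreWeight T ρ p x * ∑ q, ∑ y, fibreWeight T ρ q y * pairWeight Γ x y := by
        refine sum_congr rfl fun p _ => ?_
        rw [sum_comm]
        exact sum_congr rfl fun x _ => (mul_sum _ _ _).symm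
    _ = ∑ x, (∑ p, fibreWeight T ρ p x) * ∑ y, vertexWeight T y * pairWeight Γ x y := by
        rw [sum_comm]
        refine sum_congr rfl fun x _ => ?_
        rw [sum_mul]
        exact sum_congr rfl fun p _ => by rw [fibre_swap hT hΓ]
    _ = _ := by
        refine sum_congr rfl fun x _ => ?_
        by_cases hx : ρ x = x
        · rw [sum_fibreWeight hT hx, mul_sum]
          exact sum_congr rfl fun y _ => (mul_assoc _ _ _).symm
        · have h0 : ∀ y, pairWeight Γ x y = 0 := fun y => by
            rw [pairWeight_comm]
            exact pairWeight_eq_zero_of_isolated fun z hz => hx (hΓ _ _ hz)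
          simp [h0]

theorem vertexWeight_glue (hT : ∀ p q, T.Adj p q → ρ p = ρ q)
    (hΓ : ∀ x y, Γ.Adj x y → ρ x = x) {x : V} (hx : ρ x = x) :
    vertexWeight (Γ ⊔ T) x = vertexWeight T x + ∑ y, vertexWeight T y * pairWeight Γ x y := by
  rw [vertexWeight_eq, vertexWeight_eq (G := T)]
  simp only [pairWeight_glue hT hΓ, sum_add_distrib, sum_fibreWeight_mul, hx, distWeight_self,
    one_mul]
  rw [add_assoc, ← fibre_swap hT hΓ]
  simp only [sum_fibreWeight_mul]

end Glue

section Disjoint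

variable {V : Type*} {T₁ T₂ : SimpleGraph V} {A : Set V}

/-- Edges outside a set `A` do not matter for distances from a vertex of `A`. -/
theorem pairWeight_sup_of_mem (h₁ : ∀ p q, T₁.Adj p q → p ∈ A) (h₂ : ∀ p q, T₂.Adj p q → p ∉ A)
    {p : V} (hp : p ∈ A) (q : V) : pairWeight (T₁ ⊔ T₂) p q = pairWeight T₁ p q := by
  by_cases hpq : p = q
  · simp [hpq]
  rw [pairWeight_of_ne hpq, pairWeight_of_ne hpq]
  refine le_antisymm ?_ (distWeight_mono le_sup_left p q)
  refine distWeight_le_of_step (fun q => distWeight T₁ p q) (by simp)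
    (fun q => distWeight_nonneg _ _ _) ?_ q
  rintro q q' (h | h)
  · exact distWeight_step p h
  · rw [distWeight_eq_zero_of_isolated (fun z hz => h₂ _ _ h (h₁ _ _ hz))]
    · have := distWeight_nonneg T₁ p q'
      linarith
    · rintro rfl; exact h₂ _ _ h hp

variable [Fintype V]

theorem closeness_sup_of_disjoint (h₁ : ∀ p q, T₁.Adj p q → p ∈ A)
    (h₂ : ∀ p q, T₂.Adj p q → p ∉ A) :
    closeness (T₁ ⊔ T₂) = closeness T₁ + closeness T₂ := by
  simp only [closeness_eq_sum, ← sum_add_distrib]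
  refine sum_congr rfl fun p _ => sum_congr rfl fun q _ => ?_
  by_cases hp : p ∈ A
  · rw [pairWeight_sup_of_mem h₁ h₂ hp, pairWeight_comm (G := T₂),
      pairWeight_eq_zero_of_isolated (fun z hz => h₂ _ _ hz hp), add_zero]
  · rw [sup_comm, pairWeight_sup_of_mem (A := Aᶜ) (fun p q h => h₂ p q h)
      (fun p q h hc => hc (h₁ p q h)) hp, pairWeight_comm (G := T₁),
      pairWeight_eq_zero_of_isolated (fun z hz => hp (h₁ _ _ hz)), zero_add]

theorem vertexWeight_sup_of_mem (h₁ : ∀ p q, T₁.Adj p q → p ∈ A)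
    (h₂ : ∀ p q, T₂.Adj p q → p ∉ A) {p : V} (hp : p ∈ A) :
    vertexWeight (T₁ ⊔ T₂) p = vertexWeight T₁ p := by
  rw [vertexWeight_eq, vertexWeight_eq]
  simp only [pairWeight_sup_of_mem h₁ h₂ hp]

end Disjoint

section Clique

variable {V : Type*}

/-- The complete graph on a set of vertices; the other vertices are isolated. -/
def cliqueOn (X : Set V) : SimpleGraph V where
  Adj x y := x ≠ y ∧ x ∈ X ∧ y ∈ X
  symm := ⟨fun _ _ h => ⟨h.1.symm, h.2.2, h.2.1⟩⟩
  loopless := ⟨fun _ h => h.1 rfl⟩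

@[simp] theorem cliqueOn_adj {X : Set V} {x y : V} :
    (cliqueOn X).Adj x y ↔ x ≠ y ∧ x ∈ X ∧ y ∈ X := Iff.rfl

theorem pairWeight_cliqueOn (X : Set V) (x y : V) :
    pairWeight (cliqueOn X) x y =
      open Classical in if x ≠ y ∧ x ∈ X ∧ y ∈ X then 1 / 2 else 0 := by
  split_ifs with h
  · rw [pairWeight_of_ne h.1, distWeight_of_adj h]
  · by_cases hxy : x = y
    · simp [hxy]
    by_cases hx : x ∈ X
    · exact pairWeight_eq_zero_of_isolated fun z hz => h ⟨hxy, hx, hz.2.1⟩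
    · rw [pairWeight_comm]; exact pairWeight_eq_zero_of_isolated fun z hz => hx hz.2.1

/-- Deleting an edge of a clique with at least three vertices. -/
theorem pairWeight_cliqueOn_deleteEdges (X : Set V) {a b c : V} (ha : a ∈ X) (hb : b ∈ X)
    (hc : c ∈ X) (hab : a ≠ b) (hac : a ≠ c) (hbc : b ≠ c) (x y : V) :
    pairWeight ((cliqueOn X).deleteEdges {s(a, b)}) x y = pairWeight (cliqueOn X) x y -
      open Classical in if x = a ∧ y = b ∨ x = b ∧ y = a then 1 / 4 else 0 := by
  classical
  set K := (cliqueOn X).deleteEdges {s(a, b)}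
  have hK : ∀ {x y}, K.Adj x y ↔ (x ≠ y ∧ x ∈ X ∧ y ∈ X) ∧ ¬ (x = a ∧ y = b ∨ x = b ∧ y = a) := by
    intro x y
    simp [K, SimpleGraph.deleteEdges_adj]
  have key : distWeight K a b = 1 / 4 := by
    refine le_antisymm ?_ ?_
    · refine (distWeight_le_of_step (p := a)
        (fun q => if q = a then 1 else if q = b then 1 / 4 else 1 / 2) (by simp)
        (fun q => by split_ifs <;> norm_num) ?_ b).trans_eq (by simp [hab.symm])
      intro q q' hq
      rw [hK] at hq
      have h1 : ¬ (q = a ∧ q' = b) := fun h => hq.2 (Or.inl h)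
      split_ifs <;> first | (exfalso; tauto) | norm_num
    · have h1 : K.Adj a c := hK.mpr ⟨⟨hac, ha, hc⟩, by
        rintro (⟨-, h⟩ | ⟨-, h⟩)
        · exact hbc h.symm
        · exact hac h.symm⟩
      have h2 : K.Adj c b := hK.mpr ⟨⟨hbc.symm, hc, hb⟩, by
        rintro (⟨h, -⟩ | ⟨h, -⟩)
        · exact hac h.symm
        · exact hbc h.symm⟩
      have := distWeight_triangle (G := K) a c b
      rw [distWeight_of_adj h1, distWeight_of_adj h2] at this
      linarith
  by_cases hxy : x = y
  · subst hxy
    rw [if_neg (by rintro (⟨h1, h2⟩ | ⟨h1, h2⟩) <;> exact hab (by rw [← h1, ← h2]))]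
    simp
  rw [pairWeight_cliqueOn, pairWeight_of_ne hxy]
  by_cases h : x = a ∧ y = b ∨ x = b ∧ y = a
  · rw [if_pos h]
    rcases h with ⟨rfl, rfl⟩ | ⟨rfl, rfl⟩
    · rw [if_pos ⟨hxy, ha, hb⟩, key]; norm_num
    · rw [if_pos ⟨hxy, hb, ha⟩, distWeight_comm, key]; norm_num
  · rw [if_neg h, sub_zero]
    split_ifs with h'
    · exact distWeight_of_adj (hK.mpr ⟨h', h⟩)
    · rw [← pairWeight_of_ne hxy]
      by_cases hx : x ∈ X
      · exact pairWeight_eq_zero_of_isolated fun z hz => h' ⟨hxy, hx, (hK.mp hz).1.2.1⟩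
      · rw [pairWeight_comm]
        exact pairWeight_eq_zero_of_isolated fun z hz => hx (hK.mp hz).1.2.1

end Clique

end CutVertexCloseness

namespace CutVertexCloseness

open Finset BTree

/-! ### The graph of a tree of cliques -/

variable {V : Type*}

/-- The graph that a tree of cliques stands for. -/
def BTree.graph : BTree V → SimpleGraph V
  | leaf _ => ⊥
  | block r us => cliqueOn {x | r.root = x ∨ ∃ u ∈ us, u.root = x} ⊔
      (r.graph ⊔ (us.map fun u => u.graph).foldr (· ⊔ ·) ⊥)

/-- The disjoint union of the graphs of a list. -/
def sumGraph (L : List (BTree V)) : SimpleGraph V := (L.map graph).foldr (· ⊔ ·) ⊥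

/-- The roots of a list. -/
def rootSet (L : List (BTree V)) : Set V := {x | ∃ u ∈ L, u.root = x}

theorem mem_rootSet {L : List (BTree V)} {x : V} : x ∈ rootSet L ↔ ∃ u ∈ L, u.root = x := Iff.rfl

/-- The graph obtained by joining the roots of a list by a clique. -/
def listGraph (L : List (BTree V)) : SimpleGraph V := cliqueOn (rootSet L) ⊔ sumGraph L

/-- The list of all vertices of a list of rooted graphs. -/
def listVerts (L : List (BTree V)) : List V := L.flatMap verts

@[simp] theorem listVerts_nil : listVerts ([] : List (BTree V)) = [] := rfl
@[simp] theorem listVerts_cons (u : BTree V) (us : List (BTree V)) :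
    listVerts (u :: us) = u.verts ++ listVerts us := rfl
@[simp] theorem sumGraph_nil : sumGraph ([] : List (BTree V)) = ⊥ := rfl
@[simp] theorem sumGraph_cons (u : BTree V) (us : List (BTree V)) :
    sumGraph (u :: us) = u.graph ⊔ sumGraph us := rfl

theorem listVerts_perm {L L' : List (BTree V)} (h : L.Perm L') :
    (listVerts L).Perm (listVerts L') := h.flatMap_right _

theorem mem_listVerts {L : List (BTree V)} {x : V} :
    x ∈ listVerts L ↔ ∃ u ∈ L, x ∈ u.verts := List.mem_flatMap

theorem sumGraph_adj {L : List (BTree V)} {x y : V} :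
    (sumGraph L).Adj x y ↔ ∃ u ∈ L, u.graph.Adj x y := by
  induction L with
  | nil => simp
  | cons u us ih => simp [ih]

theorem rootSet_perm {L L' : List (BTree V)} (h : L.Perm L') : rootSet L = rootSet L' := by
  ext x; simp [rootSet, h.mem_iff]

theorem sumGraph_perm {L L' : List (BTree V)} (h : L.Perm L') : sumGraph L = sumGraph L' := by
  ext x y; simp [sumGraph_adj, h.mem_iff]

theorem listGraph_perm {L L' : List (BTree V)} (h : L.Perm L') : listGraph L = listGraph L' := by
  rw [listGraph, listGraph, rootSet_perm h, sumGraph_perm h]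

namespace BTree

@[simp] theorem root_leaf (v : V) : (leaf v).root = v := by simp [root]
@[simp] theorem root_block (r : BTree V) (us : List (BTree V)) :
    (block r us).root = r.root := by simp [root]
@[simp] theorem verts_leaf (v : V) : (leaf v).verts = [v] := by simp [verts]
@[simp] theorem verts_block (r : BTree V) (us : List (BTree V)) :
    (block r us).verts = listVerts (r :: us) := by simp [verts]; rfl
@[simp] theorem graph_leaf (v : V) : (leaf v).graph = ⊥ := by simp [graph]
theorem graph_block (r : BTree V) (us : List (BTree V)) :
    (block r us).graph = listGraph (r :: us) := by
  rw [graph, listGraph, sumGraph_cons]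
  have : {x | r.root = x ∨ ∃ u ∈ us, u.root = x} = rootSet (r :: us) := by
    ext x; simp [rootSet]
  rw [this]; rfl

theorem root_mem_verts (t : BTree V) : t.root ∈ t.verts := by
  induction t using ind with
  | leaf v => simp
  | block r us hr _ => simp [hr]

theorem mem_verts_of_adj {t : BTree V} {x y : V} (h : t.graph.Adj x y) : x ∈ t.verts := by
  induction t using ind with
  | leaf v => simp at h
  | block r us hr hus =>
    rw [graph_block, listGraph] at h
    rw [verts_block, mem_listVerts]
    rcases h with h | h
    · obtain ⟨u, hu, rfl⟩ := h.2.1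
      exact ⟨u, hu, u.root_mem_verts⟩
    · obtain ⟨u, hu, hxy⟩ := sumGraph_adj.mp h
      refine ⟨u, hu, ?_⟩
      rcases List.mem_cons.mp hu with rfl | hu
      · exact hr hxy
      · exact hus u hu hxy

theorem outer_add_inner (t : BTree V) : t.outerCount + t.innerCount = t.verts.length ∧
    t.outerRootCount + t.innerRootCount = t.verts.length := by
  induction t using ind with
  | leaf v => simp
  | block r us hr hus =>
    have : listOuter us + listInner us = (listVerts us).length := by
      clear hr
      induction us with
      | nil => simp
      | cons u us ih =>
        have h1 := ih fun x hx => hus x (by simp [hx])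
        have h2 := (hus u (by simp)).1
        simp only [listOuter_cons, listInner_cons, listVerts_cons, List.length_append]
        omega
    simp only [outerCount_block, innerCount_block, outerRootCount_block, innerRootCount_block,
      verts_block, listVerts_cons, List.length_append]
    omega

end BTree

theorem listOuter_add_listInner (L : List (BTree V)) :
    listOuter L + listInner L = (listVerts L).length := by
  induction L with
  | nil => simp
  | cons u us ih =>
    have := u.outer_add_inner.1
    simp only [listOuter_cons, listInner_cons, listVerts_cons, List.length_append]
    omega

section Nodup

variable {L : List (BTree V)} (hL : (listVerts L).Nodup)
include hL

theorem eq_of_mem_verts {u u' : BTree V} (hu : u ∈ L) (hu' : u' ∈ L) {x : V} (h : x ∈ u.verts)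
    (h' : x ∈ u'.verts) : u = u' := by
  induction L with
  | nil => simp at hu
  | cons w L ih =>
    rw [listVerts_cons, List.nodup_append] at hL
    rcases List.mem_cons.mp hu with e | m <;> rcases List.mem_cons.mp hu' with e' | m'
    · rw [e, e']
    · exact absurd rfl (hL.2.2 x (e ▸ h) x (mem_listVerts.mpr ⟨u', m', h'⟩))
    · exact absurd rfl (hL.2.2 x (e' ▸ h') x (mem_listVerts.mpr ⟨u, m, h⟩))
    · exact ih hL.2.1 m m'

theorem nodup_of_mem {u : BTree V} (hu : u ∈ L) : u.verts.Nodup :=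
  (List.nodup_flatMap.mp hL).1 u hu

theorem nodup_roots : (L.map root).Nodup := by
  induction L with
  | nil => simp
  | cons w L ih =>
    rw [listVerts_cons, List.nodup_append] at hL
    rw [List.map_cons, List.nodup_cons]
    refine ⟨fun h => ?_, ih hL.2.1⟩
    obtain ⟨u, hu, e⟩ := List.mem_map.mp h
    exact hL.2.2 _ w.root_mem_verts _ (mem_listVerts.mpr ⟨u, hu, e ▸ u.root_mem_verts⟩) rfl

/-- The map that sends every vertex to the root of its branch. -/
theorem exists_root_map : ∃ ρ : V → V, ∀ u ∈ L, ∀ p ∈ u.verts, ρ p = u.root := by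
  classical
  refine ⟨fun p => if h : ∃ u ∈ L, p ∈ u.verts then h.choose.root else p, fun u hu p hp => ?_⟩
  have h : ∃ u ∈ L, p ∈ u.verts := ⟨u, hu, hp⟩
  simp only [dif_pos h]
  rw [eq_of_mem_verts hL h.choose_spec.1 hu h.choose_spec.2 hp]

variable [Fintype V]

theorem closeness_sumGraph (h : ∀ u ∈ L, closeness u.graph = u.close) :
    closeness (sumGraph L) = (L.map close).sum := by
  induction L with
  | nil => simpa using closeness_bot
  | cons u us ih =>
    rw [listVerts_cons, List.nodup_append] at hL
    rw [sumGraph_cons, closeness_sup_of_disjoint (A := {x | x ∈ u.verts})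
      (fun p q => mem_verts_of_adj), ih hL.2.1 (fun x hx => h x (by simp [hx])), h u (by simp),
      List.map_cons, List.sum_cons]
    intro p q hpq hp
    obtain ⟨u', hu', h'⟩ := sumGraph_adj.mp hpq
    exact hL.2.2 p hp p (mem_listVerts.mpr ⟨u', hu', mem_verts_of_adj h'⟩) rfl

theorem vertexWeight_sumGraph {u : BTree V} (hu : u ∈ L) {x : V} (hx : x ∈ u.verts) :
    vertexWeight (sumGraph L) x = vertexWeight u.graph x := by
  classical
  have hp := List.perm_cons_erase hu
  have hL' : (listVerts (u :: L.erase u)).Nodup := ((listVerts_perm hp).nodup_iff).mp hL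
  rw [sumGraph_perm hp, sumGraph_cons, vertexWeight_sup_of_mem (A := {x | x ∈ u.verts})
    (fun p q => mem_verts_of_adj) _ hx]
  intro p q hpq hp
  obtain ⟨u', hu', h'⟩ := sumGraph_adj.mp hpq
  rw [listVerts_cons, List.nodup_append] at hL'
  exact hL'.2.2 p hp p (mem_listVerts.mpr ⟨u', hu', mem_verts_of_adj h'⟩) rfl

/-- Closeness after joining the branches by a graph `Γ` on their roots. -/
theorem closeness_join {Γ : SimpleGraph V} (hΓ : ∀ x y, Γ.Adj x y → x ∈ rootSet L)
    (h : ∀ u ∈ L, closeness u.graph = u.close) :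
    closeness (Γ ⊔ sumGraph L) = (L.map close).sum + ∑ x, ∑ y,
      vertexWeight (sumGraph L) x * vertexWeight (sumGraph L) y * pairWeight Γ x y := by
  obtain ⟨ρ, hρ⟩ := exists_root_map hL
  rw [← closeness_sumGraph hL h]
  refine closeness_glue (ρ := ρ) (fun p q hpq => ?_) fun x y hxy => ?_
  · obtain ⟨u, hu, h'⟩ := sumGraph_adj.mp hpq
    rw [hρ u hu p (mem_verts_of_adj h'), hρ u hu q (mem_verts_of_adj h'.symm)]
  · obtain ⟨u, hu, rfl⟩ := hΓ x y hxy
    exact hρ u hu _ u.root_mem_verts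

theorem vertexWeight_join {Γ : SimpleGraph V} (hΓ : ∀ x y, Γ.Adj x y → x ∈ rootSet L)
    {x : V} (hx : x ∈ rootSet L) :
    vertexWeight (Γ ⊔ sumGraph L) x = vertexWeight (sumGraph L) x +
      ∑ y, vertexWeight (sumGraph L) y * pairWeight Γ x y := by
  obtain ⟨ρ, hρ⟩ := exists_root_map hL
  refine vertexWeight_glue (ρ := ρ) (fun p q hpq => ?_) (fun x y hxy => ?_) ?_
  · obtain ⟨u, hu, h'⟩ := sumGraph_adj.mp hpq
    rw [hρ u hu p (mem_verts_of_adj h'), hρ u hu q (mem_verts_of_adj h'.symm)]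
  · obtain ⟨u, hu, rfl⟩ := hΓ x y hxy
    exact hρ u hu _ u.root_mem_verts
  · obtain ⟨u, hu, rfl⟩ := hx
    exact hρ u hu _ u.root_mem_verts

theorem sum_rootSet (f : V → ℝ) :
    ∑ x, (open Classical in if x ∈ rootSet L then f x else 0) =
      (L.map fun u => f u.root).sum := by
  classical
  rw [← sum_filter]
  have : (univ.filter fun x => x ∈ rootSet L) = (L.map root).toFinset := by
    ext x; simp [mem_rootSet]
  rw [this, List.sum_toFinset _ (nodup_roots hL), List.map_map]
  rfl

variable (h : ∀ u ∈ L, vertexWeight u.graph u.root = u.weight)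
include h

theorem sum_rootSet_weight :
    ∑ x, (open Classical in if x ∈ rootSet L then vertexWeight (sumGraph L) x else 0) =
      listWeight L := by
  rw [sum_rootSet hL, listWeight]
  congr 1
  refine List.map_congr_left fun u hu => ?_
  rw [vertexWeight_sumGraph hL hu u.root_mem_verts, h u hu]

theorem closeness_listGraph_of (hc : ∀ u ∈ L, closeness u.graph = u.close) :
    closeness (listGraph L) = listClose L := by
  classical
  rw [listGraph, closeness_join hL (fun x y hxy => (cliqueOn_adj.mp hxy).2.1) hc, listClose, listPairs,
    ← sum_rootSet_weight hL h]
  congr 1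
  set ω := vertexWeight (sumGraph L)
  have hsq : (L.map fun u => u.weight ^ 2).sum =
      ∑ x, (if x ∈ rootSet L then ω x else 0) * (if x ∈ rootSet L then ω x else 0) := by
    rw [show (L.map fun u => u.weight ^ 2) = L.map fun u => (fun x => ω x ^ 2) u.root from
      List.map_congr_left fun u hu => by
        beta_reduce
        rw [show ω u.root = _ from vertexWeight_sumGraph hL hu u.root_mem_verts, h u hu]]
    rw [← sum_rootSet hL fun x => ω x ^ 2]
    exact sum_congr rfl fun x _ => by split_ifs <;> ring
  rw [hsq, sq, sum_mul_sum, ← sum_sub_distrib, sum_div]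
  refine sum_congr rfl fun x _ => ?_
  have e : ∀ c : ℝ, c = ∑ y, if y = x then c else 0 := fun c => by simp
  rw [e ((if x ∈ rootSet L then ω x else 0) * (if x ∈ rootSet L then ω x else 0)),
    ← sum_sub_distrib, sum_div]
  refine sum_congr rfl fun y _ => ?_
  rw [pairWeight_cliqueOn]
  by_cases hxy : x = y
  · subst hxy; simp
  · by_cases hx : x ∈ rootSet L <;> by_cases hy : y ∈ rootSet L <;> simp [hxy, hx, hy, Ne.symm hxy]
    ring

theorem vertexWeight_listGraph_of {u : BTree V} (hu : u ∈ L) :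
    vertexWeight (listGraph L) u.root = u.weight + (listWeight L - u.weight) / 2 := by
  classical
  have hur : u.root ∈ rootSet L := ⟨u, hu, rfl⟩
  have hw : vertexWeight (sumGraph L) u.root = u.weight := by
    rw [vertexWeight_sumGraph hL hu u.root_mem_verts, h u hu]
  rw [listGraph, vertexWeight_join hL (fun x y hxy => (cliqueOn_adj.mp hxy).2.1) hur, hw,
    ← sum_rootSet_weight hL h]
  congr 1
  rw [show u.weight = ∑ y, if y = u.root then vertexWeight (sumGraph L) y else 0 by simp [hw],
    ← sum_sub_distrib, sum_div]
  refine sum_congr rfl fun y _ => ?_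
  rw [pairWeight_cliqueOn]
  by_cases hxy : u.root = y
  · subst hxy; simp [hur]
  · by_cases hy : y ∈ rootSet L <;> simp [hxy, hur, hy, Ne.symm hxy]
    ring

end Nodup

theorem sumGraph_deleteEdges {t₁ t₂ : BTree V} {L : List (BTree V)}
    (hL : (listVerts (t₁ :: t₂ :: L)).Nodup) :
    (sumGraph (t₁ :: t₂ :: L)).deleteEdges {s(t₁.root, t₂.root)} = sumGraph (t₁ :: t₂ :: L) := by
  rw [SimpleGraph.deleteEdges_eq_self, Set.disjoint_singleton_right, SimpleGraph.mem_edgeSet]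
  intro h
  obtain ⟨u, hu, h⟩ := sumGraph_adj.mp h
  have e1 := eq_of_mem_verts hL hu (by simp) (mem_verts_of_adj h) t₁.root_mem_verts
  have e2 := eq_of_mem_verts hL hu (by simp) (mem_verts_of_adj h.symm) t₂.root_mem_verts
  rw [← e1, ← e2] at h
  exact h.ne rfl

theorem root_ne_root {t₁ t₂ : BTree V} {L : List (BTree V)}
    (hL : (listVerts (t₁ :: t₂ :: L)).Nodup) : t₁.root ≠ t₂.root := by
  have := nodup_roots hL
  simp only [List.map_cons, List.nodup_cons, List.mem_cons, not_or] at this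
  exact this.1.1

theorem sup_deleteEdges (G H : SimpleGraph V) (s : Set (Sym2 V)) :
    (G ⊔ H).deleteEdges s = G.deleteEdges s ⊔ H.deleteEdges s := by
  ext x y; simp only [SimpleGraph.deleteEdges_adj, SimpleGraph.sup_adj]; tauto

variable [Fintype V]

/-- The recursive definitions of `close` and `weight` are correct. -/
theorem BTree.closeness_and_weight (t : BTree V) (ht : t.verts.Nodup) :
    closeness t.graph = t.close ∧ vertexWeight t.graph t.root = t.weight := by
  induction t using ind with
  | leaf v =>
    rw [graph_leaf, close_leaf, weight_leaf]
    exact ⟨closeness_bot, vertexWeight_of_isolated (by simp)⟩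
  | block r us hr hus =>
    rw [verts_block] at ht
    have H : ∀ u ∈ r :: us, closeness u.graph = u.close ∧
        vertexWeight u.graph u.root = u.weight := by
      intro u hu
      have hn := nodup_of_mem ht hu
      rcases List.mem_cons.mp hu with rfl | hu
      · exact hr hn
      · exact hus u hu hn
    rw [graph_block]
    refine ⟨?_, ?_⟩
    · rw [closeness_listGraph_of ht (fun u hu => (H u hu).2) (fun u hu => (H u hu).1), close_block]
    · rw [root_block, vertexWeight_listGraph_of ht (fun u hu => (H u hu).2) (u := r) (by simp),
        weight_block, listWeight_cons]
      ring

section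

variable {L : List (BTree V)} (hL : (listVerts L).Nodup)
include hL

theorem closeness_of_mem {u : BTree V} (hu : u ∈ L) : closeness u.graph = u.close :=
  (u.closeness_and_weight (nodup_of_mem hL hu)).1

theorem weight_of_mem {u : BTree V} (hu : u ∈ L) : vertexWeight u.graph u.root = u.weight :=
  (u.closeness_and_weight (nodup_of_mem hL hu)).2

theorem closeness_listGraph : closeness (listGraph L) = listClose L :=
  closeness_listGraph_of hL (fun _ hu => weight_of_mem hL hu) fun _ hu => closeness_of_mem hL hu

end

/-- Deleting a bridge. -/
theorem closeness_deleteEdges_pair {t₁ t₂ : BTree V} (hL : (listVerts [t₁, t₂]).Nodup) :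
    closeness ((listGraph [t₁, t₂]).deleteEdges {s(t₁.root, t₂.root)}) = t₁.close + t₂.close := by
  have : (cliqueOn (rootSet [t₁, t₂])).deleteEdges {s(t₁.root, t₂.root)} = ⊥ := by
    ext x y
    simp only [SimpleGraph.deleteEdges_adj, cliqueOn_adj, List.mem_cons,
      List.not_mem_nil, or_false, exists_eq_or_imp, exists_eq_left, mem_rootSet,
      Set.mem_singleton_iff, SimpleGraph.bot_adj, iff_false, not_and, not_not]
    rintro ⟨hne, rfl | rfl, rfl | rfl⟩
    · exact absurd rfl hne
    · rfl
    · exact Sym2.eq_swap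
    · exact absurd rfl hne
  rw [listGraph, sup_deleteEdges, this, bot_sup_eq, sumGraph_deleteEdges hL,
    closeness_sumGraph hL fun u hu => closeness_of_mem hL hu]
  simp

/-- Deleting an edge of a block with at least three vertices. -/
theorem closeness_deleteEdges_of_three {t₁ t₂ t₃ : BTree V} {L : List (BTree V)}
    (hL : (listVerts (t₁ :: t₂ :: t₃ :: L)).Nodup) :
    closeness ((listGraph (t₁ :: t₂ :: t₃ :: L)).deleteEdges {s(t₁.root, t₂.root)}) =
      listClose (t₁ :: t₂ :: t₃ :: L) - t₁.weight * t₂.weight / 2 := by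
  classical
  have h12 := root_ne_root hL
  have hnd := nodup_roots hL
  simp only [List.map_cons, List.nodup_cons, List.mem_cons, not_or] at hnd
  rw [← closeness_listGraph hL, listGraph, sup_deleteEdges, sumGraph_deleteEdges hL,
    closeness_join hL (fun x y hxy => (cliqueOn_adj.mp hxy).2.1) (fun u hu => closeness_of_mem hL hu),
    closeness_join hL (fun x y hxy => (cliqueOn_adj.mp (SimpleGraph.deleteEdges_adj.mp hxy).1).2.1)
      (fun u hu => closeness_of_mem hL hu)]
  set M := t₁ :: t₂ :: t₃ :: L with hM
  have w1 : vertexWeight (sumGraph M) t₁.root = t₁.weight := by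
    rw [vertexWeight_sumGraph hL (u := t₁) (by simp [hM]) t₁.root_mem_verts,
      weight_of_mem hL (by simp [hM])]
  have w2 : vertexWeight (sumGraph M) t₂.root = t₂.weight := by
    rw [vertexWeight_sumGraph hL (u := t₂) (by simp [hM]) t₂.root_mem_verts,
      weight_of_mem hL (by simp [hM])]
  rw [add_sub_assoc]
  congr 1
  simp only [pairWeight_cliqueOn_deleteEdges (rootSet M) (a := t₁.root) (b := t₂.root)
    (c := t₃.root) ⟨t₁, by simp [hM], rfl⟩ ⟨t₂, by simp [hM], rfl⟩ ⟨t₃, by simp [hM], rfl⟩ h12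
    hnd.1.2.1 hnd.2.1.1, mul_sub, sum_sub_distrib]
  congr 1
  have : ∀ x y, vertexWeight (sumGraph M) x * vertexWeight (sumGraph M) y *
      (if x = t₁.root ∧ y = t₂.root ∨ x = t₂.root ∧ y = t₁.root then (1 : ℝ) / 4 else 0) =
      (if x = t₁.root then (if y = t₂.root then t₁.weight * t₂.weight / 4 else 0) else 0) +
      (if x = t₂.root then (if y = t₁.root then t₁.weight * t₂.weight / 4 else 0) else 0) := by
    intro x y
    by_cases h1 : x = t₁.root
    · subst h1
      by_cases h2 : y = t₂.root
      · subst h2; simp [h12, w1, w2]; ring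
      · simp [h2, h12]
    · by_cases h3 : x = t₂.root
      · subst h3
        by_cases h4 : y = t₁.root
        · subst h4; simp [h1, w1, w2]; ring
        · simp [h1, h4]
      · simp [h1, h3]
  simp only [this, sum_add_distrib]
  simp
  ring

end CutVertexCloseness

namespace CutVertexCloseness

open BTree

/-! ### Representing a graph by a list of branches at a block -/

section Residual

variable {V : Type*} [Fintype V]

theorem linkResidualCloseness_le {G : SimpleGraph V} {e : Sym2 V} (he : e ∈ G.edgeSet) :
    linkResidualCloseness G ≤ closeness (G.deleteEdges {e}) :=
  (isLeast_linkResidualCloseness G ⟨e, he⟩).2 ⟨e, he, rfl⟩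

theorem le_linkResidualCloseness {G : SimpleGraph V} (hG : G.edgeSet.Nonempty) {c : ℝ}
    (h : ∀ e ∈ G.edgeSet, c ≤ closeness (G.deleteEdges {e})) : c ≤ linkResidualCloseness G := by
  obtain ⟨e, he, h'⟩ := (isLeast_linkResidualCloseness G hG).1
  rw [h']; exact h e he

end Residual

variable {V : Type*}

/-- The graph `Γ` is obtained by joining the roots of the branches in `L` by a clique, and `k` of
its vertices are inner vertices of the branches, that is, cut vertices. -/
structure IsRep (Γ : SimpleGraph V) (k : ℕ) (L : List (BTree V)) : Prop where
  nodup : (listVerts L).Nodup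
  cover : ∀ x, x ∈ listVerts L
  proper : ∀ u ∈ L, u.Proper
  graph_eq : listGraph L = Γ
  inner_eq : listInner L = k

/-- The list `w` is one of the blocks at the root of `t`, and `r` is the rest of `t`. -/
inductive RootBlock : BTree V → BTree V → List (BTree V) → Prop
  | here (r : BTree V) (us : List (BTree V)) : RootBlock (block r us) r us
  | there {r r' : BTree V} {w : List (BTree V)} (us : List (BTree V)) : RootBlock r r' w →
      RootBlock (block r us) (block r' us) w

namespace RootBlock

variable {t r : BTree V} {w : List (BTree V)}

theorem root_eq (h : RootBlock t r w) : r.root = t.root := by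
  induction h with
  | here r us => simp
  | there us _ ih => simpa using ih

theorem verts_perm (h : RootBlock t r w) : t.verts.Perm (r.verts ++ listVerts w) := by
  induction h with
  | here r us => simp
  | there us _ ih =>
    simp only [verts_block, listVerts_cons]
    refine (ih.append_right _).trans ?_
    rw [List.append_assoc, List.append_assoc]
    exact List.Perm.append_left _ List.perm_append_comm

theorem proper (h : RootBlock t r w) (ht : t.Proper) :
    r.Proper ∧ w ≠ [] ∧ ∀ u ∈ w, u.Proper := by
  induction h with
  | here r us =>
    cases ht with
    | block h1 h2 h3 => exact ⟨h1, h2, h3⟩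
  | there us _ ih =>
    cases ht with
    | block h1 h2 h3 => exact ⟨.block (ih h1).1 h2 h3, (ih h1).2⟩

theorem innerRootCount_eq (h : RootBlock t r w) :
    t.innerRootCount = r.innerRootCount + listInner w := by
  induction h with
  | here r us => simp
  | there us _ ih => simp [ih]; ring

theorem outerRootCount_eq (h : RootBlock t r w) :
    t.outerRootCount = r.outerRootCount + listOuter w := by
  induction h with
  | here r us => simp
  | there us _ ih => simp [ih]; ring

theorem innerCount_eq (h : RootBlock t r w) :
    t.innerCount = r.innerRootCount + listInner w := by
  rw [← h.innerRootCount_eq]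
  cases h <;> simp

theorem length_lt (h : RootBlock t r w) {u : BTree V} (hu : u ∈ w) :
    u.verts.length < t.verts.length := by
  classical
  rw [h.verts_perm.length_eq, List.length_append]
  have h1 : 0 < r.verts.length := List.length_pos_of_mem r.root_mem_verts
  have h2 := (listVerts_perm (List.perm_cons_erase hu)).length_eq
  rw [listVerts_cons, List.length_append] at h2
  omega

theorem graph_eq (h : RootBlock t r w) : t.graph = listGraph (r :: w) := by
  induction h with
  | here r us => exact graph_block r us
  | @there r r' w us h ih =>
    have e1 : rootSet (r :: us) = rootSet (r' :: us) := by
      ext x; simp [mem_rootSet, h.root_eq]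
    have e2 : rootSet (block r' us :: w) = rootSet (r' :: w) := by
      ext x; simp [mem_rootSet]
    rw [graph_block]
    simp only [listGraph, sumGraph_cons] at ih ⊢
    rw [ih, graph_block, e1, e2]
    simp only [listGraph, sumGraph_cons]
    ac_rfl

end RootBlock

theorem BTree.good_of_rootBlock {t : BTree V}
    (h : ∀ r w, RootBlock t r w → 2 ≤ w.length ∨ ∀ u ∈ w, u.IsPath) : t.Good := by
  induction t using ind with
  | leaf v => exact .leaf v
  | block r us hr _ =>
    exact .block (hr fun r' w hw => h _ w (.there us hw)) (h r us (.here r us))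

theorem BTree.hasThickChild_iff {t : BTree V} :
    t.HasThickChild ↔ ∃ r w, RootBlock t r w ∧ ∃ u ∈ w, ¬ u.IsPath := by
  induction t using ind with
  | leaf v =>
    simp only [HasThickChild, false_iff]
    rintro ⟨r, w, h, -⟩
    cases h
  | block r us hr _ =>
    rw [HasThickChild, hr]
    constructor
    · rintro (⟨r', w, h, hu⟩ | h)
      · exact ⟨_, w, .there us h, hu⟩
      · exact ⟨r, us, .here r us, h⟩
    · rintro ⟨r', w, h, hu⟩
      cases h with
      | here => exact Or.inr hu
      | there _ h => exact Or.inl ⟨_, w, h, hu⟩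

/-- The number of neighbours of the root. -/
def BTree.rootDegree : BTree V → ℕ
  | leaf _ => 0
  | block r us => r.rootDegree + us.length

theorem two_le_rootDegree {r : BTree V} {us : List (BTree V)} (h : (block r us).Proper)
    (hb : r.isLeaf = false ∨ 2 ≤ us.length) : 2 ≤ (block r us).rootDegree := by
  cases h with
  | block h1 h2 h3 =>
    rw [rootDegree]
    have := List.length_pos_iff.mpr h2
    rcases hb with hb | hb
    · cases h1 with
      | leaf v => simp [isLeaf] at hb
      | block g1 g2 g3 =>
        have := List.length_pos_iff.mpr g2
        rw [rootDegree]; omega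
    · omega

theorem listInner_add_length_le {L : List (BTree V)} {q : ℕ}
    (h : ∀ u ∈ L, u.innerCount + 1 ≤ q * u.outerCount) :
    listInner L + L.length ≤ q * listOuter L := by
  induction L with
  | nil => simp
  | cons u us ih =>
    have a := ih fun x hx => h x (by simp [hx])
    have b := h u (by simp)
    simp only [listInner_cons, listOuter_cons, List.length_cons, mul_add]
    omega

theorem innerRootCount_add_rootDegree_le {t : BTree V} {q : ℕ}
    (h : ∀ r w, RootBlock t r w → ∀ u ∈ w, u.innerCount + 1 ≤ q * u.outerCount) :
    t.innerRootCount + t.rootDegree ≤ 1 + q * t.outerRootCount := by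
  induction t using ind with
  | leaf v => simp [rootDegree]
  | block r us hr _ =>
    have h1 := hr fun r' w hw => h _ w (.there us hw)
    have h2 := listInner_add_length_le (h r us (.here r us))
    simp only [innerRootCount_block, outerRootCount_block, rootDegree, mul_add]
    omega

theorem innerRootCount_le_of_rootBlock {t : BTree V} {q : ℕ}
    (h : ∀ r w, RootBlock t r w → listInner w ≤ q * listOuter w) :
    t.innerRootCount ≤ 1 + q * t.outerRootCount := by
  induction t using ind with
  | leaf v => simp
  | block r us hr _ =>
    have h1 := hr fun r' w hw => h _ w (.there us hw)
    have h2 := h r us (.here r us)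
    simp only [innerRootCount_block, outerRootCount_block, mul_add]
    omega

namespace IsRep

variable {Γ : SimpleGraph V} {k : ℕ} {L : List (BTree V)}

theorem perm {L' : List (BTree V)} (h : IsRep Γ k L) (hp : L.Perm L') : IsRep Γ k L' where
  nodup := (listVerts_perm hp).nodup_iff.mp h.nodup
  cover x := (listVerts_perm hp).mem_iff.mp (h.cover x)
  proper u hu := h.proper u (hp.mem_iff.mpr hu)
  graph_eq := by rw [← listGraph_perm hp]; exact h.graph_eq
  inner_eq := by rw [← listInner_perm hp]; exact h.inner_eq

theorem swap {t₁ t₂ : BTree V} (h : IsRep Γ k (t₁ :: t₂ :: L)) : IsRep Γ k (t₂ :: t₁ :: L) :=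
  h.perm (List.Perm.swap _ _ _)

/-- Passing from a block to another block at the root of one of its branches. -/
theorem move {t r : BTree V} {w : List (BTree V)} (h : IsRep Γ k (t :: L)) (hL : L ≠ [])
    (hw : RootBlock t r w) : IsRep Γ k (block r L :: w) := by
  have hp : (listVerts (t :: L)).Perm (listVerts (block r L :: w)) := by
    simp only [listVerts_cons, verts_block]
    refine (hw.verts_perm.append_right _).trans ?_
    rw [List.append_assoc, List.append_assoc]
    exact List.Perm.append_left _ List.perm_append_comm
  obtain ⟨p1, p2, p3⟩ := hw.proper (h.proper t (by simp))
  refine ⟨hp.nodup_iff.mp h.nodup, fun x => hp.mem_iff.mp (h.cover x), ?_, ?_, ?_⟩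
  · intro u hu
    rcases List.mem_cons.mp hu with rfl | hu
    · exact .block p1 hL fun u hu => h.proper u (by simp [hu])
    · exact p3 u hu
  · rw [← h.graph_eq]
    have e1 : rootSet (t :: L) = rootSet (r :: L) := by
      ext x; simp [mem_rootSet, hw.root_eq]
    have e2 : rootSet (block r L :: w) = rootSet (r :: w) := by
      ext x; simp [mem_rootSet]
    simp only [listGraph, sumGraph_cons]
    rw [hw.graph_eq, graph_block, e1, e2]
    simp only [listGraph, sumGraph_cons]
    ac_rfl
  · rw [← h.inner_eq, listInner_cons, listInner_cons, hw.innerCount_eq, innerCount_block]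
    ring

theorem move_block {r : BTree V} {us : List (BTree V)} (h : IsRep Γ k (block r us :: L))
    (hL : L ≠ []) : IsRep Γ k (block r L :: us) := h.move hL (.here r us)

/-- Passing to a branch `u` at the block `w`. -/
theorem descend [DecidableEq (BTree V)] {t r u : BTree V} {w : List (BTree V)}
    (h : IsRep Γ k (t :: L)) (hL : L ≠ []) (hw : RootBlock t r w) (hu : u ∈ w) :
    IsRep Γ k (u :: block r L :: w.erase u) :=
  ((h.move hL hw).perm ((List.perm_cons_erase hu).cons _)).swap

theorem adj {t₁ t₂ : BTree V} (h : IsRep Γ k (t₁ :: t₂ :: L)) : Γ.Adj t₁.root t₂.root := by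
  rw [← h.graph_eq]
  exact Or.inl (cliqueOn_adj.mpr ⟨root_ne_root h.nodup, ⟨t₁, by simp, rfl⟩, ⟨t₂, by simp, rfl⟩⟩)

variable [Fintype V]

theorem outer_add (h : IsRep Γ k L) : listOuter L + k = Fintype.card V := by
  classical
  rw [← h.inner_eq, listOuter_add_listInner, ← List.toFinset_card_of_nodup h.nodup,
    ← Finset.card_univ]
  congr 1
  ext x
  simp [h.cover x]

theorem closeness_eq (h : IsRep Γ k L) : closeness Γ = listClose L := by
  rw [← h.graph_eq, closeness_listGraph h.nodup]

theorem residual_le_pair {t₁ t₂ : BTree V} (h : IsRep Γ k [t₁, t₂]) :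
    linkResidualCloseness Γ ≤ t₁.close + t₂.close := by
  refine (linkResidualCloseness_le (e := s(t₁.root, t₂.root)) h.adj).trans_eq ?_
  rw [← h.graph_eq, closeness_deleteEdges_pair h.nodup]

theorem residual_le_three {t₁ t₂ t₃ : BTree V} (h : IsRep Γ k (t₁ :: t₂ :: t₃ :: L)) :
    linkResidualCloseness Γ ≤
      listClose (t₁ :: t₂ :: t₃ :: L) - t₁.weight * t₂.weight / 2 := by
  refine (linkResidualCloseness_le (e := s(t₁.root, t₂.root)) h.adj).trans_eq ?_
  rw [← h.graph_eq, closeness_deleteEdges_of_three h.nodup]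

end IsRep

theorem listClose_of_paths {L : List (BTree V)} (h : ∀ u ∈ L, u.IsPath) :
    listClose L = pathsCloseness (L.map innerCount : Multiset ℕ) ∧
      listWeight L = slotSum (L.map innerCount : Multiset ℕ) ∧ listOuter L = L.length := by
  induction L with
  | nil => simp [pathsCloseness]
  | cons u L ih =>
    obtain ⟨h1, h2, h3⟩ := ih fun x hx => h x (by simp [hx])
    have hu := h u (by simp)
    rw [List.map_cons, ← Multiset.cons_coe, pathsCloseness_cons, slotSum_cons, listClose_cons,
      listWeight_cons, listOuter_cons, h1, h2, h3, hu.close, hu.weight, hu.outerCount,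
      pathsCloseness_singleton, List.length_cons]
    exact ⟨by ring, rfl, by ring⟩

/-! ### Graphs with a bridge -/

theorem exists_max_mem {S : Multiset ℕ} (hS : 0 < S.card) :
    ∃ i T, S = i ::ₘ T ∧ S.sum ≤ S.card * i := by
  obtain ⟨z, hz⟩ := Multiset.card_pos_iff_exists_mem.mp hS
  obtain ⟨i, hi, hmax⟩ := Finset.exists_max_image S.toFinset id ⟨z, by simpa using hz⟩
  obtain ⟨T, hT⟩ := Multiset.exists_cons_of_mem (by simpa using hi : i ∈ S)
  refine ⟨i, T, hT, ?_⟩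
  have := Multiset.sum_le_card_nsmul S i fun x hx => hmax x (by simpa using hx)
  simpa using this

/-- If a bridge is deleted such that neither side is a path, then the longest of the paths that
replace each side are together long enough for dropping them. -/
theorem bridge_lt_cutValue {U W : Multiset ℕ} {m k : ℕ} (hU : 2 ≤ U.card) (hW : 3 ≤ W.card)
    (hm : U.card + W.card = m + 1) (hk : U.sum + W.sum + 2 = k) :
    pathsCloseness U + slotSum U + pathsCloseness W <
      cutValue (m + k) m k ((k + m - 1) / m) := by
  obtain ⟨i, U, rfl, hi⟩ := exists_max_mem (by omega : 0 < U.card)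
  obtain ⟨j, W, rfl, hj⟩ := exists_max_mem (by omega : 0 < W.card)
  simp only [Multiset.card_cons, Multiset.sum_cons] at hU hW hm hk hi hj
  set a := (k + m - 1) / m
  have ha : a ≤ i + j + 2 := by
    have h1 : (U.card + 1) * i ≤ (m - 1) * i := Nat.mul_le_mul_right _ (by omega)
    have h2 : (W.card + 1) * j ≤ (m - 1) * j := Nat.mul_le_mul_right _ (by omega)
    have h3 : (m - 1) * i + (m - 1) * j + (i + j) = m * (i + j) := by
      obtain ⟨m', rfl⟩ : ∃ m', m = m' + 1 := ⟨m - 1, by omega⟩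
      simp; ring
    have h4 : m * (i + j + 3) = m * (i + j) + 3 * m := by ring
    have : a < i + j + 3 := Nat.div_lt_of_lt_mul (by omega)
    omega
  have hsc : slotScore (U + W) ≤ slotScore (balanced (m - 1) (k - a)) :=
    slotScore_le_balanced (by omega) _ (by rw [Multiset.card_add]; omega)
      (by rw [Multiset.sum_add]; omega)
  have hp : 1 ≤ slotSum U :=
    le_trans (by exact_mod_cast (by omega : 1 ≤ U.card)) (card_le_slotSum U)
  have hs : 2 ≤ slotSum W :=
    le_trans (by exact_mod_cast (by omega : 2 ≤ W.card)) (card_le_slotSum W)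
  have hpow : (2 - slot i) * (2 - slot j) ≤ 4 * (1 / 2) ^ a := by
    have h1 := half_pow_le_half_pow ha
    have h2 : (2 - slot i) * (2 - slot j) = 4 * (1 / 2) ^ (i + j + 2) := by
      unfold slot; rw [pow_add, pow_add]; ring
    rw [h2]; linarith
  have hpos : 0 < (slotSum U + 1 - slot j) * (slotSum W - slot i) := by
    have := slot_lt_two i
    have := slot_lt_two j
    apply mul_pos <;> linarith
  have hcU : ((U.card : ℝ) + 1) + (W.card + 1) = m + 1 := by exact_mod_cast hm
  have hsU : ((i : ℝ) + U.sum) + (j + W.sum) + 2 = k := by exact_mod_cast hk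
  unfold cutValue
  simp only [slotScore, slotPairs_add, slotSum_add] at hsc ⊢
  simp only [pathsCloseness, Multiset.sum_cons, Multiset.card_cons, slotSum_cons, slotPairs_cons,
    Nat.cast_add, Nat.cast_one]
  nlinarith

theorem mem_balanced_le {M s a x : ℕ} (hx : x ∈ balanced M s) (h : s ≤ M * a) :
    x ≤ a := by
  rw [balanced, Multiset.mem_add] at hx
  have h2 := Nat.div_add_mod s M
  rcases hx with hx | hx
  · have h0 : 0 < s % M := by
      by_contra h0
      simp [Nat.eq_zero_of_not_pos h0] at hx
    rw [Multiset.eq_of_mem_replicate hx]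
    refine Nat.succ_le_of_lt (lt_of_mul_lt_mul_left (a := M) ?_ (Nat.zero_le _))
    omega
  · rw [Multiset.eq_of_mem_replicate hx]
    exact Nat.div_le_of_le_mul h

theorem le_of_mem_balanced {M s c x : ℕ} (hM : 0 < M) (hx : x ∈ balanced M s)
    (h : M * c ≤ s) : c ≤ x := by
  have h1 : c ≤ s / M := (Nat.le_div_iff_mul_le hM).mpr (by rwa [mul_comm])
  rw [balanced, Multiset.mem_add] at hx
  rcases hx with hx | hx
  · rw [Multiset.eq_of_mem_replicate hx]; omega
  · rw [Multiset.eq_of_mem_replicate hx]; exact h1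

theorem cons_balanced {m k a : ℕ} (hm : 2 ≤ m) (h1 : k ≤ m * a) (h2 : m * (a - 1) < k)
    (ha : 1 ≤ a) : a ::ₘ balanced (m - 1) (k - a) = balanced m k := by
  obtain ⟨M, rfl⟩ : ∃ M, m = M + 1 := ⟨m - 1, by omega⟩
  obtain ⟨c, rfl⟩ : ∃ c, a = c + 1 := ⟨a - 1, by omega⟩
  simp only [Nat.add_sub_cancel] at h2 ⊢
  have e1 : (M + 1) * (c + 1) = M * (c + 1) + (c + 1) := by ring
  have e2 : (M + 1) * c = M * c + c := by ring
  have hbd : ∀ x ∈ (c + 1) ::ₘ balanced M (k - (c + 1)), c ≤ x ∧ x ≤ c + 1 := by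
    intro x hx
    rcases Multiset.mem_cons.mp hx with rfl | hx
    · omega
    · exact ⟨le_of_mem_balanced (by omega) hx (by omega),
        mem_balanced_le hx (by omega)⟩
  have := eq_balanced (V := (c + 1) ::ₘ balanced M (k - (c + 1))) (by simp)
    fun x hx y hy => by have := hbd x hx; have := hbd y hy; omega
  rw [Multiset.card_cons, Multiset.sum_cons, card_balanced (by omega),
    sum_balanced (by omega), show c + 1 + (k - (c + 1)) = k by omega] at this
  exact this

variable [Fintype V] {Γ : SimpleGraph V} {m k : ℕ}

theorem IsRep.lt_cutValue_of_bridge {t₁ t₂ : BTree V} (h : IsRep Γ k [t₁, t₂])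
    (hn : Fintype.card V = m + k) (h₁ : ¬ t₁.IsPath) (h₂ : ¬ t₂.IsPath) :
    linkResidualCloseness Γ < cutValue (m + k) m k ((k + m - 1) / m) := by
  classical
  induction hN : t₁.verts.length using Nat.strong_induction_on generalizing t₁ t₂ with
  | _ N ih =>
    by_cases hg : t₁.Good
    · have q1 := h.proper t₁ (by simp)
      have q2 := h.proper t₂ (by simp)
      have c1 := two_le_outerCount q1 h₁
      have c2 := two_le_outerCount q2 h₂
      have e1 := h.outer_add
      have e2 := h.inner_eq
      simp only [listOuter_cons, listOuter_nil, listInner_cons, listInner_nil] at e1 e2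
      obtain ⟨U, g, ⟨u1, u2, u3, u4⟩, -⟩ := hg.exists_starBound q1 le_rfl
      rcases t₁.eq_leaf_or_block with ⟨v, rfl⟩ | ⟨r, us, rfl⟩
      · exact absurd (.leaf v) h₁
      rcases t₂.eq_leaf_or_block with ⟨v, rfl⟩ | ⟨r', us', rfl⟩
      · exact absurd (.leaf v) h₂
      obtain ⟨W, w1, w2, w3⟩ := close_le_pathsCloseness q2
      rw [outerRootCount_block, ← outerCount_block] at u1
      rw [innerRootCount_block, ← innerCount_block] at u2
      refine lt_of_le_of_lt ?_ (bridge_lt_cutValue (U := U) (W := W) (by omega) (by omega)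
        (by omega) (by omega))
      have := h.residual_le_pair
      linarith
    · have : ∃ r w, RootBlock t₁ r w ∧ ¬ (2 ≤ w.length ∨ ∀ u ∈ w, u.IsPath) := by
        by_contra! hc
        exact hg (good_of_rootBlock fun r w hw => by have := hc r w hw; tauto)
      obtain ⟨r, w, hw, hbad⟩ := this
      push Not at hbad
      obtain ⟨hlen, u, hu, hup⟩ := hbad
      have hrep := h.descend (by simp) hw hu
      have hnil : w.erase u = [] := by
        have := List.length_erase_of_mem hu
        exact List.length_eq_zero_iff.mp (by omega)
      rw [hnil] at hrep
      refine ih _ (hN ▸ hw.length_lt hu) hrep hup (fun hp => ?_) rfl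
      cases hp with
      | cons v hp => exact h₂ hp

/-- No bridge separates two parts of the graph neither of which is a path attached at its end. -/
def OnlyPendantBridges (Γ : SimpleGraph V) (k : ℕ) : Prop :=
  ∀ t₁ t₂ : BTree V, IsRep Γ k [t₁, t₂] → t₁.IsPath ∨ t₂.IsPath

/-- The graph consists of a clique with balanced pendant paths. -/
def IsBalancedPaths (Γ : SimpleGraph V) (m k : ℕ) : Prop :=
  ∃ L : List (BTree V), IsRep Γ k L ∧ (∀ u ∈ L, u.IsPath) ∧
    (L.map innerCount : Multiset ℕ) = balanced m k

theorem IsRep.exists_longest {t₁ t₂ : BTree V} (h : IsRep Γ k [t₁, t₂]) (h₁ : t₁.IsPath)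
    (hn : Fintype.card V = m + k) (hm : 3 ≤ m) :
    ∃ t₁' r us, IsRep Γ k [t₁', block r us] ∧ t₁'.IsPath ∧ t₁.innerCount ≤ t₁'.innerCount ∧
      (r.isLeaf = false ∨ 2 ≤ us.length) := by
  induction t₂ using ind generalizing t₁ with
  | leaf v =>
    have := h.outer_add
    simp [h₁.outerCount] at this
    omega
  | block r us _ hus =>
    by_cases hb : r.isLeaf = false ∨ 2 ≤ us.length
    · exact ⟨t₁, r, us, h, h₁, le_rfl, hb⟩
    · push Not at hb
      obtain ⟨v, rfl⟩ : ∃ v, r = leaf v := by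
        rcases r.eq_leaf_or_block with h | ⟨r', us', rfl⟩
        · exact h
        · simp [isLeaf] at hb
      have hne : us ≠ [] := by
        cases h.proper (block (leaf v) us) (by simp) with
        | block _ h2 _ => exact h2
      obtain ⟨u, us, rfl⟩ := List.exists_cons_of_ne_nil hne
      obtain rfl : us = [] := by
        have := hb.2
        simp only [List.length_cons] at this
        exact List.length_eq_zero_iff.mp (by omega)
      have h' : IsRep Γ k [block (leaf v) [t₁], u] := h.swap.move_block (by simp)
      obtain ⟨t₁', r, us, a, b, c, d⟩ := hus u (by simp) h' (.cons v h₁)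
      refine ⟨t₁', r, us, a, b, le_trans ?_ c, d⟩
      simp

theorem le_mul_ceil {m k : ℕ} (hm : 0 < m) : k ≤ m * ((k + m - 1) / m) := by
  have h1 := Nat.div_add_mod (k + m - 1) m
  have h2 := Nat.mod_lt (k + m - 1) hm
  omega

theorem mul_ceil_sub_one_lt {m k : ℕ} (hm : 0 < m) (hk : 0 < k) :
    m * ((k + m - 1) / m - 1) < k := by
  have h1 := Nat.mul_div_le (k + m - 1) m
  have h2 : 1 ≤ (k + m - 1) / m := (Nat.one_le_div_iff hm).mpr (by omega)
  have h3 : m * ((k + m - 1) / m - 1) + m = m * ((k + m - 1) / m) := by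
    rw [Nat.mul_sub, mul_one]
    have : m * 1 ≤ m * ((k + m - 1) / m) := Nat.mul_le_mul_left _ h2
    omega
  omega

/-- If there is a long pendant path, it is best to cut it off. -/
theorem IsRep.le_cutValue_of_pendant {t₁ t₂ : BTree V} (h : IsRep Γ k [t₁, t₂])
    (hn : Fintype.card V = m + k) (hm : 3 ≤ m) (hk : 0 < k) (hB : OnlyPendantBridges Γ k)
    (h₁ : t₁.IsPath) (hlong : (k + m - 1) / m ≤ t₁.innerCount + 1) :
    linkResidualCloseness Γ < cutValue (m + k) m k ((k + m - 1) / m) ∨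
      linkResidualCloseness Γ ≤ cutValue (m + k) m k ((k + m - 1) / m) ∧
        IsBalancedPaths Γ m k := by
  classical
  obtain ⟨t₁, r, us, h, h₁, hle, hb⟩ := h.exists_longest h₁ hn hm
  replace hlong : (k + m - 1) / m ≤ t₁.innerCount + 1 := by omega
  clear hle
  set a := (k + m - 1) / m with ha
  have ha1 : 1 ≤ a := (Nat.one_le_div_iff (by omega)).mpr (by omega)
  have q2 := h.proper (block r us) (by simp)
  have hg : (block r us).Good := by
    refine good_of_rootBlock fun r' w hw => ?_
    by_contra! hc
    obtain ⟨hlen, u, hu, hup⟩ := hc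
    have hrep := h.swap.descend (by simp) hw hu
    have hnil : w.erase u = [] := by
      have := List.length_erase_of_mem hu
      exact List.length_eq_zero_iff.mp (by omega)
    rw [hnil] at hrep
    rcases hB _ _ hrep with hp | hp
    · exact hup hp
    · cases hp with
      | cons v hp =>
        cases hw with
        | here =>
          rcases hb with hb | hb
          · simp [isLeaf] at hb
          · omega
  have e1 := h.outer_add
  have e2 := h.inner_eq
  simp only [listOuter_cons, listOuter_nil, listInner_cons, listInner_nil, h₁.outerCount] at e1 e2
  have hres := h.residual_le_pair
  rw [h₁.close, pathsCloseness_singleton] at hres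
  have hpow : 2 * ((t₁.innerCount : ℝ) + 1) - 2 * slot t₁.innerCount =
      2 * (t₁.innerCount + 1) - 4 + 4 * (1 / 2) ^ (t₁.innerCount + 1) := by
    unfold slot; rw [pow_succ]; ring
  rw [hpow] at hres
  set b := t₁.innerCount + 1 with hb'
  have hbR : (t₁.innerCount : ℝ) + 1 = b := by rw [hb']; push_cast; rfl
  -- the value for a multiset of path lengths on the other side
  have hval : ∀ S : Multiset ℕ, S.card = m - 1 → S.sum + 1 = (block r us).innerCount →
      2 * (b : ℝ) - 4 + 4 * (1 / 2) ^ b + (pathsCloseness S + slotSum S) =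
        2 * ((m + k : ℕ) : ℝ) - 6 + 4 * (1 / 2) ^ b + slotScore S := by
    intro S h1 h2
    have : ((b : ℝ) + S.sum) + (S.card + 1) = ((m + k : ℕ) : ℝ) := by
      exact_mod_cast (by omega : b + S.sum + (S.card + 1) = m + k)
    simp only [pathsCloseness, slotScore]
    linarith
  rw [hbR] at hres
  obtain ⟨S, g, ⟨u1, u2, u3, u4⟩, u5, -⟩ := hg.exists_starBound q2 le_rfl
  rw [outerRootCount_block, ← outerCount_block] at u1
  rw [innerRootCount_block, ← innerCount_block] at u2
  have hSc : slotScore S ≤ slotScore (balanced (m - 1) (k - b)) :=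
    slotScore_le_balanced (by omega) S (by omega) (by omega)
  have hv := hval S (by omega) u2
  have hcut : linkResidualCloseness Γ + g ≤ cutValue (m + k) m k b := by
    unfold cutValue; linarith
  by_cases hab : a < b
  · left
    exact lt_of_le_of_lt (by linarith) (cutValue_lt hm hab)
  clear_value a b
  obtain rfl : b = a := by omega
  by_cases hstar : (block r us).IsStar
  · obtain ⟨s1, s2⟩ := hstar r us rfl
    obtain ⟨v, rfl⟩ : ∃ v, r = leaf v := by
      rcases r.eq_leaf_or_block with h | ⟨r', us', rfl⟩
      · exact h
      · simp [isLeaf] at s1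
    obtain ⟨p1, p2, p3⟩ := listClose_of_paths s2
    set S₀ : Multiset ℕ := (us.map innerCount : Multiset ℕ) with hS₀
    have c0 : S₀.card = m - 1 := by
      rw [hS₀, Multiset.coe_card, List.length_map, ← p3]
      simp at e1; omega
    have s0 : S₀.sum + 1 = (block (leaf v) us).innerCount := by
      rw [hS₀, Multiset.sum_coe]; simp [listInner]; ring
    have hclose : (block (leaf v) us).close = pathsCloseness S₀ + slotSum S₀ := by
      rw [close_block, listClose_cons, p1, p2]; simp
    have hv0 := hval S₀ c0 s0
    have hsum : S₀.sum = k - b := by omega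
    have hbal := slotScore_le_balanced_of_sum_eq S₀
    rw [c0, hsum] at hbal
    by_cases heq : S₀ = balanced (m - 1) (k - b)
    · right
      refine ⟨by linarith, block (leaf v) [t₁] :: us, h.swap.move_block (by simp), ?_, ?_⟩
      · intro u hu
        rcases List.mem_cons.mp hu with rfl | hu
        · exact .cons v h₁
        · exact s2 u hu
      · rw [List.map_cons, ← Multiset.cons_coe, ← hS₀, heq]
        have : (block (leaf v) [t₁]).innerCount = b := by simp; omega
        rw [this, cons_balanced (by omega) (ha ▸ le_mul_ceil (by omega))
          (ha ▸ mul_ceil_sub_one_lt (by omega) hk) ha1]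
    · left
      have hlt := lt_of_le_of_ne hbal.1 fun e => heq (hbal.2 e)
      have : cutValue (m + k) m k b = 2 * ((m + k : ℕ) : ℝ) - 6 + 4 * (1 / 2) ^ b +
        slotScore (balanced (m - 1) (k - b)) := rfl
      linarith
  · left
    have := u5 hstar
    linarith

end CutVertexCloseness

namespace CutVertexCloseness

open BTree

/-! ### Graphs without long pendant paths -/

variable {V : Type*} {Γ : SimpleGraph V} {m k : ℕ} {L : List (BTree V)}

/-- Every path attached by a bridge at its end has fewer than `q` inner vertices. -/
def NoLongPendants (Γ : SimpleGraph V) (k q : ℕ) : Prop :=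
  ∀ t₁ t₂ : BTree V, IsRep Γ k [t₁, t₂] → t₁.IsPath → t₁.innerCount + 1 ≤ q

theorem eq_leaf_of_isLeaf {t : BTree V} (h : t.isLeaf = true) : ∃ v, t = leaf v := by
  rcases t.eq_leaf_or_block with h' | ⟨r, us, rfl⟩
  · exact h'
  · simp [isLeaf] at h

theorem not_isPath_block {r : BTree V} (h : 2 ≤ L.length) : ¬ (block r L).IsPath := by
  intro hp
  cases hp
  simp at h

namespace IsRep

theorem ne_nil_of_rootBlock {t r : BTree V} {w : List (BTree V)} (h : IsRep Γ k (t :: L))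
    (hw : RootBlock t r w) : 0 < w.length :=
  List.length_pos_iff.mpr (hw.proper (h.proper t (by simp))).2.1

/-- In a block with at least three vertices, the bridges at a branch lead to paths. -/
theorem isPath_of_rootBlock {t r : BTree V} {w : List (BTree V)} (h : IsRep Γ k (t :: L))
    (hL : 2 ≤ L.length) (hB : OnlyPendantBridges Γ k) (hw : RootBlock t r w) (h1 : ¬ 2 ≤ w.length) :
    ∀ u ∈ w, u.IsPath ∧ IsRep Γ k [u, block r L] := by
  classical
  intro u hu
  have hrep := h.descend (List.ne_nil_of_length_pos (by omega)) hw hu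
  have hnil : w.erase u = [] := by
    have := List.length_erase_of_mem hu
    exact List.length_eq_zero_iff.mp (by omega)
  rw [hnil] at hrep
  exact ⟨(hB _ _ hrep).resolve_right (not_isPath_block hL), hrep⟩

theorem innerCount_le_of_isPath {q : ℕ} {t : BTree V} (h : IsRep Γ k (t :: L))
    (hL : L ≠ []) (hA : NoLongPendants Γ k q) (ht : t.IsPath) : t.innerCount ≤ q := by
  cases ht with
  | leaf v => simp
  | cons v hu =>
    have := hA _ _ (h.move_block hL).swap hu
    simp
    omega

theorem good {t : BTree V} (h : IsRep Γ k (t :: L)) (hL : 2 ≤ L.length)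
    (hB : OnlyPendantBridges Γ k) : t.Good :=
  good_of_rootBlock fun r w hw => by
    by_cases h2 : 2 ≤ w.length
    · exact Or.inl h2
    · exact Or.inr fun u hu => (h.isPath_of_rootBlock hL hB hw h2 u hu).1

/-- If all paths at blocks with at least three vertices are short, every branch at such a block has
few cut vertices. -/
theorem innerCount_lt_of_forall {q : ℕ} {t : BTree V} (h : IsRep Γ k (t :: L))
    (hL : 2 ≤ L.length) (hB : OnlyPendantBridges Γ k) (hA : NoLongPendants Γ k q)
    (hP : ∀ (t : BTree V) (L : List (BTree V)), IsRep Γ k (t :: L) → 2 ≤ L.length → t.IsPath →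
      t.innerCount + 1 ≤ q) : t.innerCount + 1 ≤ q * t.outerCount := by
  classical
  induction hN : t.verts.length using Nat.strong_induction_on generalizing t L with
  | _ N ih =>
    by_cases ht : t.IsPath
    · rw [ht.outerCount, mul_one]
      exact hP _ _ h hL ht
    have key : t.innerRootCount + t.rootDegree ≤ 1 + q * t.outerRootCount := by
      refine innerRootCount_add_rootDegree_le fun r w hw u hu => ?_
      by_cases h2 : 2 ≤ w.length
      · refine ih _ (hN ▸ hw.length_lt hu)
          (h.descend (List.ne_nil_of_length_pos (by omega)) hw hu) ?_ rfl
        rw [List.length_cons, List.length_erase_of_mem hu]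
        omega
      · obtain ⟨h3, h4⟩ := h.isPath_of_rootBlock hL hB hw h2 u hu
        rw [h3.outerCount, mul_one]
        exact hA _ _ h4 h3
    rcases t.eq_leaf_or_block with ⟨v, rfl⟩ | ⟨r, us, rfl⟩
    · exact absurd (.leaf v) ht
    have hd : 2 ≤ (block r us).rootDegree := by
      refine two_le_rootDegree (h.proper _ (by simp)) ?_
      by_contra! hc
      obtain ⟨v, rfl⟩ := eq_leaf_of_isLeaf (by simpa using hc.1)
      have hus := h.isPath_of_rootBlock hL hB (.here _ us) (by omega)
      obtain ⟨u, us, rfl⟩ := List.exists_cons_of_ne_nil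
        (List.ne_nil_of_length_pos (h.ne_nil_of_rootBlock (.here _ us)))
      obtain rfl : us = [] := by
        have := hc.2
        simp only [List.length_cons] at this
        exact List.length_eq_zero_iff.mp (by omega)
      exact ht (.cons v (hus u (by simp)).1)
    rw [outerRootCount_block, ← outerCount_block, innerRootCount_block, ← innerCount_block] at key
    omega

variable [Fintype V]

/-- If no block had three vertices, the graph would be a tree with paths too short for `k` cut
vertices. -/
theorem exists_three_le {q : ℕ} (h : IsRep Γ k L) (hL : 2 ≤ L.length)
    (hn : Fintype.card V = m + k) (hm : 3 ≤ m) (hk : m * q < k)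
    (hB : OnlyPendantBridges Γ k) (hA : NoLongPendants Γ k q) :
    ∃ L', IsRep Γ k L' ∧ 3 ≤ L'.length := by
  classical
  by_cases h3 : 3 ≤ L.length
  · exact ⟨L, h, h3⟩
  obtain ⟨t₁, t₂, rfl⟩ : ∃ t₁ t₂, L = [t₁, t₂] := by
    match L, hL, h3 with
    | [t₁, t₂], _, _ => exact ⟨t₁, t₂, rfl⟩
    | _ :: _ :: _ :: _, _, h3 => simp at h3
  obtain ⟨t₁, t₂, h, h₁⟩ : ∃ t₁ t₂, IsRep Γ k [t₁, t₂] ∧ t₁.IsPath := by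
    rcases hB _ _ h with h' | h'
    · exact ⟨_, _, h, h'⟩
    · exact ⟨_, _, h.swap, h'⟩
  obtain ⟨t₁, r, us, h, h₁, -, hb⟩ := h.exists_longest h₁ hn hm
  by_cases hw : ∃ r' w, RootBlock (block r us) r' w ∧ 2 ≤ w.length
  · obtain ⟨r', w, hw, h2⟩ := hw
    exact ⟨_, h.swap.move (by simp) hw, by simpa using h2⟩
  push Not at hw
  exfalso
  have hd := two_le_rootDegree (h.proper _ (by simp)) hb
  have key : (block r us).innerRootCount + (block r us).rootDegree ≤
      1 + q * (block r us).outerRootCount := by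
    refine innerRootCount_add_rootDegree_le fun r' w hw' u hu => ?_
    have h2 := hw r' w hw'
    have hrep := h.swap.descend (by simp) hw' hu
    have hnil : w.erase u = [] := by
      have := List.length_erase_of_mem hu
      exact List.length_eq_zero_iff.mp (by omega)
    rw [hnil] at hrep
    have hup : u.IsPath := by
      refine (hB _ _ hrep).resolve_right fun hp => ?_
      cases hp with
      | cons v _ =>
        cases hw' with
        | here =>
          rcases hb with hb | hb
          · simp [isLeaf] at hb
          · omega
    rw [hup.outerCount, mul_one]
    exact hA _ _ hrep hup
  have h4 := hA _ _ h h₁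
  have e1 := h.outer_add
  have e2 := h.inner_eq
  rw [outerRootCount_block, ← outerCount_block, innerRootCount_block, ← innerCount_block] at key
  simp only [listOuter_cons, listOuter_nil, listInner_cons, listInner_nil, h₁.outerCount] at e1 e2
  have : m * q = q * (block r us).outerCount + q := by
    rw [show m = (block r us).outerCount + 1 by omega]; ring
  omega

/-- If every path were short, there would be too few cut vertices. -/
theorem exists_long_path {q : ℕ} (h : IsRep Γ k L) (hL : 2 ≤ L.length)
    (hn : Fintype.card V = m + k) (hm : 3 ≤ m) (hk : m * q < k)
    (hB : OnlyPendantBridges Γ k) (hA : NoLongPendants Γ k q) :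
    ∃ t us, IsRep Γ k (t :: us) ∧ 2 ≤ us.length ∧ t.IsPath ∧ t.innerCount = q := by
  classical
  by_contra! hc
  obtain ⟨L, h, hL⟩ := h.exists_three_le hL hn hm hk hB hA
  have hle : ∀ u ∈ L, u.innerCount + 1 ≤ q * u.outerCount := by
    intro u hu
    have h' := h.perm (List.perm_cons_erase hu)
    have hl := List.length_erase_of_mem hu
    refine h'.innerCount_lt_of_forall (by omega) hB hA fun t us h hus ht => ?_
    have h1 := hc t us h hus ht
    have h2 := h.innerCount_le_of_isPath (List.ne_nil_of_length_pos (by omega)) hA ht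
    omega
  have h1 := listInner_add_length_le hle
  have h2 := h.outer_add
  have h3 := h.inner_eq
  rw [show listOuter L = m by omega, mul_comm] at h1
  omega

/-- The bound obtained by cutting off a path at the clique. -/
theorem residual_le_cut {q : ℕ} {t u : BTree V} {us : List (BTree V)}
    (h : IsRep Γ k (t :: u :: us)) (ht : t.IsPath) (hq : t.innerCount = q + 1) :
    linkResidualCloseness Γ ≤ 2 * (q + 1) - 4 + 4 * (1 / 2) ^ (q + 1) + u.close + listClose us +
      u.weight * (1 + listWeight us) + listWeight us := by
  cases ht with
  | leaf v => simp at hq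
  | @cons v t ht =>
    have h' := (h.move_block (by simp)).residual_le_pair
    have hq' : t.innerCount = q := by
      simp at hq; omega
    rw [ht.close, pathsCloseness_singleton, hq'] at h'
    have : 2 * ((q : ℝ) + 1) - 2 * slot q = 2 * (q + 1) - 4 + 4 * (1 / 2) ^ (q + 1) := by
      unfold slot; rw [pow_succ]; ring
    rw [this] at h'
    simp only [close_block, listClose_cons, listWeight_cons, close_leaf, weight_leaf] at h'
    linarith

end IsRep

theorem cut_eq {q : ℕ} {A B : Multiset ℕ} (hm : 1 + A.card + B.card = m)
    (hk : q + 1 + A.sum + B.sum = k) :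
    2 * (q : ℝ) - 4 + 4 * (1 / 2) ^ q + (pathsCloseness A + slotSum A) +
        (pathsCloseness B + slotSum B + (1 + slotSum A) * (1 + slotSum B / 2)) +
      ((slotSum A - 1) * (slotSum B - 2) / 2 - 2 * (1 / 2) ^ q) =
    2 * ((m + k : ℕ) : ℝ) - 6 + 4 * (1 / 2) ^ (q + 1) + slotScore (A + B) := by
  have h1 : ((m + k : ℕ) : ℝ) = 2 + A.card + B.card + q + A.sum + B.sum := by
    rw [← hm, ← hk]; simp only [Nat.cast_add, Nat.cast_one]; ring
  rw [h1]
  simp only [pathsCloseness, slotScore, slotSum_add, slotPairs_add, pow_succ]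
  ring

/-- If a path with `q` vertices is cut off, and the paths `A` replace the other branches but one,
and the paths `B` replace this one, then the resulting bound for the closeness falls short of the
value for the balanced paths by at least the last summand, and by more if `A + B` is not
balanced. -/
theorem cut_le {q : ℕ} {A B : Multiset ℕ} (hm : 1 + A.card + B.card = m) (hm3 : 3 ≤ m)
    (hk : q + 1 + A.sum + B.sum = k) :
    2 * (q : ℝ) - 4 + 4 * (1 / 2) ^ q + (pathsCloseness A + slotSum A) +
        (pathsCloseness B + slotSum B + (1 + slotSum A) * (1 + slotSum B / 2)) +
      ((slotSum A - 1) * (slotSum B - 2) / 2 - 2 * (1 / 2) ^ q) ≤ cutValue (m + k) m k (q + 1) ∧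
    ∀ x ∈ A + B, ∀ y ∈ A + B, y + 1 < x →
    2 * (q : ℝ) - 4 + 4 * (1 / 2) ^ q + (pathsCloseness A + slotSum A) +
        (pathsCloseness B + slotSum B + (1 + slotSum A) * (1 + slotSum B / 2)) +
      ((slotSum A - 1) * (slotSum B - 2) / 2 - 2 * (1 / 2) ^ q) <
        cutValue (m + k) m k (q + 1) := by
  rw [cut_eq hm hk, cutValue]
  constructor
  · have : slotScore (A + B) ≤ slotScore (balanced (m - 1) (k - (q + 1))) :=
      slotScore_le_balanced (by omega) _ (by rw [Multiset.card_add]; omega)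
        (by rw [Multiset.sum_add]; omega)
    linarith
  · intro x hx y hy hxy
    have : slotScore (A + B) < slotScore (balanced (m - 1) (k - (q + 1))) :=
      slotScore_lt_balanced_of_unbalanced (by omega) _ (by rw [Multiset.card_add]; omega)
        (by rw [Multiset.sum_add]; omega) hx hy hxy
    linarith

/-- The graph consists of two cliques with a common vertex, with `s` and `t` further vertices, and
of a pendant edge at each of these. -/
def IsTwoCliques (Γ : SimpleGraph V) (k s t : ℕ) : Prop :=
  ∃ (c : V) (w us : List (BTree V)), IsRep Γ k (block (leaf c) w :: us) ∧ w.length = s ∧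
    us.length = t ∧ ∀ u ∈ w ++ us, u.IsPath ∧ u.innerCount = 1

theorem map_innerCount_eq_replicate {L : List (BTree V)} {j : ℕ} (h : ∀ u ∈ L, u.innerCount = j) :
    (L.map innerCount : Multiset ℕ) = Multiset.replicate L.length j := by
  rw [Multiset.eq_replicate]
  refine ⟨by simp, fun x hx => ?_⟩
  obtain ⟨u, hu, rfl⟩ := List.mem_map.mp (by simpa using hx)
  exact h u hu

theorem listInner_of_forall {L : List (BTree V)} {j : ℕ} (h : ∀ u ∈ L, u.innerCount = j) :
    listInner L = L.length * j := by
  have := congrArg Multiset.sum (map_innerCount_eq_replicate h)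
  simpa [listInner] using this

variable [Fintype V]

/-- Two cliques with a common vertex and with paths of equal length at all other vertices. -/
theorem IsRep.residual_le_of_two_cliques {q : ℕ} {c : V} {w us : List (BTree V)}
    (h : IsRep Γ k (block (leaf c) w :: us)) (hn : Fintype.card V = m + k) (hw : 2 ≤ w.length)
    (hus : 2 ≤ us.length)
    (hp : ∀ u ∈ w ++ us, u.IsPath ∧ u.innerCount = q + 1) :
    linkResidualCloseness Γ + ((((us.length : ℝ) - 1) * slot (q + 1) - 1) *
      (w.length * slot (q + 1) - 2) / 2 - 2 * (1 / 2) ^ (q + 1)) ≤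
        cutValue (m + k) m k (q + 1 + 1) ∧ m = w.length + us.length ∧ k = m * (q + 1) + 1 := by
  obtain ⟨t, us, rfl⟩ := List.exists_cons_of_ne_nil
    (List.ne_nil_of_length_pos (by omega : 0 < us.length))
  have ht := hp t (by simp)
  have hus' : ∀ u ∈ us, u.IsPath ∧ u.innerCount = q + 1 := fun u hu => hp u (by simp [hu])
  have hw' : ∀ u ∈ w, u.IsPath ∧ u.innerCount = q + 1 := fun u hu => hp u (by simp [hu])
  obtain ⟨a1, a2, a3⟩ := listClose_of_paths fun u hu => (hus' u hu).1
  obtain ⟨b1, b2, b3⟩ := listClose_of_paths fun u hu => (hw' u hu).1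
  have a4 := map_innerCount_eq_replicate fun u hu => (hus' u hu).2
  have b4 := map_innerCount_eq_replicate fun u hu => (hw' u hu).2
  have a5 := listInner_of_forall fun u hu => (hus' u hu).2
  have b5 := listInner_of_forall fun u hu => (hw' u hu).2
  rw [a4] at a1 a2
  rw [b4] at b1 b2
  have e1 := h.outer_add
  have e2 := h.inner_eq
  have hres := h.swap.residual_le_cut ht.1 ht.2
  simp only [listOuter_cons, listInner_cons, ht.1.outerCount, ht.2, outerCount_block,
    outerRootCount_leaf, innerCount_block, innerRootCount_leaf, a3, b3, a5, b5] at e1 e2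
  rw [List.length_cons] at hus ⊢
  have hm : m = w.length + (us.length + 1) := by omega
  have hk : k = m * (q + 1) + 1 := by rw [← e2, hm]; ring
  have hcut := (cut_le (q := q + 1) (A := Multiset.replicate us.length (q + 1))
    (B := Multiset.replicate w.length (q + 1)) (m := m) (k := k)
    (by simp; omega) (by omega) (by simp; omega)).1
  refine ⟨?_, hm, hk⟩
  simp only [close_block, listClose_cons, close_leaf, weight_leaf, weight_block, a1, a2, b1, b2]
    at hres
  rw [slotSum_replicate, slotSum_replicate] at hcut hres
  push_cast at hcut ⊢
  linarith

/-- Only for paths of length one and small cliques the edge deleted is not better than the one in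
the balanced graph. -/
theorem IsRep.le_cutValue_of_two_cliques {q : ℕ} {c : V} {w us : List (BTree V)}
    (h : IsRep Γ k (block (leaf c) w :: us)) (hn : Fintype.card V = m + k) (hw : 2 ≤ w.length)
    (hus : w.length ≤ us.length)
    (hp : ∀ u ∈ w ++ us, u.IsPath ∧ u.innerCount = q + 1) :
    linkResidualCloseness Γ < cutValue (m + k) m k (q + 1 + 1) ∨
      IsTwoCliques Γ k 2 2 ∨
      linkResidualCloseness Γ ≤ cutValue (m + k) m k (q + 1 + 1) ∧ IsTwoCliques Γ k 2 3 := by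
  obtain ⟨hres, hm, hk⟩ := h.residual_le_of_two_cliques hn hw (hw.trans hus) hp
  have hwR : (2 : ℝ) ≤ w.length := by exact_mod_cast hw
  have husR : (w.length : ℝ) ≤ us.length := by exact_mod_cast hus
  obtain _ | q := q
  · rw [zero_add, slot_one] at hres
    by_cases h3 : 3 ≤ w.length
    · left
      have h3R : (3 : ℝ) ≤ w.length := by exact_mod_cast h3
      nlinarith
    have hw2 : w.length = 2 := by omega
    by_cases h2 : us.length = 2
    · exact Or.inr (Or.inl ⟨c, w, us, h, hw2, h2, hp⟩)
    by_cases h3 : us.length = 3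
    · refine Or.inr (Or.inr ⟨?_, c, w, us, h, hw2, h3, hp⟩)
      rw [hw2, h3] at hres
      norm_num at hres ⊢
      linarith
    · left
      have h4R : (4 : ℝ) ≤ us.length := by exact_mod_cast (by omega : 4 ≤ us.length)
      rw [hw2] at hres
      norm_num at hres ⊢
      linarith
  · left
    have h1 := slot_mono (by omega : 2 ≤ q + 1 + 1)
    rw [slot_two] at h1
    have h2 := half_pow_le_half_pow (by omega : 2 ≤ q + 1 + 1)
    have h3 : (3 : ℝ) / 4 ≤ ((us.length : ℝ) - 1) * slot (q + 1 + 1) - 1 := by nlinarith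
    have h4 : (3 : ℝ) / 2 ≤ (w.length : ℝ) * slot (q + 1 + 1) - 2 := by nlinarith
    have h5 := mul_le_mul h3 h4 (by norm_num) (by linarith)
    norm_num at h2 h5 ⊢
    linarith

end CutVertexCloseness

namespace CutVertexCloseness

open BTree

/-! ### Cutting off a path of less than average length -/

variable {V : Type*} {Γ : SimpleGraph V} {m k : ℕ} {L : List (BTree V)}

theorem exists_lt_of_listInner {L : List (BTree V)} {q : ℕ}
    (h : q * listOuter L < listInner L) : ∃ u ∈ L, q * u.outerCount < u.innerCount := by
  induction L with
  | nil => simp at h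
  | cons u L ih =>
    by_cases hu : q * u.outerCount < u.innerCount
    · exact ⟨u, by simp, hu⟩
    · simp only [listOuter_cons, listInner_cons, mul_add] at h
      obtain ⟨u', h1, h2⟩ := ih (by omega)
      exact ⟨u', by simp [h1], h2⟩

theorem listInner_le_of_paths {L : List (BTree V)} {q : ℕ}
    (h : ∀ u ∈ L, u.IsPath ∧ u.innerCount ≤ q) : listInner L ≤ q * listOuter L := by
  induction L with
  | nil => simp
  | cons u L ih =>
    have h1 := ih fun x hx => h x (by simp [hx])
    have h2 := h u (by simp)
    simp only [listInner_cons, listOuter_cons, h2.1.outerCount, mul_add]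
    omega

theorem innerCount_eq_of_le {L : List (BTree V)} {q : ℕ}
    (h : ∀ u ∈ L, u.IsPath ∧ u.innerCount ≤ q) (heq : q * listOuter L ≤ listInner L) :
    ∀ u ∈ L, u.innerCount = q := by
  induction L with
  | nil => simp
  | cons u L ih =>
    have h0 := fun x hx => h x (List.mem_cons_of_mem u hx)
    have h1 := listInner_le_of_paths h0
    have h2 := h u (by simp)
    simp only [listInner_cons, listOuter_cons, h2.1.outerCount, mul_add] at heq
    intro x hx
    rcases List.mem_cons.mp hx with rfl | hx
    · omega
    · exact ih h0 (by omega) x hx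

theorem exists_two_le_of_sum {S : Multiset ℕ} (h : S.card < S.sum) : ∃ x ∈ S, 2 ≤ x := by
  by_contra! hc
  have := Multiset.sum_le_card_nsmul S 1 fun x hx => Nat.le_of_lt_succ (hc x hx)
  simp at this
  omega

variable [Fintype V]

/-- The path `t` is cut off at its clique, which has a branch `u` that is no path. The bound is
strict if a second branch is no path, or some branch at a neighbour of the root of `u` is no path,
or `u` has several blocks at its root. -/
theorem IsRep.lt_cutValue_of_thick {q : ℕ} {t u : BTree V} {us : List (BTree V)}
    (h : IsRep Γ k (t :: u :: us)) (hn : Fintype.card V = m + k) (ht : t.IsPath)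
    (hq : t.innerCount = q + 1) (hus : us ≠ []) (hk : m * (q + 1) < k) (hu : ¬ u.IsPath)
    (hgood : u.Good)
    (hthick : (∃ x ∈ us, ¬ x.IsPath) ∨ u.HasThickChild ∨
      ∃ r w, u = block r w ∧ 2 ≤ r.outerRootCount ∧ 2 ≤ listOuter w) :
    linkResidualCloseness Γ < cutValue (m + k) m k (q + 1 + 1) := by
  have pu := h.proper u (by simp)
  have pus : ∀ x ∈ us, x.Proper := fun x hx => h.proper x (by simp [hx])
  obtain ⟨r, w, rfl⟩ : ∃ r w, u = block r w := by
    rcases u.eq_leaf_or_block with ⟨v, rfl⟩ | h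
    · exact absurd (.leaf v) hu
    · exact h
  have hw2 := two_le_weight pu hu
  have ho2 := two_le_outerCount pu hu
  have hlen : 1 ≤ us.length := List.length_pos_iff.mpr hus
  have hlenR : (1 : ℝ) ≤ us.length := by exact_mod_cast hlen
  have hlo := length_le_listOuter pus
  obtain ⟨A, g₁, a1, a2, a3, a4, a5⟩ := exists_paths_of_list us ((block r w).weight + 1)
    (by linarith) pus (fun x hx => (pus x hx).pathsDominate) (Or.inl (by linarith))
  have hA0 := slotSum_nonneg A
  obtain ⟨B, g₂, ⟨b1, b2, b3, b4⟩, -, b5, b6⟩ := hgood.exists_starBound pu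
    (Z := 1 + slotSum A) (by linarith)
  rw [outerRootCount_block, ← outerCount_block] at b1
  rw [innerRootCount_block, ← innerCount_block] at b2
  have e1 := h.outer_add
  have e2 := h.inner_eq
  simp only [listOuter_cons, listInner_cons, ht.outerCount, hq] at e1 e2
  have hm : 1 + A.card + B.card = m := by omega
  have hres := h.residual_le_cut ht hq
  obtain ⟨c1, c2⟩ := cut_le (q := q + 1) (A := A) (B := B) (m := m) (k := k) hm (by omega)
    (by omega)
  have hcA := card_le_slotSum A
  have hcB := card_le_slotSum B
  have hA1 : (1 : ℝ) ≤ A.card := by exact_mod_cast (by omega : 1 ≤ A.card)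
  have hB1 : (2 : ℝ) ≤ B.card := by exact_mod_cast (by omega : 2 ≤ B.card)
  have hpow := half_pow_le_half_pow (by omega : 1 ≤ q + 1)
  rw [pow_one] at hpow
  have hnn : 0 ≤ (slotSum A - 1) * (slotSum B - 2) / 2 := by
    have := mul_nonneg (by linarith : 0 ≤ slotSum A - 1) (by linarith : 0 ≤ slotSum B - 2)
    linarith
  push_cast at c1 c2
  rcases hthick with hx | hx | ⟨r', w', hu', hr, hw⟩
  · -- a second branch that is no path
    have hg := (a4 hx).2
    rw [min_eq_right (by linarith)] at hg
    have hA2 : 2 ≤ A.card := by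
      obtain ⟨x, hx, hxp⟩ := hx
      have h1 := two_le_outerCount (pus x hx) hxp
      have h2 := List.single_le_sum (fun _ _ => Nat.zero_le _) _
        (List.mem_map_of_mem (f := outerCount) hx)
      rw [a1, listOuter]
      omega
    have hA2R : (2 : ℝ) ≤ A.card := by exact_mod_cast hA2
    by_cases hB0 : 0 < B.sum
    · have h3 := card_add_half_le_slotSum hB0
      have := mul_pos (by linarith : 0 < slotSum A - 1) (by linarith : 0 < slotSum B - 2)
      linarith
    · -- then the path lengths are not balanced
      have hA3 : A.card < A.sum := by
        rw [← hm] at hk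
        have h1 : (1 + A.card + B.card) * 1 ≤ (1 + A.card + B.card) * (q + 1) :=
          Nat.mul_le_mul_left _ (by omega)
        have h2 : (1 + A.card + B.card) * (q + 1) = (q + 1) + (A.card + B.card) * (q + 1) := by
          ring
        have h3 : (A.card + B.card) * 1 ≤ (A.card + B.card) * (q + 1) :=
          Nat.mul_le_mul_left _ (by omega)
        omega
      obtain ⟨x, hx, hx2⟩ := exists_two_le_of_sum hA3
      obtain ⟨y, hy⟩ := Multiset.card_pos_iff_exists_mem.mp (by omega : 0 < B.card)
      have hy0 : y = 0 := by
        have := Multiset.single_le_sum (fun _ _ => Nat.zero_le _) y hy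
        omega
      have := c2 x (by simp [hx]) y (by simp [hy]) (by omega)
      linarith
  · have hg := b5 hx
    rw [min_eq_right (by linarith)] at hg
    have hbal : 0 < (slotSum A - 1) * (slotSum B - 2) / 2 ∨
        ∃ x ∈ A + B, ∃ y ∈ A + B, y + 1 < x := by
      have h2 : (1 + A.card + B.card) * (q + 1) = (q + 1) + (A.card + B.card) * (q + 1) := by
        ring
      have h3 : (A.card + B.card) * 1 ≤ (A.card + B.card) * (q + 1) :=
        Nat.mul_le_mul_left _ (by omega)
      rw [← hm] at hk
      by_cases hA : A.sum = 0
      · right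
        obtain ⟨x, hx, hx2⟩ := exists_two_le_of_sum (by omega : B.card < B.sum)
        obtain ⟨y, hy⟩ := Multiset.card_pos_iff_exists_mem.mp (by omega : 0 < A.card)
        have hy0 : y = 0 := by
          have := Multiset.single_le_sum (fun _ _ => Nat.zero_le _) y hy
          omega
        exact ⟨x, by simp [hx], y, by simp [hy], by omega⟩
      by_cases hB : B.sum = 0
      · right
        obtain ⟨x, hx, hx2⟩ := exists_two_le_of_sum (by omega : A.card < A.sum)
        obtain ⟨y, hy⟩ := Multiset.card_pos_iff_exists_mem.mp (by omega : 0 < B.card)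
        have hy0 : y = 0 := by
          have := Multiset.single_le_sum (fun _ _ => Nat.zero_le _) y hy
          omega
        exact ⟨x, by simp [hx], y, by simp [hy], by omega⟩
      · left
        have h3 := card_add_half_le_slotSum (by omega : 0 < A.sum)
        have h4 := card_add_half_le_slotSum (by omega : 0 < B.sum)
        have := mul_pos (by linarith : 0 < slotSum A - 1) (by linarith : 0 < slotSum B - 2)
        linarith
    rcases hbal with hpos | ⟨x, hx, y, hy, hxy⟩
    · linarith
    · have := c2 x hx y hy hxy
      linarith
  · have hg := b6 r' w' hu'
    have hr' : (2 : ℝ) ≤ r'.outerRootCount := by exact_mod_cast hr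
    have hw' : (2 : ℝ) ≤ listOuter w' := by exact_mod_cast hw
    have := mul_le_mul hr' hw' (by norm_num) (by linarith)
    linarith

/-- If all pendant paths are short, one of them has the maximal possible length, and all paths have
this length whenever cutting it off is not strictly worse than in the balanced graph. -/
theorem IsRep.le_cutValue_of_long {q : ℕ} (h : IsRep Γ k L) (hL : 2 ≤ L.length)
    (hn : Fintype.card V = m + k) (hm : 3 ≤ m) (hk : m * (q + 1) < k)
    (hB : OnlyPendantBridges Γ k) (hA : NoLongPendants Γ k (q + 1)) :
    linkResidualCloseness Γ < cutValue (m + k) m k (q + 1 + 1) ∨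
      IsTwoCliques Γ k 2 2 ∨
      linkResidualCloseness Γ ≤ cutValue (m + k) m k (q + 1 + 1) ∧ IsTwoCliques Γ k 2 3 := by
  classical
  obtain ⟨t, L, h, hL, ht, hq⟩ := h.exists_long_path hL hn hm hk hB hA
  have e1 := h.outer_add
  have e2 := h.inner_eq
  simp only [listOuter_cons, listInner_cons, ht.outerCount, hq] at e1 e2
  have hmL : m = 1 + listOuter L := by omega
  have hmul : m * (q + 1) = (q + 1) + (q + 1) * listOuter L := by rw [hmL]; ring
  obtain ⟨u, hu, hlt⟩ := exists_lt_of_listInner (by omega : (q + 1) * listOuter L < listInner L)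
  have hp := List.perm_cons_erase hu
  have hlen := List.length_erase_of_mem hu
  set us := L.erase u
  have hus : us ≠ [] := List.ne_nil_of_length_pos (by omega)
  replace h := h.perm (hp.cons t)
  have h' := h.swap
  have hup : ¬ u.IsPath := by
    intro hup
    have := h'.innerCount_le_of_isPath (by simp) hA hup
    rw [hup.outerCount] at hlt
    omega
  have hlen2 : 2 ≤ (t :: us).length := by simp only [List.length_cons]; omega
  have hgood : u.Good := h'.good hlen2 hB
  by_cases c1 : ∃ x ∈ us, ¬ x.IsPath
  · exact Or.inl (h.lt_cutValue_of_thick hn ht hq hus hk hup hgood (Or.inl c1))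
  by_cases c2 : u.HasThickChild
  · exact Or.inl (h.lt_cutValue_of_thick hn ht hq hus hk hup hgood (Or.inr (Or.inl c2)))
  push Not at c1
  rw [hasThickChild_iff] at c2
  push Not at c2
  have hus1 : ∀ x ∈ us, x.IsPath ∧ x.innerCount ≤ q + 1 := by
    intro x hx
    refine ⟨c1 x hx, ?_⟩
    have hp' : (t :: u :: us).Perm (x :: t :: u :: us.erase x) :=
      ((((List.perm_cons_erase hx).cons u).trans (List.Perm.swap _ _ _)).cons t).trans
        (List.Perm.swap _ _ _)
    exact (h.perm hp').innerCount_le_of_isPath (by simp) hA (c1 x hx)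
  have hw1 : ∀ r w, RootBlock u r w → ∀ x ∈ w, x.IsPath ∧ x.innerCount ≤ q + 1 := by
    intro r w hw x hx
    have hxp := c2 r w hw x hx
    exact ⟨hxp, (h'.descend (by simp) hw hx).innerCount_le_of_isPath (by simp) hA hxp⟩
  have hall : ∀ r w, RootBlock u r w → listInner w ≤ (q + 1) * listOuter w := fun r w hw =>
    listInner_le_of_paths (hw1 r w hw)
  have hu1 := innerRootCount_le_of_rootBlock hall
  have hus2 := listInner_le_of_paths hus1
  rw [listOuter_perm hp, listOuter_cons, mul_add (q + 1)] at hmul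
  rw [listInner_perm hp, listInner_cons] at e2
  rcases u.eq_leaf_or_block with ⟨v, rfl⟩ | ⟨r, w, rfl⟩
  · exact absurd (.leaf v) hup
  have hu2 : (block r w).innerRootCount = (block r w).innerCount := by simp
  have hu3 : (block r w).outerRootCount = (block r w).outerCount := by simp
  rw [hu2, hu3] at hu1
  have hus3 := innerCount_eq_of_le hus1 (by omega)
  -- all paths at the root of the other branch are as long as possible
  have hw2 : ∀ r' w', RootBlock (block r w) r' w' →
      r'.innerRootCount ≤ 1 + (q + 1) * r'.outerRootCount →
      (∀ x ∈ w', x.innerCount = q + 1) ∧ 2 ≤ w'.length := by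
    intro r' w' hw' hr'
    have f1 := hw'.innerRootCount_eq
    have f2 := hw'.outerRootCount_eq
    have f3 := hall r' w' hw'
    rw [hu2] at f1
    rw [hu3] at f2
    rw [f2, mul_add] at hlt
    have hx := innerCount_eq_of_le (hw1 r' w' hw') (by omega)
    refine ⟨hx, ?_⟩
    by_contra hlen'
    obtain ⟨x, hxm⟩ := List.exists_mem_of_length_pos (h'.ne_nil_of_rootBlock hw')
    obtain ⟨g1, g2⟩ := h'.isPath_of_rootBlock hlen2 hB hw' hlen' x hxm
    have := hA _ _ g2 g1
    have := hx x hxm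
    omega
  have pu := h.proper (block r w) (by simp)
  have pw : ∀ x ∈ w, x.Proper := by
    cases pu with
    | block _ _ h3 => exact h3
  have hrall : r.innerRootCount ≤ 1 + (q + 1) * r.outerRootCount :=
    innerRootCount_le_of_rootBlock fun r' w' hw' => hall _ w' (.there w hw')
  obtain ⟨x1, x2⟩ := hw2 r w (.here r w) hrall
  rcases r.eq_leaf_or_block with ⟨c, rfl⟩ | ⟨r', w', rfl⟩
  · have hall' : ∀ x ∈ w ++ (t :: us), x.IsPath ∧ x.innerCount = q + 1 := by
      intro x hx
      rcases List.mem_append.mp hx with hx | hx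
      · exact ⟨(hw1 _ w (.here _ w) x hx).1, x1 x hx⟩
      · rcases List.mem_cons.mp hx with rfl | hx
        · exact ⟨ht, hq⟩
        · exact ⟨c1 x hx, hus3 x hx⟩
    by_cases hle : w.length ≤ (t :: us).length
    · exact h'.le_cutValue_of_two_cliques hn x2 hle hall'
    · refine (h'.move_block (by simp)).le_cutValue_of_two_cliques hn hlen2 (by omega) ?_
      intro x hx
      exact hall' x (by rw [List.mem_append] at hx ⊢; exact hx.symm)
  · left
    refine h.lt_cutValue_of_thick hn ht hq hus hk hup hgood
      (Or.inr (Or.inr ⟨block r' w', w, rfl, ?_, ?_⟩))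
    · have hrb : RootBlock (block (block r' w') w) (block r' w) w' := .there w (.here r' w')
      have hr2 : (block r' w).innerRootCount ≤ 1 + (q + 1) * (block r' w).outerRootCount := by
        refine innerRootCount_le_of_rootBlock fun r'' w'' hw'' => ?_
        cases hw'' with
        | here => exact hall _ _ (.here _ w)
        | there _ hw'' => exact hall _ _ (.there w (.there w' hw''))
      have hl := (hw2 _ w' hrb hr2).2
      have pw' : ∀ x ∈ w', x.Proper := by
        cases pu with
        | block h1 _ _ =>
          cases h1 with
          | block _ _ h3 => exact h3
      have := length_le_listOuter pw'
      rw [outerRootCount_block]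
      omega
    · exact x2.trans (length_le_listOuter pw)

omit [Fintype V] in
/-- Some block has only one vertex at which other blocks are attached. -/
theorem IsRep.exists_end_block {t : BTree V} (h : IsRep Γ k (t :: L)) (hL : L ≠ [])
    (ht : t.isLeaf = false) :
    ∃ R us, IsRep Γ k (R :: us) ∧ us ≠ [] ∧ R.isLeaf = false ∧ ∀ u ∈ us, ∃ v, u = leaf v := by
  classical
  induction t using ind generalizing L with
  | leaf v => simp [isLeaf] at ht
  | block r us _ ih =>
    have h' := h.move_block hL
    by_cases hus : ∀ u ∈ us, u.isLeaf = true
    · exact ⟨_, us, h', List.ne_nil_of_length_pos (h.ne_nil_of_rootBlock (.here r us)), rfl,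
        fun u hu => eq_leaf_of_isLeaf (hus u hu)⟩
    · push Not at hus
      obtain ⟨u, hu, hul⟩ := hus
      exact ih u hu (h.descend hL (.here r us) hu) (by simp) (by simpa using hul)

/-- Without bridges, it suffices to delete an edge at the cut vertex of an end block. -/
theorem IsRep.lt_cutValue_of_no_bridge (h : IsRep Γ k L) (hL : 2 ≤ L.length)
    (hn : Fintype.card V = m + k) (hk2 : 2 ≤ k)
    (hno : ∀ t₁ t₂ : BTree V, ¬ IsRep Γ k [t₁, t₂]) :
    linkResidualCloseness Γ < cutValue (m + k) m k 1 := by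
  classical
  obtain ⟨R, us, h, hus, hR, hleaf⟩ : ∃ R us, IsRep Γ k (R :: us) ∧ us ≠ [] ∧
      R.isLeaf = false ∧ ∀ u ∈ us, ∃ v, u = leaf v := by
    obtain ⟨u, hu, hul⟩ : ∃ u ∈ L, u.isLeaf = false := by
      by_contra! hc
      have h1 : listInner L = L.length * 0 := listInner_of_forall fun u hu => by
        obtain ⟨v, rfl⟩ := eq_leaf_of_isLeaf (by simpa using hc u hu)
        simp
      have := h.inner_eq
      omega
    have hl := List.length_erase_of_mem hu
    exact (h.perm (List.perm_cons_erase hu)).exists_end_block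
      (List.ne_nil_of_length_pos (by omega)) hul
  have hlen : 2 ≤ us.length := by
    by_contra hc
    have := List.length_pos_iff.mpr hus
    obtain ⟨u, rfl⟩ := List.length_eq_one_iff.mp (by omega : us.length = 1)
    exact hno _ _ h
  have hblock : ∀ r w, RootBlock R r w → 2 ≤ w.length := by
    intro r w hw
    by_contra hc
    have := h.ne_nil_of_rootBlock hw
    obtain ⟨u, rfl⟩ := List.length_eq_one_iff.mp (by omega : w.length = 1)
    exact hno _ _ (h.move hus hw)
  have hgood : R.Good := good_of_rootBlock fun r w hw => Or.inl (hblock r w hw)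
  have pR := h.proper R (by simp)
  have hpath : ∀ r w, RootBlock R r w → ∀ u ∈ w, u.IsPath → u.isLeaf = true := by
    intro r w hw u hu hup
    cases hup with
    | leaf v => rfl
    | cons v hup => exact absurd ((h.descend hus hw hu).move_block (by simp)) (hno _ _)
  obtain ⟨hp1, hp2, hp3⟩ := listClose_of_paths (L := us) fun u hu => by
    obtain ⟨v, rfl⟩ := hleaf u hu
    exact .leaf v
  have hz : ∀ u ∈ us, u.innerCount = 0 := fun u hu => by
    obtain ⟨v, rfl⟩ := hleaf u hu
    simp
  have hz' := listInner_of_forall hz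
  rw [map_innerCount_eq_replicate hz] at hp1 hp2
  have e1 := h.outer_add
  have e2 := h.inner_eq
  simp only [listOuter_cons, listInner_cons, hp3, hz', mul_zero, add_zero] at e1 e2
  have hlenR : (2 : ℝ) ≤ us.length := by exact_mod_cast hlen
  have hin : R.innerRootCount = R.innerCount := by
    rcases R.eq_leaf_or_block with ⟨v, rfl⟩ | ⟨r, w, rfl⟩ <;> simp [isLeaf] at hR ⊢
  have hout : R.outerRootCount = R.outerCount := by
    rcases R.eq_leaf_or_block with ⟨v, rfl⟩ | ⟨r, w, rfl⟩ <;> simp [isLeaf] at hR ⊢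
  have hthick : ∃ r w, RootBlock R r w ∧ ∃ u ∈ w, ¬ u.IsPath := by
    by_contra! hc
    have := innerRootCount_le_of_rootBlock (t := R) (q := 0) fun r w hw => by
      have : listInner w = w.length * 0 := listInner_of_forall fun u hu => by
        obtain ⟨v, rfl⟩ := eq_leaf_of_isLeaf (hpath r w hw u hu (hc r w hw u hu))
        simp
      omega
    omega
  have ho3 : 3 ≤ R.outerRootCount := by
    obtain ⟨r, w, hw, u, hu, hup⟩ := hthick
    have pw := (hw.proper pR).2.2
    have h1 := two_le_outerCount (pw u hu) hup
    have h2 := length_le_listOuter (us := w.erase u) fun x hx => pw x (List.mem_of_mem_erase hx)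
    have h3 := List.length_erase_of_mem hu
    have h4 := hblock r w hw
    have h5 := listOuter_perm (List.perm_cons_erase hu)
    rw [listOuter_cons] at h5
    have h6 := hw.outerRootCount_eq
    omega
  obtain ⟨S, g, ⟨b1, b2, b3, b4⟩, -, b5, -⟩ := hgood.exists_starBound pR
    (Z := us.length - 1 / 2) (by linarith)
  replace b5 := b5 (hasThickChild_iff.mpr hthick)
  have hg : (3 : ℝ) / 4 ≤ g := le_trans (le_min (by linarith) (by norm_num)) b5
  have hres : linkResidualCloseness Γ ≤ listClose (R :: us) - R.weight / 2 := by
    obtain ⟨u₁, us', rfl⟩ := List.exists_cons_of_ne_nil hus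
    obtain ⟨u₂, us', rfl⟩ := List.exists_cons_of_ne_nil (l := us') (by rintro rfl; simp at hlen)
    obtain ⟨v, rfl⟩ := hleaf u₁ (by simp)
    simpa using h.residual_le_three
  have hS := card_add_half_le_slotSum (by omega : 0 < S.sum)
  have hS3 : (3 : ℝ) ≤ S.card := by exact_mod_cast (by omega : 3 ≤ S.card)
  have hcut : slotScore (S + Multiset.replicate (us.length - 1) 0) ≤
      slotScore (balanced (m - 1) (k - 1)) :=
    slotScore_le_balanced (by omega) _ (by simp; omega) (by simp; omega)
  have hl1 : ((us.length - 1 : ℕ) : ℝ) = us.length - 1 := by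
    rw [Nat.cast_sub (by omega)]; simp
  have hmR : (m : ℝ) = S.card + us.length := by exact_mod_cast (by omega : m = S.card + us.length)
  have hkR : (k : ℝ) = S.sum + 1 := by exact_mod_cast (by omega : k = S.sum + 1)
  unfold cutValue
  simp only [slotScore, slotSum_add, slotPairs_add, slotSum_replicate, slotPairs_replicate,
    slot_zero, hl1] at hcut
  simp only [listClose_cons, hp1, hp2, pathsCloseness, slotSum_replicate, slotPairs_replicate,
    slot_zero, Multiset.sum_replicate, Multiset.card_replicate, smul_zero, Nat.cast_zero] at hres
  simp only [pathsCloseness] at b4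
  rw [Nat.cast_add, hmR, hkR, slotScore]
  have := mul_nonneg (by linarith : (0 : ℝ) ≤ us.length - 2) (by linarith : 0 ≤ slotSum S - 3.5)
  nlinarith

/-- The upper bound for graphs all of whose blocks are complete. -/
theorem IsRep.residual_bound (h : IsRep Γ k L) (hL : 2 ≤ L.length)
    (hn : Fintype.card V = m + k) (hm : 3 ≤ m) (hk2 : 2 ≤ k) :
    linkResidualCloseness Γ < cutValue (m + k) m k ((k + m - 1) / m) ∨
      linkResidualCloseness Γ ≤ cutValue (m + k) m k ((k + m - 1) / m) ∧
        (IsBalancedPaths Γ m k ∨ IsTwoCliques Γ k 2 3) ∨ IsTwoCliques Γ k 2 2 := by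
  by_cases hB : OnlyPendantBridges Γ k
  · by_cases hA : ∃ t₁ t₂, IsRep Γ k [t₁, t₂] ∧ t₁.IsPath ∧ (k + m - 1) / m ≤ t₁.innerCount + 1
    · obtain ⟨t₁, t₂, h', h1, h2⟩ := hA
      rcases h'.le_cutValue_of_pendant hn hm (by omega) hB h1 h2 with h3 | ⟨h3, h4⟩
      · exact Or.inl h3
      · exact Or.inr (Or.inl ⟨h3, Or.inl h4⟩)
    push Not at hA
    have hc := mul_ceil_sub_one_lt (m := m) (k := k) (by omega) (by omega)
    obtain ⟨q, hq⟩ : ∃ q, (k + m - 1) / m = q + 1 := by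
      have : 1 ≤ (k + m - 1) / m := (Nat.one_le_div_iff (by omega)).mpr (by omega)
      exact ⟨(k + m - 1) / m - 1, by omega⟩
    rw [hq] at hA hc ⊢
    have hA' : NoLongPendants Γ k q := fun t₁ t₂ h h1 => by
      have := hA t₁ t₂ h h1
      omega
    obtain _ | q := q
    · refine Or.inl (h.lt_cutValue_of_no_bridge hL hn hk2 fun t₁ t₂ h' => ?_)
      rcases hB _ _ h' with h1 | h1
      · have := hA' _ _ h' h1
        omega
      · have := hA' _ _ h'.swap h1
        omega
    · rcases h.le_cutValue_of_long hL hn hm hc hB hA' with h1 | h1 | ⟨h1, h2⟩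
      · exact Or.inl h1
      · exact Or.inr (Or.inr h1)
      · exact Or.inr (Or.inl ⟨h1, Or.inr h2⟩)
  · unfold OnlyPendantBridges at hB
    push Not at hB
    obtain ⟨t₁, t₂, h', h1, h2⟩ := hB
    exact Or.inl (h'.lt_cutValue_of_bridge hn h1 h2)

end CutVertexCloseness

namespace CutVertexCloseness

open BTree

/-! ### The residual closeness of the extremal graphs -/

variable {V : Type*} {Γ : SimpleGraph V} {m k : ℕ} {L : List (BTree V)}

theorem exists_perm_of_mem_rootSet {L : List (BTree V)} {x y : V} (hx : x ∈ rootSet L)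
    (hy : y ∈ rootSet L) (hxy : x ≠ y) :
    ∃ t₁ t₂ L', L.Perm (t₁ :: t₂ :: L') ∧ t₁.root = x ∧ t₂.root = y := by
  classical
  obtain ⟨t₁, h1, rfl⟩ := mem_rootSet.mp hx
  obtain ⟨t₂, h2, rfl⟩ := mem_rootSet.mp hy
  have h2' : t₂ ∈ L.erase t₁ :=
    (List.mem_erase_of_ne (by rintro rfl; exact hxy rfl)).mpr h2
  exact ⟨t₁, t₂, (L.erase t₁).erase t₂,
    (List.perm_cons_erase h1).trans ((List.perm_cons_erase h2').cons _), rfl, rfl⟩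

theorem listGraph_adj {x y : V} :
    (listGraph L).Adj x y ↔ (x ≠ y ∧ x ∈ rootSet L ∧ y ∈ rootSet L) ∨ ∃ u ∈ L, u.graph.Adj x y := by
  rw [listGraph, SimpleGraph.sup_adj, cliqueOn_adj, sumGraph_adj]

variable [Fintype V]

namespace IsRep

theorem closeness_deleteEdges_of_root {x y : V} (h : IsRep Γ k L) (hL : 3 ≤ L.length)
    (hx : x ∈ rootSet L) (hy : y ∈ rootSet L) (hxy : x ≠ y) :
    ∃ t₁ t₂ L', L.Perm (t₁ :: t₂ :: L') ∧
      closeness (Γ.deleteEdges {s(x, y)}) = closeness Γ - t₁.weight * t₂.weight / 2 := by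
  obtain ⟨t₁, t₂, L', hp, rfl, rfl⟩ := exists_perm_of_mem_rootSet hx hy hxy
  refine ⟨t₁, t₂, L', hp, ?_⟩
  have h' := h.perm hp
  have hlen := hp.length_eq
  obtain ⟨t₃, L', rfl⟩ := List.exists_cons_of_ne_nil (l := L') (by
    rintro rfl; simp at hlen; omega)
  rw [h'.closeness_eq, ← closeness_deleteEdges_of_three h'.nodup, h'.graph_eq]

theorem closeness_deleteEdges_bridge {t₁ t₂ : BTree V} (h : IsRep Γ k [t₁, t₂]) :
    closeness (Γ.deleteEdges {s(t₁.root, t₂.root)}) = closeness Γ - t₁.weight * t₂.weight := by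
  rw [h.closeness_eq, ← h.graph_eq, closeness_deleteEdges_pair h.nodup]
  simp only [listClose_cons, listClose_nil, listWeight_cons, listWeight_nil]
  ring

/-- The edges of a path at the end of a bridge. -/
theorem le_closeness_deleteEdges_of_bridge {t₁ t₂ : BTree V} (h : IsRep Γ k [t₁, t₂])
    (ht : t₁.IsPath) (h₂ : 2 ≤ t₂.weight) {x y : V} (hxy : t₁.graph.Adj x y) :
    closeness Γ - slot t₁.innerCount * t₂.weight ≤ closeness (Γ.deleteEdges {s(x, y)}) := by
  induction ht generalizing t₂ with
  | leaf v => simp at hxy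
  | @cons v u hu ih =>
    have h' : IsRep Γ k [u, block (leaf v) [t₂]] := (h.move_block (by simp)).swap
    have hw : (block (leaf v) [t₂]).weight = 1 + t₂.weight / 2 := by simp
    have hle : slot u.innerCount * (block (leaf v) [t₂]).weight ≤
        slot (block (leaf v) [u]).innerCount * t₂.weight := by
      have h1 := one_le_slot u.innerCount
      refine mul_le_mul (slot_mono (by simp)) (by rw [hw]; linarith) (by rw [hw]; linarith) ?_
      linarith [one_le_slot (block (leaf v) [u]).innerCount]
    rw [graph_block, listGraph_adj] at hxy
    rcases hxy with ⟨hne, hx, hy⟩ | ⟨u', hu', hxy⟩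
    · obtain ⟨s₁, s₂, L', hp, rfl, rfl⟩ := exists_perm_of_mem_rootSet hx hy hne
      have hroot : s(s₁.root, s₂.root) = s(u.root, (block (leaf v) [t₂]).root) := by
        have h1 : s₁ ∈ [leaf v, u] := hp.mem_iff.mpr (by simp)
        have h2 : s₂ ∈ [leaf v, u] := hp.mem_iff.mpr (by simp)
        simp only [List.mem_cons, List.not_mem_nil, or_false] at h1 h2
        rcases h1 with rfl | rfl <;> rcases h2 with rfl | rfl
        · exact absurd rfl hne
        · simp [Sym2.eq_swap]
        · simp
        · exact absurd rfl hne
      rw [hroot, h'.closeness_deleteEdges_bridge, hu.weight]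
      linarith
    · simp only [List.mem_cons, List.not_mem_nil, or_false] at hu'
      rcases hu' with rfl | rfl
      · simp at hxy
      · have := ih h' (by rw [hw]; linarith) hxy
        linarith

/-- The edges of a path at a clique: the edge next to the clique is the most important one. -/
theorem le_closeness_deleteEdges_of_path {t : BTree V} (h : IsRep Γ k (t :: L)) (hL : L ≠ [])
    (ht : t.IsPath) (hw : 2 ≤ listWeight L) {x y : V} (hxy : t.graph.Adj x y) :
    closeness Γ - (slot t.innerCount - 1) * (2 + listWeight L) ≤
      closeness (Γ.deleteEdges {s(x, y)}) := by
  cases ht with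
  | leaf v => simp at hxy
  | @cons v u hu =>
    have h' : IsRep Γ k [u, block (leaf v) L] := (h.move_block hL).swap
    have hw' : (block (leaf v) L).weight = 1 + listWeight L / 2 := by simp
    have hval : (slot (block (leaf v) [u]).innerCount - 1) * (2 + listWeight L) =
        slot u.innerCount * (block (leaf v) L).weight := by
      rw [hw', show (block (leaf v) [u]).innerCount = u.innerCount + 1 by simp [add_comm],
        slot_succ]
      ring
    rw [hval]
    rw [graph_block, listGraph_adj] at hxy
    rcases hxy with ⟨hne, hx, hy⟩ | ⟨u', hu', hxy⟩
    · obtain ⟨s₁, s₂, L', hp, rfl, rfl⟩ := exists_perm_of_mem_rootSet hx hy hne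
      have hroot : s(s₁.root, s₂.root) = s(u.root, (block (leaf v) L).root) := by
        have h1 : s₁ ∈ [leaf v, u] := hp.mem_iff.mpr (by simp)
        have h2 : s₂ ∈ [leaf v, u] := hp.mem_iff.mpr (by simp)
        simp only [List.mem_cons, List.not_mem_nil, or_false] at h1 h2
        rcases h1 with rfl | rfl <;> rcases h2 with rfl | rfl
        · exact absurd rfl hne
        · simp [Sym2.eq_swap]
        · simp
        · exact absurd rfl hne
      rw [hroot, h'.closeness_deleteEdges_bridge, hu.weight]
    · simp only [List.mem_cons, List.not_mem_nil, or_false] at hu'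
      rcases hu' with rfl | rfl
      · simp at hxy
      · exact h'.le_closeness_deleteEdges_of_bridge hu (by rw [hw']; linarith) hxy

omit [Fintype V] in
theorem edgeSet_nonempty (h : IsRep Γ k L) (hL : 2 ≤ L.length) : Γ.edgeSet.Nonempty := by
  obtain ⟨t₁, L, rfl⟩ := List.exists_cons_of_ne_nil
    (List.ne_nil_of_length_pos (by omega : 0 < L.length))
  obtain ⟨t₂, L, rfl⟩ := List.exists_cons_of_ne_nil (l := L) (by rintro rfl; simp at hL)
  exact ⟨s(t₁.root, t₂.root), h.adj⟩

end IsRep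

theorem IsBalancedPaths.cutValue_le (h : IsBalancedPaths Γ m k) (hm : 3 ≤ m) (hk : 0 < k) :
    cutValue (m + k) m k ((k + m - 1) / m) ≤ linkResidualCloseness Γ := by
  classical
  obtain ⟨L, h, hp, hbal⟩ := h
  have hlen : L.length = m := by
    have := congrArg Multiset.card hbal
    rw [card_balanced (by omega)] at this
    simpa using this
  have ha1 : 1 ≤ (k + m - 1) / m := (Nat.one_le_div_iff (by omega)).mpr (by omega)
  have hle := le_mul_ceil (m := m) (k := k) (by omega)
  have hlt := mul_ceil_sub_one_lt (m := m) (k := k) (by omega) hk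
  set a := (k + m - 1) / m
  have hc := cons_balanced (by omega) hle hlt ha1
  obtain ⟨l1, l2, l3⟩ := listClose_of_paths hp
  rw [hbal, ← hc] at l1 l2
  set B := balanced (m - 1) (k - a) with hB
  have hcard : B.card = m - 1 := card_balanced (by omega) _
  have hsum : B.sum = k - a := sum_balanced (by omega) _
  have hak : a ≤ k := by
    have : 1 * (a - 1) ≤ m * (a - 1) := Nat.mul_le_mul_right _ (by omega)
    omega
  have hn : ((m + k : ℕ) : ℝ) = 1 + B.card + a + B.sum := by
    rw [hcard, hsum]; exact_mod_cast (by omega : m + k = 1 + (m - 1) + a + (k - a))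
  have hBs : (2 : ℝ) ≤ slotSum B :=
    le_trans (by rw [hcard]; exact_mod_cast (by omega : 2 ≤ m - 1)) (card_le_slotSum B)
  have hval : cutValue (m + k) m k a = closeness Γ - (slot a - 1) * (2 + slotSum B) := by
    rw [h.closeness_eq, l1, cutValue, hn, ← hB, pathsCloseness, slotScore]
    simp only [Multiset.sum_cons, Multiset.card_cons, slotSum_cons, slotPairs_cons, slot,
      Nat.cast_add, Nat.cast_one]
    ring
  have ha2 := slot_lt_two a
  have ha3 := slot_mono ha1
  rw [slot_one] at ha3
  rw [slotSum_cons] at l2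
  have hia : ∀ u ∈ L, u.innerCount ≤ a := fun u hu => by
    have : u.innerCount ∈ balanced m k := by
      rw [← hbal]; simpa using ⟨u, hu, rfl⟩
    exact mem_balanced_le this hle
  refine le_linkResidualCloseness (h.edgeSet_nonempty (by omega)) fun e he => ?_
  induction e using Sym2.ind with
  | _ x y =>
    rw [SimpleGraph.mem_edgeSet, ← h.graph_eq, listGraph_adj] at he
    rw [hval]
    rcases he with ⟨hne, hx, hy⟩ | ⟨u, hu, hxy⟩
    · obtain ⟨t₁, t₂, L', hperm, heq⟩ := h.closeness_deleteEdges_of_root (by omega) hx hy hne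
      rw [heq]
      have p1 := hp t₁ (hperm.mem_iff.mpr (by simp))
      have p2 := hp t₂ (hperm.mem_iff.mpr (by simp))
      rw [p1.weight, p2.weight]
      have b1 := slot_lt_two t₁.innerCount
      have b2 := slot_lt_two t₂.innerCount
      have b3 := one_le_slot t₁.innerCount
      have b4 := one_le_slot t₂.innerCount
      nlinarith
    · have hperm := List.perm_cons_erase hu
      have hw := listWeight_perm hperm
      rw [listWeight_cons, (hp u hu).weight, l2] at hw
      have b1 := slot_mono (hia u hu)
      have b2 := one_le_slot u.innerCount
      refine le_trans ?_ ((h.perm hperm).le_closeness_deleteEdges_of_path ?_ (hp u hu) ?_ hxy)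
      · rw [show listWeight (L.erase u) = slot a + slotSum B - slot u.innerCount by linarith]
        nlinarith
      · have := List.length_erase_of_mem hu
        exact List.ne_nil_of_length_pos (by omega)
      · linarith

/-- No edge matters more than a pendant edge at the larger clique, which leaves the closeness `16`
or `24.5`. -/
theorem IsTwoCliques.le_residual {t : ℕ} (h : IsTwoCliques Γ k 2 t)
    (ht : t = 2 ∨ t = 3) :
    (if t = 2 then 16 else 24.5) ≤ linkResidualCloseness Γ := by
  classical
  obtain ⟨c, w, us, h, hw, hus, hp⟩ := h
  have hpw : ∀ u ∈ w, u.IsPath := fun u hu => (hp u (by simp [hu])).1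
  have hpu : ∀ u ∈ us, u.IsPath := fun u hu => (hp u (by simp [hu])).1
  have hiw : ∀ u ∈ w, u.innerCount = 1 := fun u hu => (hp u (by simp [hu])).2
  have hiu : ∀ u ∈ us, u.innerCount = 1 := fun u hu => (hp u (by simp [hu])).2
  obtain ⟨a1, a2, -⟩ := listClose_of_paths hpw
  obtain ⟨b1, b2, -⟩ := listClose_of_paths hpu
  rw [map_innerCount_eq_replicate hiw, hw] at a1 a2
  rw [map_innerCount_eq_replicate hiu, hus] at b1 b2
  have hwt : ∀ u ∈ w ++ us, u.weight = 3 / 2 := fun u hu => by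
    rw [(hp u hu).1.weight, (hp u hu).2, slot_one]
  rw [slotSum_replicate, slot_one] at a2 b2
  have hW : (block (leaf c) w).weight = 5 / 2 := by simp [a2]; norm_num
  have hU : (block (leaf c) us).weight = 1 + t * (3 / 2) / 2 := by simp [b2]
  have h' := h.move_block (List.ne_nil_of_length_pos (by omega))
  have hclose : closeness Γ = if t = 2 then 19 else 28.25 := by
    rw [h.closeness_eq, listClose_cons, hW, b1, b2, close_block, listClose_cons, a1, a2]
    simp only [pathsCloseness, slotSum_replicate, slotPairs_replicate, slot_one, close_leaf,
      weight_leaf, Multiset.sum_replicate, Multiset.card_replicate, smul_eq_mul, mul_one]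
    rcases ht with rfl | rfl <;> norm_num
  have hpath : ∀ u L, IsRep Γ k (u :: L) → u ∈ w ++ us → L ≠ [] → 2 ≤ listWeight L →
      listWeight L ≤ 5 / 2 + (t - 1) * (3 / 2) → ∀ x y, u.graph.Adj x y →
      (if t = 2 then 16 else 24.5) ≤ closeness (Γ.deleteEdges {s(x, y)}) := by
    intro u L hr hu hL h2 hle x y hxy
    refine le_trans ?_ (hr.le_closeness_deleteEdges_of_path hL (hp u hu).1 h2 hxy)
    rw [(hp u hu).2, slot_one, hclose]
    rcases ht with rfl | rfl <;> norm_num at hle ⊢ <;> linarith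
  have hroot : ∀ t₁ t₂ : BTree V, t₁.weight ≤ 13 / 4 → t₂.weight = 3 / 2 →
      (if t = 2 then 16 else 24.5) ≤ closeness Γ - t₁.weight * t₂.weight / 2 := by
    intro t₁ t₂ h1 h2
    rw [h2, hclose]
    rcases ht with rfl | rfl <;> norm_num <;> linarith
  have hU' : (block (leaf c) us).weight ≤ 13 / 4 := by
    rw [hU]
    rcases ht with rfl | rfl <;> norm_num
  -- the edges of one of the two cliques
  have hclique : ∀ (T : BTree V) (L : List (BTree V)), IsRep Γ k (T :: L) → 2 ≤ L.length →
      T.weight ≤ 13 / 4 → (∀ u ∈ L, u ∈ w ++ us) → ∀ x y, x ≠ y → x ∈ rootSet (T :: L) →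
      y ∈ rootSet (T :: L) →
      (if t = 2 then 16 else 24.5) ≤ closeness (Γ.deleteEdges {s(x, y)}) := by
    intro T L hr hL hT hsub x y hne hx hy
    obtain ⟨t₁, t₂, L', hperm, heq⟩ :=
      hr.closeness_deleteEdges_of_root (by simp; omega) hx hy hne
    rw [heq]
    have hnd : (T :: L).Nodup := List.Nodup.of_map _ (nodup_roots hr.nodup)
    have h1 : t₁ ∈ T :: L := hperm.mem_iff.mpr (by simp)
    have h2 : t₂ ∈ T :: L := hperm.mem_iff.mpr (by simp)
    have h12 : t₁ ≠ t₂ := by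
      have := hperm.nodup_iff.mp hnd
      rintro rfl
      simp at this
    rcases List.mem_cons.mp h2 with rfl | h2
    · have h1 := (List.mem_cons.mp h1).resolve_left h12
      rw [mul_comm]
      exact hroot _ _ hT (hwt _ (hsub _ h1))
    · refine hroot _ _ ?_ (hwt _ (hsub _ h2))
      rcases List.mem_cons.mp h1 with rfl | h1
      · exact hT
      · rw [hwt _ (hsub _ h1)]; norm_num
  refine le_linkResidualCloseness (h.edgeSet_nonempty (by simp; omega)) fun e he => ?_
  induction e using Sym2.ind with
  | _ x y =>
    rw [SimpleGraph.mem_edgeSet, ← h.graph_eq, listGraph_adj] at he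
    rcases he with ⟨hne, hx, hy⟩ | ⟨u, hu, hxy⟩
    · exact hclique _ _ h (by omega) (by rw [hW]; norm_num) (fun u hu => by simp [hu])
        x y hne hx hy
    rcases List.mem_cons.mp hu with rfl | hu
    · rw [graph_block, listGraph_adj] at hxy
      rcases hxy with ⟨hne, hx, hy⟩ | ⟨u, hu, hxy⟩
      · refine hclique _ _ h' (by omega) hU' (fun u hu => by simp [hu]) x y hne ?_ ?_
        · simpa [mem_rootSet] using hx
        · simpa [mem_rootSet] using hy
      rcases List.mem_cons.mp hu with rfl | hu
      · simp at hxy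
      · have hperm := (List.perm_cons_erase hu)
        have hw1 := listWeight_perm hperm
        rw [listWeight_cons, hwt u (by simp [hu]), a2] at hw1
        refine hpath u _ (h'.perm ((hperm.cons _).trans (List.Perm.swap _ _ _)))
          (by simp [hu]) (by simp) ?_ ?_ x y hxy
        · rw [listWeight_cons, hU]
          rcases ht with rfl | rfl <;> norm_num at hw1 ⊢ <;> linarith
        · rw [listWeight_cons, hU]
          rcases ht with rfl | rfl <;> norm_num at hw1 ⊢ <;> linarith
    · have hperm := (List.perm_cons_erase hu)
      have hw1 := listWeight_perm hperm
      rw [listWeight_cons, hwt u (by simp [hu]), b2] at hw1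
      refine hpath u _ (h.perm ((hperm.cons _).trans (List.Perm.swap _ _ _)))
        (by simp [hu]) (by simp) ?_ ?_ x y hxy
      · rw [listWeight_cons, hW]
        rcases ht with rfl | rfl <;> norm_num at hw1 ⊢ <;> linarith
      · rw [listWeight_cons, hW]
        rcases ht with rfl | rfl <;> norm_num at hw1 ⊢ <;> linarith

end CutVertexCloseness

namespace CutVertexCloseness

open BTree

/-! ### Isomorphisms -/

section Iso

variable {V W : Type*} {G : SimpleGraph V} {H : SimpleGraph W}

theorem distWeight_iso (φ : G ≃g H) (u v : V) : distWeight H (φ u) (φ v) = distWeight G u v := by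
  unfold distWeight
  rw [φ.reachable_iff]
  split_ifs with h
  · congr 3
    refine le_antisymm ?_ ?_
    · obtain ⟨p, hp⟩ := h.exists_walk_length_eq_dist
      rw [← hp, ← SimpleGraph.Walk.length_map φ.toHom]
      exact SimpleGraph.dist_le _
    · obtain ⟨p, hp⟩ := (φ.reachable_iff.mpr h).exists_walk_length_eq_dist
      rw [← hp, ← SimpleGraph.Walk.length_map φ.symm.toHom]
      refine le_of_eq_of_le ?_ (SimpleGraph.dist_le _)
      simp
  · rfl

variable [Fintype V] [Fintype W]

theorem closeness_iso (φ : G ≃g H) : closeness G = closeness H := by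
  classical
  unfold closeness vertexCloseness
  refine Fintype.sum_equiv φ.toEquiv _ _ fun u => ?_
  refine Finset.sum_equiv φ.toEquiv (fun v => ?_) fun v _ => ?_
  · simp
  · exact (distWeight_iso φ u v).symm

theorem linkResidualCloseness_iso (φ : G ≃g H) :
    linkResidualCloseness G = linkResidualCloseness H := by
  refine Equiv.iInf_congr φ.mapEdgeSet fun e => ?_
  refine (closeness_iso ⟨φ.toEquiv, ?_⟩).symm
  intro a b
  have h1 : H.Adj (φ a) (φ b) ↔ G.Adj a b := φ.map_adj_iff
  have h2 : s(φ a, φ b) = Sym2.map φ e ↔ s(a, b) = e := by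
    rw [← Sym2.map_mk]
    exact (Sym2.map.injective φ.injective).eq_iff
  simp only [SimpleGraph.deleteEdges_adj, Set.mem_singleton_iff]
  exact and_congr h1 (not_congr h2)

end Iso

variable {V : Type*} {Γ : SimpleGraph V} {k : ℕ} {L : List (BTree V)}

theorem BTree.IsPath.length_verts {t : BTree V} (ht : t.IsPath) :
    t.verts.length = t.innerCount + 1 := by
  rw [← t.outer_add_inner.1, ht.outerCount, add_comm]

theorem BTree.getElem_verts_zero (t : BTree V) (h : 0 < t.verts.length) :
    t.verts[0] = t.root := by
  induction t using ind with
  | leaf v => simp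
  | block r us hr _ =>
    have := List.length_pos_of_mem r.root_mem_verts
    simp only [verts_block, listVerts_cons, root_block]
    rw [List.getElem_append_left this, hr]

theorem sym2_eq_of_ne {a b x y : V} (hxy : x ≠ y) (hx : x = a ∨ x = b) (hy : y = a ∨ y = b) :
    s(x, y) = s(a, b) := by
  rcases hx with rfl | rfl <;> rcases hy with rfl | rfl
  · exact absurd rfl hxy
  · rfl
  · exact Sym2.eq_swap
  · exact absurd rfl hxy

/-- Adjacency in a path is succession in its list of vertices. -/
theorem BTree.IsPath.graph_adj {t : BTree V} (ht : t.IsPath) (hnd : t.verts.Nodup) {x y : V} :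
    t.graph.Adj x y ↔
      ∃ (j : ℕ) (h : j + 1 < t.verts.length), s(x, y) = s(t.verts[j], t.verts[j + 1]) := by
  induction ht with
  | leaf v => simp
  | @cons v u hu ih =>
    have hnd' : u.verts.Nodup ∧ v ∉ u.verts := by
      simp only [verts_block, listVerts_cons, verts_leaf] at hnd
      simpa [and_comm] using hnd
    have hne : v ≠ u.root := by
      rintro rfl; exact hnd'.2 u.root_mem_verts
    have hv : (BTree.block (BTree.leaf v) [u]).verts = v :: u.verts := by simp
    have hpos := List.length_pos_of_mem u.root_mem_verts
    rw [graph_block, listGraph_adj]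
    simp only [mem_rootSet, List.mem_cons, List.not_mem_nil, or_false, exists_eq_or_imp,
      exists_eq_left, root_leaf, graph_leaf, SimpleGraph.bot_adj, false_or, ih hnd'.1, hv,
      List.length_cons]
    constructor
    · rintro (⟨h1, h2, h3⟩ | ⟨j, hj, h⟩)
      · refine ⟨0, by omega, ?_⟩
        simp only [List.getElem_cons_zero, List.getElem_cons_succ, u.getElem_verts_zero]
        exact sym2_eq_of_ne h1 (h2.imp Eq.symm Eq.symm) (h3.imp Eq.symm Eq.symm)
      · exact ⟨j + 1, by omega, by simpa using h⟩
    · rintro ⟨j, hj, h⟩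
      obtain _ | j := j
      · left
        simp only [List.getElem_cons_zero, List.getElem_cons_succ, u.getElem_verts_zero] at h
        rcases Sym2.eq_iff.mp h with ⟨rfl, rfl⟩ | ⟨rfl, rfl⟩
        · exact ⟨hne, Or.inl rfl, Or.inr rfl⟩
        · exact ⟨hne.symm, Or.inr rfl, Or.inl rfl⟩
      · right
        exact ⟨j, by omega, by simpa using h⟩

theorem exists_perm_map_eq {α β : Type*} (f : α → β) {l : List α} {l' : List β}
    (h : (l.map f).Perm l') : ∃ l₂, l.Perm l₂ ∧ l₂.map f = l' := by
  classical
  induction l' generalizing l with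
  | nil => exact ⟨[], by simpa using h, rfl⟩
  | cons b l' ih =>
    obtain ⟨a, ha, rfl⟩ := List.mem_map.mp (h.mem_iff.mpr (by simp : b ∈ b :: l'))
    have hp := List.perm_cons_erase ha
    have h' := ((hp.map f).symm.trans h)
    rw [List.map_cons, List.perm_cons] at h'
    obtain ⟨l₂, h1, h2⟩ := ih h'
    exact ⟨a :: l₂, hp.trans (h1.cons a), by simp [h2]⟩

theorem nodup_of_listVerts (h : (listVerts L).Nodup) : L.Nodup :=
  List.Nodup.of_map _ (nodup_roots h)

theorem iso_fromRel {W : Type*} [Fintype V] [Fintype W] (f : W → V) (hinj : Function.Injective f)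
    (hcard : Fintype.card V ≤ Fintype.card W) (R : W → W → Prop)
    (h : ∀ a b, a ≠ b → (Γ.Adj (f a) (f b) ↔ R a b ∨ R b a)) :
    Nonempty (Γ ≃g SimpleGraph.fromRel R) := by
  have hb : Function.Bijective f := (Fintype.bijective_iff_injective_and_card f).mpr
    ⟨hinj, le_antisymm (Fintype.card_le_of_injective f hinj) hcard⟩
  refine ⟨(RelIso.symm ⟨Equiv.ofBijective f hb, fun {a b} => ?_⟩)⟩
  rw [SimpleGraph.fromRel_adj, Equiv.ofBijective_apply, Equiv.ofBijective_apply]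
  by_cases hab : a = b
  · simp [hab]
  · simp [hab, h a b hab]

theorem IsRep.iso_cliqueWithPaths [Fintype V] {m : ℕ} (h : IsRep Γ k L) (hp : ∀ u ∈ L, u.IsPath)
    (a : Fin m → ℕ) (ha : L.map innerCount = List.ofFn a) :
    Nonempty (Γ ≃g cliqueWithPaths a) := by
  have hlen : L.length = m := by simpa using congrArg List.length ha
  have hi : ∀ i : Fin m, (L[i]'(by omega)).innerCount = a i := by
    intro i
    have : (L.map innerCount)[i]'(by simp; omega) = (List.ofFn a)[i]'(by simp) := by
      simp only [ha]
    simpa using this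
  have hmem : ∀ i : Fin m, L[i]'(by omega) ∈ L := fun i => List.getElem_mem _
  have hl : ∀ i : Fin m, (L[i]'(by omega)).verts.length = a i + 1 := fun i => by
    rw [(hp _ (hmem i)).length_verts, hi]
  let f : (Σ i : Fin m, Fin (a i + 1)) → V := fun p =>
    (L[p.1]'(by omega)).verts[(p.2 : ℕ)]'(by rw [hl]; exact p.2.2)
  have hfm : ∀ p, f p ∈ (L[p.1]'(by omega)).verts := fun p => List.getElem_mem _
  have hfst : ∀ p (i : Fin m), f p ∈ (L[i]'(by omega)).verts → p.1 = i := by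
    intro p i hpi
    have := eq_of_mem_verts h.nodup (hmem p.1) (hmem i) (hfm p) hpi
    exact Fin.ext ((nodup_of_listVerts h.nodup).getElem_inj_iff.mp this)
  have hsnd : ∀ p (i : Fin m) (j : ℕ) (hj : j < (L[i]'(by omega)).verts.length),
      f p = (L[i]'(by omega)).verts[j] → p.1 = i ∧ (p.2 : ℕ) = j := by
    rintro ⟨i', j'⟩ i j hj hpj
    obtain rfl := hfst ⟨i', j'⟩ i (hpj ▸ List.getElem_mem _)
    exact ⟨rfl, (nodup_of_mem h.nodup (hmem i')).getElem_inj_iff.mp hpj⟩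
  have hinj : Function.Injective f := by
    rintro ⟨i, j⟩ ⟨i', j'⟩ hpq
    obtain ⟨h1, h2⟩ := hsnd ⟨i, j⟩ i' j' (by rw [hl]; exact j'.2) hpq
    simp only at h1 h2
    subst h1
    rw [Fin.ext h2]
  have hroot : ∀ p, f p ∈ rootSet L ↔ (p.2 : ℕ) = 0 := by
    intro p
    rw [mem_rootSet]
    constructor
    · rintro ⟨u, hu, hup⟩
      obtain ⟨i, hi, rfl⟩ := List.getElem_of_mem hu
      rw [← getElem_verts_zero _ (by rw [(hp _ hu).length_verts]; omega)] at hup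
      exact (hsnd p ⟨i, by omega⟩ 0 _ hup.symm).2
    · intro h0
      refine ⟨_, hmem p.1, ?_⟩
      rw [← getElem_verts_zero _ (by rw [hl]; omega)]
      simp only [f, h0]
  refine iso_fromRel f hinj ?_ _ ?_
  · refine Fintype.card_le_of_surjective f fun x => ?_
    obtain ⟨u, hu, hx⟩ := mem_listVerts.mp (h.cover x)
    obtain ⟨i, hi', rfl⟩ := List.getElem_of_mem hu
    obtain ⟨j, hj, rfl⟩ := List.getElem_of_mem hx
    exact ⟨⟨⟨i, by omega⟩, ⟨j, by rw [← hl ⟨i, by omega⟩]; exact hj⟩⟩, rfl⟩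
  · rintro p p' hne
    rw [← h.graph_eq, listGraph_adj, hroot, hroot]
    constructor
    · rintro (⟨-, h1, h2⟩ | ⟨u, hu, hadj⟩)
      · exact Or.inl (Or.inl ⟨h1, h2⟩)
      · rw [(hp u hu).graph_adj (nodup_of_mem h.nodup hu)] at hadj
        obtain ⟨j, hj, hs⟩ := hadj
        obtain ⟨i, hi', rfl⟩ := List.getElem_of_mem hu
        rcases Sym2.eq_iff.mp hs with ⟨g1, g2⟩ | ⟨g1, g2⟩
        · obtain ⟨e1, e2⟩ := hsnd p ⟨i, by omega⟩ j _ g1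
          obtain ⟨e3, e4⟩ := hsnd p' ⟨i, by omega⟩ _ hj g2
          exact Or.inl (Or.inr ⟨e1.trans e3.symm, by omega⟩)
        · obtain ⟨e1, e2⟩ := hsnd p ⟨i, by omega⟩ _ hj g1
          obtain ⟨e3, e4⟩ := hsnd p' ⟨i, by omega⟩ j _ g2
          exact Or.inr (Or.inr ⟨e3.trans e1.symm, by omega⟩)
    · have key : ∀ p p' : (Σ i : Fin m, Fin (a i + 1)), p.1 = p'.1 → (p'.2 : ℕ) = p.2 + 1 →
          (L[p.1]'(by omega)).graph.Adj (f p) (f p') := by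
        rintro ⟨i, j⟩ ⟨i', j'⟩ h1 h2
        simp only at h1 h2
        subst h1
        rw [(hp _ (hmem i)).graph_adj (nodup_of_mem h.nodup (hmem i))]
        refine ⟨j, by rw [hl]; omega, ?_⟩
        simp only [f, h2]
      rintro ((⟨h1, h2⟩ | ⟨h1, h2⟩) | (⟨h1, h2⟩ | ⟨h1, h2⟩))
      · exact Or.inl ⟨hinj.ne hne, h1, h2⟩
      · exact Or.inr ⟨_, hmem p.1, key p p' h1 h2⟩
      · exact Or.inl ⟨hinj.ne hne, h2, h1⟩
      · exact Or.inr ⟨_, hmem p'.1, (key p' p h1 h2).symm⟩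

theorem ofFn_balancedSeq {m : ℕ} (hm : 0 < m) (s : ℕ) :
    (List.ofFn (balancedSeq m s) : Multiset ℕ) = balanced m s := by
  have hne : (List.ofFn (balancedSeq m s) : Multiset ℕ) ≠ 0 := by
    intro h0
    have := congrArg Multiset.card h0
    simp at this
    omega
  have := eq_balanced hne fun x hx y hy => by
    simp only [Multiset.mem_coe, List.mem_ofFn] at hx hy
    obtain ⟨i, rfl⟩ := hx
    obtain ⟨j, rfl⟩ := hy
    simp only [balancedSeq]
    split_ifs <;> omega
  simpa [List.sum_ofFn, sum_balancedSeq hm] using this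

theorem IsBalancedPaths.iso [Fintype V] {m : ℕ} (h : IsBalancedPaths Γ m k) (hm : 0 < m) :
    Nonempty (Γ ≃g cliqueWithPaths (balancedSeq m k)) := by
  obtain ⟨L, h, hp, hbal⟩ := h
  rw [← ofFn_balancedSeq hm, Multiset.coe_eq_coe] at hbal
  obtain ⟨L', h1, h2⟩ := exists_perm_map_eq _ hbal
  exact (h.perm h1).iso_cliqueWithPaths (fun u hu => hp u (h1.mem_iff.mpr hu)) _ h2

/-- The path with the vertex `v` at its root, followed by the vertices in `l`. -/
def pathTree : V → List V → BTree V
  | v, [] => leaf v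
  | v, w :: l => block (leaf v) [pathTree w l]

theorem pathTree_spec (v : V) (l : List V) :
    (pathTree v l).IsPath ∧ (pathTree v l).verts = v :: l ∧
      (pathTree v l).innerCount = l.length := by
  induction l generalizing v with
  | nil => exact ⟨.leaf v, by simp [pathTree], by simp [pathTree]⟩
  | cons w l ih =>
    obtain ⟨h1, h2, h3⟩ := ih w
    exact ⟨.cons v h1, by simp [pathTree, h2], by simp [pathTree, h3, add_comm]⟩

theorem exists_isBalancedPaths {m : ℕ} (hm : 0 < m) (k : ℕ) :
    ∃ Γ : SimpleGraph (Σ i : Fin m, Fin (balancedSeq m k i + 1)), IsBalancedPaths Γ m k := by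
  set a := balancedSeq m k
  let L : List (BTree (Σ i : Fin m, Fin (a i + 1))) := (List.finRange m).map fun i =>
    pathTree ⟨i, 0⟩ ((List.finRange (a i)).map fun j => ⟨i, j.succ⟩)
  have hp : ∀ u ∈ L, u.IsPath := by
    intro u hu
    obtain ⟨i, -, rfl⟩ := List.mem_map.mp hu
    exact (pathTree_spec _ _).1
  have hv : listVerts L = (List.finRange m).sigma fun i => List.finRange (a i + 1) := by
    simp only [listVerts, L, List.flatMap_map, List.sigma]
    refine List.flatMap_congr fun i _ => ?_
    rw [(pathTree_spec _ _).2.1, List.finRange_succ, List.map_cons, List.map_map]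
    rfl
  have hb : (L.map innerCount : Multiset ℕ) = balanced m k := by
    rw [← ofFn_balancedSeq hm, List.ofFn_eq_map, List.map_map]
    congr 2
    funext i
    simp [(pathTree_spec _ _).2.2, a]
  refine ⟨listGraph L, L, ⟨?_, ?_, fun u hu => (hp u hu).proper, rfl, ?_⟩, hp, hb⟩
  · rw [hv]
    exact (List.nodup_finRange m).sigma fun i => List.nodup_finRange _
  · rintro ⟨i, j⟩
    rw [hv]
    exact List.mem_sigma.mpr ⟨List.mem_finRange _, List.mem_finRange _⟩
  · have := congrArg Multiset.sum hb
    rw [sum_balanced hm] at this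
    simpa [listInner] using this

end CutVertexCloseness

namespace CutVertexCloseness

open BTree

/-! ### Two cliques with a common vertex -/

variable {V : Type*} {Γ : SimpleGraph V} {k : ℕ} {L : List (BTree V)}

/-- The rooted path with the vertices `a` and `b`. -/
def BTree.edge (a b : V) : BTree V := block (leaf a) [leaf b]

theorem BTree.edge_spec (a b : V) : (edge a b).IsPath ∧ (edge a b).innerCount = 1 ∧
    (edge a b).root = a ∧ (edge a b).verts = [a, b] := by
  refine ⟨.cons a (.leaf b), ?_, ?_, ?_⟩ <;> simp [edge]

theorem BTree.edge_graph_adj (a b x y : V) :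
    (edge a b).graph.Adj x y ↔ a ≠ b ∧ s(x, y) = s(a, b) := by
  rw [edge, graph_block, listGraph_adj]
  simp only [mem_rootSet, List.mem_cons, List.not_mem_nil, or_false, exists_eq_or_imp,
    exists_eq_left, root_leaf, graph_leaf, SimpleGraph.bot_adj, or_self]
  constructor
  · rintro ⟨h1, h2, h3⟩
    have := sym2_eq_of_ne h1 (h2.imp Eq.symm Eq.symm) (h3.imp Eq.symm Eq.symm)
    refine ⟨?_, this⟩
    rintro rfl
    rcases Sym2.eq_iff.mp this with ⟨rfl, rfl⟩ | ⟨rfl, rfl⟩ <;> exact h1 rfl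
  · rintro ⟨h1, h2⟩
    rcases Sym2.eq_iff.mp h2 with ⟨rfl, rfl⟩ | ⟨rfl, rfl⟩
    · exact ⟨h1, Or.inl rfl, Or.inr rfl⟩
    · exact ⟨h1.symm, Or.inr rfl, Or.inl rfl⟩

theorem exists_eq_map_edge {s : ℕ} (hL : L.length = s)
    (h : ∀ u ∈ L, u.IsPath ∧ u.innerCount = 1) :
    ∃ a b : Fin s → V, L = (List.finRange s).map fun i => edge (a i) (b i) := by
  have key : ∀ u ∈ L, ∃ a b : V, u = edge a b := by
    intro u hu
    obtain ⟨h1, h2⟩ := h u hu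
    cases h1 with
    | leaf v => simp at h2
    | @cons v u' h1 =>
      cases h1 with
      | leaf w => exact ⟨v, w, rfl⟩
      | cons w _ => simp at h2
  subst hL
  choose a b hab using fun i : Fin L.length => key L[i] (List.getElem_mem _)
  refine ⟨a, b, List.ext_getElem (by simp) fun i h1 h2 => ?_⟩
  simpa using hab ⟨i, h1⟩

/-- The two cliques with pendant edges, with vertices given by `f`. -/
def twoCliques {s t : ℕ} (f : Option ((Fin s ⊕ Fin t) × Bool) → V) : List (BTree V) :=
  block (leaf (f none)) ((List.finRange s).map fun i =>
      edge (f (some (Sum.inl i, false))) (f (some (Sum.inl i, true)))) ::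
    (List.finRange t).map fun j => edge (f (some (Sum.inr j, false))) (f (some (Sum.inr j, true)))

theorem IsTwoCliques.iso [Fintype V] {s t : ℕ} (h : IsTwoCliques Γ k s t) :
    Nonempty (Γ ≃g graphH (s + 1) (t + 1)) := by
  obtain ⟨c, w, us, h, hw, hus, hp⟩ := h
  obtain ⟨a, b, rfl⟩ := exists_eq_map_edge hw fun u hu => hp u (by simp [hu])
  obtain ⟨a', b', rfl⟩ := exists_eq_map_edge hus fun u hu => hp u (by simp [hu])
  clear hw hus hp
  let f : Option ((Fin s ⊕ Fin t) × Bool) → V := fun p =>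
    p.elim c fun x => bif x.2 then Sum.elim b b' x.1 else Sum.elim a a' x.1
  have hsurj : Function.Surjective f := by
    intro x
    have := h.cover x
    simp only [listVerts_cons, verts_block, verts_leaf, List.mem_append, mem_listVerts,
      List.mem_map, List.mem_finRange, true_and, List.mem_cons, List.not_mem_nil, or_false] at this
    rcases this with (rfl | ⟨_, ⟨i, rfl⟩, hx⟩) | ⟨_, ⟨i, rfl⟩, hx⟩
    · exact ⟨none, rfl⟩
    · rw [(edge_spec _ _).2.2.2] at hx
      simp only [List.mem_cons, List.not_mem_nil, or_false] at hx
      rcases hx with rfl | rfl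
      · exact ⟨some (Sum.inl i, false), rfl⟩
      · exact ⟨some (Sum.inl i, true), rfl⟩
    · rw [(edge_spec _ _).2.2.2] at hx
      simp only [List.mem_cons, List.not_mem_nil, or_false] at hx
      rcases hx with rfl | rfl
      · exact ⟨some (Sum.inr i, false), rfl⟩
      · exact ⟨some (Sum.inr i, true), rfl⟩
  have hcard : Fintype.card V = Fintype.card (Option ((Fin s ⊕ Fin t) × Bool)) := by
    have hi : ∀ (n : ℕ) (a b : Fin n → V),
        listInner ((List.finRange n).map fun i => edge (a i) (b i)) = n ∧
        listOuter ((List.finRange n).map fun i => edge (a i) (b i)) = n := by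
      intro n a b
      constructor
      · rw [listInner_of_forall (j := 1) fun u hu => ?_]
        · simp
        · obtain ⟨i, -, rfl⟩ := List.mem_map.mp hu
          exact (edge_spec _ _).2.1
      · rw [(listClose_of_paths fun u hu => ?_).2.2]
        · simp
        · obtain ⟨i, -, rfl⟩ := List.mem_map.mp hu
          exact (edge_spec _ _).1
    have e1 := h.outer_add
    have e2 := h.inner_eq
    simp only [listOuter_cons, outerCount_block, outerRootCount_leaf, listInner_cons,
      innerCount_block, innerRootCount_leaf, (hi _ _ _).1, (hi _ _ _).2] at e1 e2
    simp only [Fintype.card_option, Fintype.card_prod, Fintype.card_sum, Fintype.card_fin,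
      Fintype.card_bool]
    omega
  have hinj : Function.Injective f :=
    ((Fintype.bijective_iff_surjective_and_card f).mpr ⟨hsurj, hcard.symm⟩).1
  refine iso_fromRel (W := Option ((Fin s ⊕ Fin t) × Bool)) f hinj hcard.le _ ?_
  intro p q hpq
  have hL : block (leaf c) ((List.finRange s).map fun i => edge (a i) (b i)) ::
      ((List.finRange t).map fun i => edge (a' i) (b' i)) = twoCliques f := rfl
  rw [hL] at h
  rw [← h.graph_eq, twoCliques, listGraph_adj]
  simp only [List.mem_cons, exists_eq_or_imp, graph_block, listGraph_adj, mem_rootSet,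
    List.mem_map, List.mem_finRange, true_and, exists_exists_eq_and, (edge_spec _ _).2.2.1,
    root_block, root_leaf, edge_graph_adj, graph_leaf, SimpleGraph.bot_adj, false_or,
    hinj.eq_iff, hinj.ne_iff, Sym2.eq_iff]
  rcases p with _ | ⟨i | i, _ | _⟩ <;> rcases q with _ | ⟨j | j, _ | _⟩ <;>
    simp_all [eq_comm]

theorem exists_isTwoCliques (s t : ℕ) (hs : 0 < s) : 
    ∃ Γ : SimpleGraph (Option ((Fin s ⊕ Fin t) × Bool)), IsTwoCliques Γ (s + t + 1) s t := by
  have hp : ∀ (n : ℕ) (g : Fin n → Fin s ⊕ Fin t), ∀ u ∈ (List.finRange n).map fun i =>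
      edge (V := Option ((Fin s ⊕ Fin t) × Bool)) (some (g i, false)) (some (g i, true)),
      u.IsPath ∧ u.innerCount = 1 := by
    intro n g u hu
    obtain ⟨i, -, rfl⟩ := List.mem_map.mp hu
    exact ⟨(edge_spec _ _).1, (edge_spec _ _).2.1⟩
  have hcover : ∀ x : Option ((Fin s ⊕ Fin t) × Bool), x ∈ listVerts (twoCliques id) := by
    intro x
    simp only [twoCliques, id, listVerts_cons, verts_block, verts_leaf, List.mem_append,
      mem_listVerts, List.mem_map, List.mem_finRange, true_and, exists_exists_eq_and,
      (edge_spec _ _).2.2.2]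
    rcases x with _ | ⟨i | i, _ | _⟩ <;> simp
  have hin : listInner (twoCliques (id : Option ((Fin s ⊕ Fin t) × Bool) → _)) = s + t + 1 := by
    simp only [twoCliques, listInner_cons, innerCount_block, innerRootCount_leaf, id]
    rw [listInner_of_forall fun u hu => (hp s Sum.inl u hu).2,
      listInner_of_forall fun u hu => (hp t Sum.inr u hu).2]
    simp only [List.length_map, List.length_finRange]
    omega
  have hout : listOuter (twoCliques (id : Option ((Fin s ⊕ Fin t) × Bool) → _)) = s + t := by
    simp only [twoCliques, listOuter_cons, outerCount_block, outerRootCount_leaf, id]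
    rw [(listClose_of_paths fun u hu => (hp s Sum.inl u hu).1).2.2,
      (listClose_of_paths fun u hu => (hp t Sum.inr u hu).1).2.2]
    simp
  refine ⟨_, none, _, _, ⟨?_, hcover, ?_, rfl, hin⟩, by simp, by simp, ?_⟩
  · rw [← Multiset.coe_nodup, ← Multiset.toFinset_card_eq_card_iff_nodup]
    have : (listVerts (twoCliques (id : Option ((Fin s ⊕ Fin t) × Bool) → _))).toFinset =
        Finset.univ := by
      ext x; simpa using hcover x
    refine (congrArg Finset.card this).trans ?_
    have h1 := listOuter_add_listInner
      (twoCliques (id : Option ((Fin s ⊕ Fin t) × Bool) → _))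
    rw [hin, hout] at h1
    refine Eq.trans ?_ h1
    simp [Fintype.card_option]
    omega
  · intro u hu
    rcases List.mem_cons.mp hu with rfl | hu
    · refine .block (.leaf _) ?_ fun u hu => (hp s Sum.inl u hu).1.proper
      exact List.ne_nil_of_length_pos (by simpa using hs)
    · exact (hp t Sum.inr u hu).1.proper
  · intro u hu
    rcases List.mem_append.mp hu with hu | hu
    · exact hp s Sum.inl u hu
    · exact hp t Sum.inr u hu

end CutVertexCloseness

namespace CutVertexCloseness

open BTree

/-! ### From connected graphs to trees of cliques -/

variable {V : Type*} {Γ G : SimpleGraph V} {k : ℕ} {L : List (BTree V)}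

/-- The inner vertices of the branches in a list, that is, the cut vertices of `listGraph L`. -/
def innerVerts (L : List (BTree V)) : List V := L.flatMap inner

@[simp] theorem innerVerts_cons (u : BTree V) (us : List (BTree V)) :
    innerVerts (u :: us) = u.inner ++ innerVerts us := rfl

theorem innerVerts_perm {L L' : List (BTree V)} (h : L.Perm L') :
    (innerVerts L).Perm (innerVerts L') := h.flatMap_right _

theorem length_innerVerts (L : List (BTree V)) : (innerVerts L).length = listInner L := by
  simp [innerVerts, listInner, List.length_flatMap]; rfl

theorem BTree.inner_leaf (v : V) : (leaf v).inner = [] := by simp [inner, isLeaf]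

theorem BTree.inner_block (r : BTree V) (us : List (BTree V)) :
    (block r us).inner = r.innerRoot ++ innerVerts us := by
  simp [inner, isLeaf, innerRoot, innerVerts]; rfl

theorem BTree.innerRoot_leaf (v : V) : (leaf v).innerRoot = [v] := by simp [innerRoot]

theorem BTree.innerRoot_block (r : BTree V) (us : List (BTree V)) :
    (block r us).innerRoot = r.innerRoot ++ innerVerts us := by
  simp [isLeaf, innerRoot, innerVerts]; rfl

theorem BTree.root_mem_innerRoot (t : BTree V) : t.root ∈ t.innerRoot := by
  induction t using ind with
  | leaf v => simp [innerRoot_leaf]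
  | block r us hr _ => simp [innerRoot_block, hr]

theorem innerVerts_sublist_of (h : ∀ u ∈ L, u.innerRoot.Sublist u.verts) :
    (innerVerts L).Sublist (listVerts L) := by
  induction L with
  | nil => exact List.Sublist.slnil
  | cons u L ih =>
    rw [innerVerts_cons, listVerts_cons]
    refine List.Sublist.append ?_ (ih fun x hx => h x (by simp [hx]))
    unfold BTree.inner
    split_ifs
    · exact List.nil_sublist _
    · exact h u (by simp)

theorem BTree.innerRoot_sublist (t : BTree V) : t.innerRoot.Sublist t.verts := by
  induction t using ind with
  | leaf v => simp [innerRoot_leaf]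
  | block r us hr hus =>
    rw [innerRoot_block, verts_block, listVerts_cons]
    exact hr.append (innerVerts_sublist_of hus)

theorem innerVerts_sublist (L : List (BTree V)) : (innerVerts L).Sublist (listVerts L) :=
  innerVerts_sublist_of fun u _ => u.innerRoot_sublist

theorem RootBlock.inner_perm {t r : BTree V} {w : List (BTree V)} (h : RootBlock t r w) :
    t.inner.Perm (r.innerRoot ++ innerVerts w) := by
  induction h with
  | here r us => rw [inner_block]
  | @there r r' w us h ih =>
    have : r.inner = r.innerRoot := by cases h <;> simp [BTree.inner, isLeaf]
    rw [inner_block, innerRoot_block, ← this]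
    refine (ih.append_right _).trans ?_
    rw [List.append_assoc, List.append_assoc]
    exact List.Perm.append_left _ List.perm_append_comm

theorem eq_root_or_exists_rootBlock {t : BTree V} {x : V} (hx : x ∈ t.verts) :
    x = t.root ∨ ∃ r w, RootBlock t r w ∧ ∃ u ∈ w, x ∈ u.verts := by
  induction t using ind with
  | leaf v => left; simpa using hx
  | block r us hr _ =>
    rw [verts_block, listVerts_cons, List.mem_append, mem_listVerts] at hx
    rcases hx with hx | hx
    · rcases hr hx with h | ⟨r', w, h, hu⟩
      · left; simpa using h
      · exact Or.inr ⟨_, w, .there us h, hu⟩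
    · exact Or.inr ⟨r, us, .here r us, hx⟩

/-- Every vertex is the root of some branch of a suitable representation. -/
theorem IsRep.exists_root_eq {t : BTree V} {x : V} (h : IsRep Γ k (t :: L)) (hL : L ≠ [])
    (hx : x ∈ t.verts) :
    ∃ t' L', IsRep Γ k (t' :: L') ∧ L' ≠ [] ∧ t'.root = x ∧
      (innerVerts (t :: L)).Perm (innerVerts (t' :: L')) := by
  classical
  induction hN : t.verts.length using Nat.strong_induction_on generalizing t L with
  | _ N ih =>
    rcases eq_root_or_exists_rootBlock hx with rfl | ⟨r, w, hw, u, hu, hxu⟩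
    · exact ⟨t, L, h, hL, rfl, List.Perm.refl _⟩
    · obtain ⟨t', L', h1, h2, h3, h4⟩ := ih _ (hN ▸ hw.length_lt hu) (h.descend hL hw hu)
        (by simp) hxu rfl
      refine ⟨t', L', h1, h2, h3, List.Perm.trans ?_ h4⟩
      have h5 : (innerVerts (t :: L)).Perm (innerVerts (block r L :: w)) := by
        simp only [innerVerts_cons, inner_block]
        refine (hw.inner_perm.append_right _).trans ?_
        rw [List.append_assoc, List.append_assoc]
        exact List.Perm.append_left _ List.perm_append_comm
      exact h5.trans (innerVerts_perm (((List.perm_cons_erase hu).cons _).trans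
        (List.Perm.swap _ _ _)))

/-- A branch is not separated by the removal of a vertex outside of it. -/
theorem mem_iff_root_mem {c : V} {us : List (BTree V)}
    (hnd : (listVerts (leaf c :: us)).Nodup) (hle : G ≤ listGraph (leaf c :: us)) {S : Set V}
    (hS : ∀ a b, G.Adj a b → a ≠ c → b ≠ c → (a ∈ S ↔ b ∈ S)) {u : BTree V} (hu : u ∈ us)
    {z w : V} (p : G.Walk z w) (hw : w = c) (hz : z ∈ u.verts) : z ∈ S ↔ u.root ∈ S := by
  have hc : ∀ x ∈ u.verts, x ≠ c := by
    rintro x hx rfl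
    rw [listVerts_cons, verts_leaf, List.singleton_append, List.nodup_cons] at hnd
    exact hnd.1 (mem_listVerts.mpr ⟨u, hu, hx⟩)
  induction p with
  | nil => exact absurd hw (hc _ hz)
  | @cons z z' w hadj p ih =>
    have hu' : u ∈ leaf c :: us := List.mem_cons_of_mem _ hu
    rcases listGraph_adj.mp (hle hadj) with ⟨-, hr, -⟩ | ⟨u', hu'', h'⟩
    · obtain ⟨u', hu'', rfl⟩ := mem_rootSet.mp hr
      rw [eq_of_mem_verts hnd hu'' hu' u'.root_mem_verts hz]
    · obtain rfl := eq_of_mem_verts hnd hu'' hu' (mem_verts_of_adj h') hz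
      have hz' := mem_verts_of_adj h'.symm
      exact (hS _ _ hadj (hc _ hz) (hc _ hz')).trans (ih hw hz')

/-- The block at a cut vertex can be split. -/
theorem exists_split {c : V} {us : List (BTree V)} (hG : G.Connected) (hc : IsCutVertex G c)
    (h : IsRep Γ k (leaf c :: us)) (hle : G ≤ Γ) :
    ∃ us₁ us₂, (us₁ ++ us₂).Perm us ∧ us₁ ≠ [] ∧ us₂ ≠ [] ∧
      G ≤ listGraph (block (leaf c) us₁ :: us₂) := by
  classical
  obtain ⟨x, y, hxy⟩ : ∃ x y, ¬ (G.induce {c}ᶜ).Reachable x y := by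
    unfold IsCutVertex SimpleGraph.Preconnected at hc
    push Not at hc
    exact hc
  set S : Set V := {z | ∃ hz : z ∈ ({c}ᶜ : Set V), (G.induce {c}ᶜ).Reachable x ⟨z, hz⟩} with hSdef
  have hS : ∀ a b, G.Adj a b → a ≠ c → b ≠ c → (a ∈ S ↔ b ∈ S) := by
    have key : ∀ a b, G.Adj a b → b ≠ c → a ∈ S → b ∈ S := by
      rintro a b hab hb ⟨ha, h⟩
      refine ⟨hb, h.trans (SimpleGraph.Adj.reachable ?_)⟩
      exact hab
    exact fun a b hab ha hb => ⟨key a b hab hb, key b a hab.symm ha⟩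
  have hle' : G ≤ listGraph (leaf c :: us) := by rw [h.graph_eq]; exact hle
  have hroot : ∀ u ∈ us, ∀ z ∈ u.verts, (z ∈ S ↔ u.root ∈ S) := fun u hu z hz => by
    obtain ⟨p⟩ := hG.preconnected z c
    exact mem_iff_root_mem h.nodup hle' hS hu p rfl hz
  have hmem : ∀ z, z ≠ c → ∃ u ∈ us, z ∈ u.verts := by
    intro z hz
    have := h.cover z
    rw [listVerts_cons, verts_leaf, List.singleton_append, List.mem_cons, mem_listVerts] at this
    exact this.resolve_left hz
  have hrc : ∀ u ∈ us, u.root ≠ c := by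
    intro u hu he
    have hnd := h.nodup
    rw [listVerts_cons, verts_leaf, List.singleton_append, List.nodup_cons] at hnd
    exact hnd.1 (mem_listVerts.mpr ⟨u, hu, he ▸ u.root_mem_verts⟩)
  refine ⟨us.filter fun u => decide (u.root ∈ S), us.filter fun u => !decide (u.root ∈ S),
    List.filter_append_perm _ _, ?_, ?_, ?_⟩
  · obtain ⟨u, hu, hxu⟩ := hmem x x.2
    refine List.ne_nil_of_mem (a := u) (List.mem_filter.mpr ⟨hu, ?_⟩)
    simpa using (hroot u hu _ hxu).mp ⟨x.2, SimpleGraph.Reachable.refl _⟩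
  · obtain ⟨u, hu, hyu⟩ := hmem y y.2
    refine List.ne_nil_of_mem (a := u) (List.mem_filter.mpr ⟨hu, ?_⟩)
    have : u.root ∉ S := by
      rw [← hroot u hu _ hyu]
      rintro ⟨_, h⟩
      exact hxy h
    simpa using this
  · intro a b hab
    have hm₁ : ∀ u ∈ us, u.root ∈ S → u ∈ us.filter fun u => decide (u.root ∈ S) :=
      fun u hu h => List.mem_filter.mpr ⟨hu, by simpa using h⟩
    have hm₂ : ∀ u ∈ us, u.root ∉ S → u ∈ us.filter fun u => !decide (u.root ∈ S) :=
      fun u hu h => List.mem_filter.mpr ⟨hu, by simpa using h⟩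
    set us₁ := us.filter fun u => decide (u.root ∈ S)
    set us₂ := us.filter fun u => !decide (u.root ∈ S)
    have hin₁ : ∀ a b, a ≠ b → a ∈ rootSet (leaf c :: us₁) → b ∈ rootSet (leaf c :: us₁) →
        (listGraph (block (leaf c) us₁ :: us₂)).Adj a b := fun a b hne ha hb =>
      listGraph_adj.mpr (Or.inr ⟨_, List.mem_cons_self, by
        rw [graph_block, listGraph_adj]; exact Or.inl ⟨hne, ha, hb⟩⟩)
    have hin₂ : ∀ a b, a ≠ b → a ∈ rootSet (leaf c :: us₂) → b ∈ rootSet (leaf c :: us₂) →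
        (listGraph (block (leaf c) us₁ :: us₂)).Adj a b := fun a b hne ha hb =>
      listGraph_adj.mpr (Or.inl ⟨hne, by simpa [mem_rootSet] using ha,
        by simpa [mem_rootSet] using hb⟩)
    have hin : ∀ u ∈ us, u.graph.Adj a b → (listGraph (block (leaf c) us₁ :: us₂)).Adj a b := by
      intro u hu hadj
      rw [listGraph_adj]
      right
      by_cases hs : u.root ∈ S
      · exact ⟨_, List.mem_cons_self, by
          rw [graph_block, listGraph_adj]
          exact Or.inr ⟨u, List.mem_cons_of_mem _ (hm₁ u hu hs), hadj⟩⟩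
      · exact ⟨u, List.mem_cons_of_mem _ (hm₂ u hu hs), hadj⟩
    have hc0 : ∀ l : List (BTree V), c ∈ rootSet (leaf c :: l) := fun l =>
      ⟨leaf c, by simp, by simp⟩
    have hr0 : ∀ (l : List (BTree V)), ∀ u ∈ l, u.root ∈ rootSet (leaf c :: l) := fun l u hu =>
      ⟨u, by simp [hu], rfl⟩
    rcases listGraph_adj.mp (hle' hab) with ⟨hne, ha, hb⟩ | ⟨u, hu, hadj⟩
    · obtain ⟨u, hu, rfl⟩ := mem_rootSet.mp ha
      obtain ⟨u', hu', rfl⟩ := mem_rootSet.mp hb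
      rcases List.mem_cons.mp hu with rfl | hu <;> rcases List.mem_cons.mp hu' with rfl | hu'
      · exact absurd rfl hne
      · by_cases hs : u'.root ∈ S
        · exact hin₁ _ _ hne (by simpa using hc0 us₁) (hr0 _ _ (hm₁ _ hu' hs))
        · exact hin₂ _ _ hne (by simpa using hc0 us₂) (hr0 _ _ (hm₂ _ hu' hs))
      · by_cases hs : u.root ∈ S
        · exact hin₁ _ _ hne (hr0 _ _ (hm₁ _ hu hs)) (by simpa using hc0 us₁)
        · exact hin₂ _ _ hne (hr0 _ _ (hm₂ _ hu hs)) (by simpa using hc0 us₂)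
      · have hiff := hS _ _ hab (hrc u hu) (hrc u' hu')
        by_cases hs : u.root ∈ S
        · exact hin₁ _ _ hne (hr0 _ _ (hm₁ _ hu hs)) (hr0 _ _ (hm₁ _ hu' (hiff.mp hs)))
        · exact hin₂ _ _ hne (hr0 _ _ (hm₂ _ hu hs)) (hr0 _ _ (hm₂ _ hu' (mt hiff.mpr hs)))
    · rcases List.mem_cons.mp hu with rfl | hu
      · simp at hadj
      · exact hin u hu hadj

variable [Fintype V]

/-- Completing the blocks of a connected graph gives a tree of cliques with the same cut
vertices: among the trees of cliques that contain `G` and all of whose inner vertices are cut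
vertices of `G`, one with the most inner vertices is as required, as otherwise a block could be
split. -/
theorem exists_isRep (hG : G.Connected) (hV : 2 ≤ Fintype.card V) :
    ∃ (Γ : SimpleGraph V) (L : List (BTree V)), G ≤ Γ ∧
      IsRep Γ {v | IsCutVertex G v}.ncard L ∧ 2 ≤ L.length := by
  classical
  let P : ℕ → Prop := fun j => ∃ (Γ : SimpleGraph V) (L : List (BTree V)), G ≤ Γ ∧
    IsRep Γ j L ∧ 2 ≤ L.length ∧ ∀ x ∈ innerVerts L, IsCutVertex G x
  have hP0 : P 0 := by
    let L : List (BTree V) := (Finset.univ : Finset V).toList.map leaf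
    have hv : listVerts L = (Finset.univ : Finset V).toList := by
      simp [listVerts, L, List.flatMap_map]
    have hi : ∀ l : List V, innerVerts (l.map leaf) = [] := by
      intro l
      simp [innerVerts, inner_leaf]
    refine ⟨listGraph L, L, fun a b hab => ?_, ⟨?_, ?_, ?_, rfl, ?_⟩, ?_, ?_⟩
    · exact listGraph_adj.mpr (Or.inl ⟨hab.ne, ⟨leaf a, by simp [L], by simp⟩,
        ⟨leaf b, by simp [L], by simp⟩⟩)
    · rw [hv]; exact Finset.nodup_toList _
    · intro x; rw [hv]; simp
    · intro u hu
      obtain ⟨v, -, rfl⟩ := List.mem_map.mp hu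
      exact .leaf v
    · rw [← length_innerVerts, hi]; rfl
    · simpa [L] using hV
    · intro x hx
      rw [hi] at hx
      simp at hx
  have hbd : ∀ j, P j → j ≤ Fintype.card V := by
    rintro j ⟨Γ, L, -, h, -⟩
    have := h.outer_add
    omega
  obtain ⟨Γ, L, hle, h, hL, hcut⟩ := Nat.findGreatest_spec (P := P)
    (Nat.zero_le (Fintype.card V)) hP0
  have hmax : ∀ j, P j → j ≤ Nat.findGreatest P (Fintype.card V) := fun j hj =>
    Nat.le_findGreatest (hbd j hj) hj
  set j := Nat.findGreatest P (Fintype.card V)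
  refine ⟨Γ, L, hle, ?_, hL⟩
  have hall : ∀ x, IsCutVertex G x → x ∈ innerVerts L := by
    intro c hc
    by_contra hcL
    obtain ⟨t, ht, hct⟩ := mem_listVerts.mp (h.cover c)
    have hp := List.perm_cons_erase ht
    have hl := List.length_erase_of_mem ht
    obtain ⟨t', L', h', hL', rfl, hperm⟩ := (h.perm hp).exists_root_eq
      (List.ne_nil_of_length_pos (by omega)) hct
    have hperm' := (innerVerts_perm hp).trans hperm
    rcases t'.eq_leaf_or_block with ⟨c, rfl⟩ | ⟨r, us, rfl⟩
    · rw [root_leaf] at hc hcL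
      obtain ⟨us₁, us₂, p1, p2, p3, p4⟩ := exists_split hG hc h' hle
      have pv := listVerts_perm p1
      have pi := innerVerts_perm p1
      have hnd := h'.nodup
      have hcov := h'.cover
      have e := h'.inner_eq
      rw [← length_innerVerts, innerVerts_cons, inner_leaf, List.nil_append,
        ← pi.length_eq] at e
      have hin : innerVerts (block (leaf c) us₁ :: us₂) = c :: innerVerts (us₁ ++ us₂) := by
        simp [inner_block, innerRoot_leaf, innerVerts]
      have hve : listVerts (block (leaf c) us₁ :: us₂) = c :: listVerts (us₁ ++ us₂) := by
        simp [listVerts]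
      have pcons : (listVerts (leaf c :: us₁ ++ us₂)).Perm (listVerts (leaf c :: L')) :=
        listVerts_perm (p1.cons _)
      rw [List.cons_append, listVerts_cons, verts_leaf, List.singleton_append] at pcons
      have hprop : ∀ u ∈ us₁ ++ us₂, u.Proper := fun u hu =>
        h'.proper u (List.mem_cons_of_mem _ (p1.mem_iff.mp hu))
      have hPj : P (j + 1) := by
        refine ⟨_, block (leaf c) us₁ :: us₂, p4, ⟨?_, ?_, ?_, rfl, ?_⟩, ?_, ?_⟩
        · rw [hve]; exact pcons.nodup_iff.mpr hnd
        · intro x; rw [hve]; exact pcons.mem_iff.mpr (hcov x)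
        · intro u hu
          rcases List.mem_cons.mp hu with rfl | hu
          · exact .block (.leaf c) p2 fun u hu => hprop u (by simp [hu])
          · exact hprop u (by simp [hu])
        · rw [← length_innerVerts, hin, List.length_cons, e]
        · have := List.length_pos_iff.mpr p3
          rw [List.length_cons]; omega
        · intro x hx
          rw [hin] at hx
          rcases List.mem_cons.mp hx with rfl | hx
          · exact hc
          · refine hcut x (hperm'.mem_iff.mpr ?_)
            rw [innerVerts_cons, inner_leaf, List.nil_append]
            exact pi.mem_iff.mp hx
      have := hmax _ hPj
      omega
    · refine hcL (hperm'.mem_iff.mpr ?_)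
      rw [innerVerts_cons, inner_block, root_block, List.mem_append, List.mem_append]
      exact Or.inl (Or.inl r.root_mem_innerRoot)
  have hset : {v | IsCutVertex G v} = ((innerVerts L).toFinset : Set V) := by
    ext x
    simpa using ⟨hall x, hcut x⟩
  rw [hset, Set.ncard_coe_finset, List.toFinset_card_of_nodup
    (h.nodup.sublist (innerVerts_sublist L)), length_innerVerts, h.inner_eq]
  exact h

theorem linkResidualCloseness_lt {G H : SimpleGraph V} (hGH : G < H) (hG : G.edgeSet.Nonempty) :
    linkResidualCloseness G < linkResidualCloseness H := by
  have hH : H.edgeSet.Nonempty := hG.mono (SimpleGraph.edgeSet_mono hGH.le)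
  obtain ⟨e, he, heq⟩ := (isLeast_linkResidualCloseness H hH).1
  rw [heq]
  have hdel : ∀ {e : Sym2 V} {K : SimpleGraph V}, e ∈ K.edgeSet → K.deleteEdges {e} < K := by
    intro e K he
    refine lt_of_le_of_ne (SimpleGraph.deleteEdges_le _) fun h => ?_
    have : e ∈ (K.deleteEdges {e}).edgeSet := by rw [h]; exact he
    simp [SimpleGraph.edgeSet_deleteEdges] at this
  by_cases heG : e ∈ G.edgeSet
  · refine (linkResidualCloseness_le heG).trans_lt (closeness_lt_of_lt ?_)
    obtain ⟨f, hfH, hfG⟩ := Set.exists_of_ssubset (SimpleGraph.edgeSet_ssubset_edgeSet.mpr hGH)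
    rw [← SimpleGraph.edgeSet_ssubset_edgeSet, SimpleGraph.edgeSet_deleteEdges,
      SimpleGraph.edgeSet_deleteEdges]
    refine Set.ssubset_iff_exists.mpr
      ⟨Set.sdiff_subset_sdiff_left (SimpleGraph.edgeSet_mono hGH.le), f, ⟨hfH, ?_⟩, fun h => hfG h.1⟩
    rintro rfl
    exact hfG heG
  · obtain ⟨f, hf⟩ := hG
    refine ((linkResidualCloseness_le hf).trans_lt
      (closeness_lt_of_lt (hdel hf))).trans_le (closeness_le_of_le ?_)
    rw [← SimpleGraph.edgeSet_subset_edgeSet, SimpleGraph.edgeSet_deleteEdges]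
    rintro f hf
    refine ⟨SimpleGraph.edgeSet_mono hGH.le hf, ?_⟩
    rintro rfl
    exact heG hf

end CutVertexCloseness

namespace CutVertexCloseness

/-! ### The values of the extremal graphs -/

theorem cutValue_nine : cutValue 9 4 5 2 = 15.25 := by
  have : balanced (4 - 1) (5 - 2) = Multiset.replicate 3 1 := rfl
  rw [cutValue, this, slotScore, slotPairs_replicate, slotSum_replicate, slot_one]
  norm_num

theorem cutValue_eleven : cutValue 11 5 6 2 = 24.5 := by
  have : balanced (5 - 1) (6 - 2) = Multiset.replicate 4 1 := rfl
  rw [cutValue, this, slotScore, slotPairs_replicate, slotSum_replicate, slot_one]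
  norm_num

theorem IsTwoCliques.counts {V : Type*} [Fintype V] {Γ : SimpleGraph V} {m k s t : ℕ}
    (h : IsTwoCliques Γ k s t) (hs : 2 ≤ s) (ht : 2 ≤ t) (hn : Fintype.card V = m + k) :
    m = s + t ∧ k = m + 1 := by
  obtain ⟨c, w, us, h, rfl, rfl, hp⟩ := h
  obtain ⟨-, h1, h2⟩ := h.residual_le_of_two_cliques (q := 0) hn hs ht hp
  exact ⟨h1, by simpa using h2⟩

theorem IsTwoCliques.residual_le {V : Type*} [Fintype V] {Γ : SimpleGraph V}
    (h : IsTwoCliques Γ 5 2 2) (hn : Fintype.card V = 9) : linkResidualCloseness Γ ≤ 16 := by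
  obtain ⟨c, w, us, h, hw, hus, hp⟩ := h
  obtain ⟨h1, -, -⟩ := h.residual_le_of_two_cliques (q := 0) (m := 4) hn hw.ge hus.ge hp
  rw [hw, hus, zero_add, slot_one] at h1
  have := cutValue_nine
  norm_num at h1 this
  linarith

theorem cutValue_le_graphPK {n k : ℕ} (hm : 3 ≤ n - k) (hk : 0 < k) :
    cutValue (n - k + k) (n - k) k ((k + (n - k) - 1) / (n - k)) ≤
      linkResidualCloseness (graphPK n k) := by
  obtain ⟨Γ, h⟩ := exists_isBalancedPaths (by omega : 0 < n - k) k
  obtain ⟨φ⟩ := h.iso (by omega)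
  exact (h.cutValue_le hm hk).trans_eq (linkResidualCloseness_iso φ)

theorem le_graphH_three_three : 16 ≤ linkResidualCloseness (graphH 3 3) := by
  obtain ⟨Γ, h⟩ := exists_isTwoCliques 2 2 (by norm_num)
  obtain ⟨φ⟩ := h.iso
  have h1 := h.le_residual (Or.inl rfl)
  rw [linkResidualCloseness_iso φ] at h1
  simpa using h1

theorem le_graphH_three_four : 24.5 ≤ linkResidualCloseness (graphH 3 4) := by
  obtain ⟨Γ, h⟩ := exists_isTwoCliques 2 3 (by norm_num)
  obtain ⟨φ⟩ := h.iso
  have h1 := h.le_residual (Or.inr rfl)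
  rw [linkResidualCloseness_iso φ] at h1
  simpa using h1

end CutVertexCloseness

open CutVertexCloseness in
theorem theorem7p2 {V : Type*} [Fintype V] (G : SimpleGraph V) (hG : G.Connected)
    (n k q r : ℕ) (hn : Fintype.card V = n) (hk : {v : V | IsCutVertex G v}.ncard = k)
    (hk2 : 2 ≤ k) (hkn : k ≤ n - 3) (hqr : k = (n - k) * q + r) (hr : r < n - k) :
    ((n, k) = (9, 5) →
      linkResidualCloseness G ≤ 16 ∧
      (linkResidualCloseness G = 16 ↔ Nonempty (G ≃g graphH 3 3))) ∧
    ((n, k) ≠ (9, 5) →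
      linkResidualCloseness G ≤ cutVertexBound n k q r ∧
      ((n, k) ≠ (11, 6) →
        (linkResidualCloseness G = cutVertexBound n k q r ↔ Nonempty (G ≃g graphPK n k))) ∧
      ((n, k) = (11, 6) →
        (linkResidualCloseness G = cutVertexBound n k q r ↔
          Nonempty (G ≃g graphPK 11 6) ∨ Nonempty (G ≃g graphH 3 4)))) := by
  obtain ⟨Γ, L, hle, hrep, hL⟩ := exists_isRep hG (by omega)
  rw [hk] at hrep
  have hnmk : n - k + k = n := by omega
  have hbound := hrep.residual_bound hL (m := n - k) (by omega) (by omega) hk2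
  rw [hnmk] at hbound
  have hle' : linkResidualCloseness G ≤ linkResidualCloseness Γ ∧
      (linkResidualCloseness G = linkResidualCloseness Γ → G = Γ) := by
    rcases hle.eq_or_lt with rfl | hlt
    · exact ⟨le_rfl, fun _ => rfl⟩
    · have hne : G.edgeSet.Nonempty := by
        have : Nontrivial V := Fintype.one_lt_card_iff_nontrivial.mp (by omega)
        obtain ⟨v⟩ := hG.nonempty
        obtain ⟨w, hw⟩ := hG.preconnected.exists_adj_of_nontrivial v
        exact ⟨s(v, w), hw⟩
      have := linkResidualCloseness_lt hlt hne
      exact ⟨this.le, fun h => absurd h this.ne⟩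
  have hceil : (k + (n - k) - 1) / (n - k) = if r = 0 then q else q + 1 := by
    split_ifs with h0
    · rw [Nat.div_eq_iff (by omega)]
      constructor <;> rw [mul_comm] <;> omega
    · rw [Nat.div_eq_iff (by omega)]
      constructor <;> rw [mul_comm] <;> simp only [mul_add, mul_one] <;> omega
  have hval := cutVertexBound_eq_cutValue (n := n) (k := k) (q := q) (r := r) (by omega) hqr hr
  rw [← hceil] at hval
  rw [← hval] at hbound
  have hPK : Nonempty (G ≃g graphPK n k) →
      cutVertexBound n k q r ≤ linkResidualCloseness G := by
    rintro ⟨φ⟩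
    rw [linkResidualCloseness_iso φ, hval]
    have := cutValue_le_graphPK (n := n) (k := k) (by omega) (by omega)
    rwa [hnmk] at this
  have hcounts : ∀ s t, 2 ≤ s → 2 ≤ t → IsTwoCliques Γ k s t → n - k = s + t ∧ k = n - k + 1 :=
    fun s t hs ht h => h.counts hs ht (by omega)
  constructor
  · intro h95
    obtain ⟨rfl, rfl⟩ := Prod.mk.inj h95
    have hB : cutVertexBound 9 5 q r < 16 := by
      obtain ⟨rfl, rfl⟩ : q = 1 ∧ r = 1 := by omega
      rw [hval]
      norm_num [cutValue_nine]
    have hcase : linkResidualCloseness Γ < 16 ∨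
        linkResidualCloseness Γ ≤ 16 ∧ IsTwoCliques Γ 5 2 2 := by
      rcases hbound with h | ⟨h, -⟩ | h
      · exact Or.inl (h.trans hB)
      · exact Or.inl (h.trans_lt hB)
      · exact Or.inr ⟨h.residual_le hn, h⟩
    have hle16 : linkResidualCloseness Γ ≤ 16 := by
      rcases hcase with h | h
      · exact h.le
      · exact h.1
    refine ⟨hle'.1.trans hle16, fun h => ?_, fun ⟨φ⟩ => ?_⟩
    · obtain rfl := hle'.2 (le_antisymm hle'.1 (h ▸ hle16))
      exact (hcase.resolve_left h.ge.not_gt).2.iso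
    · refine le_antisymm (hle'.1.trans hle16) ?_
      rw [linkResidualCloseness_iso φ]
      exact le_graphH_three_three
  · intro h95
    have hcase : linkResidualCloseness Γ < cutVertexBound n k q r ∨
        linkResidualCloseness Γ ≤ cutVertexBound n k q r ∧
          (IsBalancedPaths Γ (n - k) k ∨ IsTwoCliques Γ k 2 3) := by
      rcases hbound with h | h | h
      · exact Or.inl h
      · exact Or.inr h
      · have := hcounts 2 2 le_rfl le_rfl h
        exact absurd (Prod.ext (by simp only; omega) (by simp only; omega)) h95
    have hleB : linkResidualCloseness Γ ≤ cutVertexBound n k q r := by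
      rcases hcase with h | h
      · exact h.le
      · exact h.1
    have heq : linkResidualCloseness G = cutVertexBound n k q r →
        IsBalancedPaths G (n - k) k ∨ IsTwoCliques G k 2 3 := fun h => by
      obtain rfl := hle'.2 (le_antisymm hle'.1 (h ▸ hleB))
      exact (hcase.resolve_left h.ge.not_gt).2
    refine ⟨hle'.1.trans hleB, fun h116 => ⟨fun h => ?_, fun h => ?_⟩, fun h116 => ?_⟩
    · rcases heq h with h | h
      · exact h.iso (by omega)
      · have := h.counts (m := n - k) le_rfl (by norm_num) (by omega)
        exact absurd (Prod.ext (by simp only; omega) (by simp only; omega)) h116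
    · exact le_antisymm (hle'.1.trans hleB) (hPK h)
    · obtain ⟨rfl, rfl⟩ := Prod.mk.inj h116
      refine ⟨fun h => ?_, ?_⟩
      · rcases heq h with h | h
        · exact Or.inl (h.iso (by norm_num))
        · exact Or.inr h.iso
      · rintro (h | ⟨⟨φ⟩⟩)
        · exact le_antisymm (hle'.1.trans hleB) (hPK h)
        · refine le_antisymm (hle'.1.trans hleB) ?_
          rw [linkResidualCloseness_iso φ, hval]
          refine le_of_eq_of_le ?_ le_graphH_three_four
          norm_num [cutValue_eleven]
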